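/- Let $\mathbb K$ be a field of characteristic different from $2$, let $s\ge 1$ be an integer, and let $(g_{\lambda\mu})_{0\le\lambda,\mu\le s}$ be the matrix of a nondegenerate symmetric bilinear form on $\mathbb K^{s+1}$, with inverse matrix $(g^{\lambda\mu})$. Repeated up-down indices are summed. Let $E=\bigoplus_{\lambda=0}^{s}\mathbb K\nabla_\lambda$, let $T(E)$ be its tensor algebra, and let $$W^\rho=g^{\lambda\mu}g^{\nu\rho}[\nabla_\lambda,[\nabla_\mu,\nabla_\nu]]\in E^{\otimes 3},\qquad R=\sum_\rho\mathbb K W^\rho .$$ For arbitrary coefficients $j^{\mu\nu\rho},j^{\lambda\rho},j^\rho\in\mathbb K$ put $J^\rho=j^{\mu\nu\rho}\nabla_\mu\otimes\nabla_\nu+j^{\lambda\rho}\nabla_\lambda+j^\rho 1$, and let $U=T(E)/(\{W^\rho-J^\rho\mid 0\le\rho\le s\})$ be the inhomogeneous Yang–Mills algebra, filtered by the images of $\bigoplus_{i\le n}E^{\otimes i}$, and $A=T(E)/(R)$ the (homogeneous) Yang–Mills algebra. One says that $U$ has the PBW property if the natural graded algebra morphism $A\to\mathrm{gr}(U)$ is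 an isomorphism, and that $U$ is Koszul if moreover the cubic homogeneous algebra $A$ is Koszul, i.e. its Koszul complex $\cdots\to A\otimes W_4\to A\otimes R\to A\otimes E\to A$ is exact in positive degrees (the terms are $A\otimes W_{n(i)}$ with $n(2p)=3p$, $n(2p+1)=3p+1$ and $W_m=E^{\otimes m}\cap\bigcap_{a+3+b=m}E^{\otimes a}\otimes R\otimes E^{\otimes b}$; the differential multiplies the first $n(i)-n(i-1)$ tensor factors into $A$). Then $U$ is Koszul if and only if it has the PBW property, and this is the case if and only if there are $b_\rho,\ \omega^{\alpha\beta\gamma},\ s^{\alpha\beta\gamma},\ s^{\alpha\beta},\ s^\alpha\in\mathbb K$ with $$\begin{aligned} j^{\alpha\beta\gamma}&=(g^{\alpha\rho}g^{\beta\gamma}-g^{\alpha\gamma}g^{\beta\rho})b_\rho+\omega^{\alpha\beta\gamma}+s^{\alpha\beta\gamma},\\ j^{\alpha\beta}&=-\tfrac12\,\omega^{\alpha\beta\rho}b_\rho+s^{\alpha\beta},\\ j^\alpha&=s^\alpha,\end{aligned}$$ where $\omega^{\alpha\beta\gamma}$ is completely antisymmetric, $s^{\alpha\beta\gamma}$ is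 completely symmetric with $s^{\alpha\beta\rho}b_\rho=0$, $s^{\alpha\beta}$ is symmetric with $s^{\alpha\rho}b_\rho=0$, and $s^\rho b_\rho=0$. -/

import Mathlib

open scoped TensorProduct

noncomputable section

namespace InhomYM

/-! ### Filtered quotients of the tensor algebra and the PBW property -/

section General

variable (K : Type*) [Field K] (V : Type*) [AddCommGroup V] [Module K V]

/-- The homogeneous component `V^{⊗n}` of the tensor algebra `T(V)`. -/
def tensorDeg (n : ℕ) : Submodule K (TensorAlgebra K V) :=
  LinearMap.range (TensorAlgebra.ι K (M := V)) ^ n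

instance tensorDegGraded : GradedAlgebra fun n => tensorDeg K V n :=
  inferInstanceAs (GradedAlgebra fun n => LinearMap.range (TensorAlgebra.ι K (M := V)) ^ n)

/-- The sum `⨁_{i < n} V^{⊗i}`.  The usual filtration `F^n = ⨁_{i ≤ n} V^{⊗i}` of `T(V)` is
`tensorBelow K V (n + 1)`, and `F^{n-1}` (with `F^{-1} = 0`) is `tensorBelow K V n`. -/
def tensorBelow (n : ℕ) : Submodule K (TensorAlgebra K V) :=
  ⨆ i : Fin n, tensorDeg K V i

variable {K V}

/-- The two-sided ideal `(P)` of `T(V)` generated by a subspace `P`. -/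
def relIdeal (P : Submodule K (TensorAlgebra K V)) : TwoSidedIdeal (TensorAlgebra K V) :=
  TwoSidedIdeal.span (P : Set (TensorAlgebra K V))

/-- The algebra `T(V)/(P)`. -/
abbrev QuotAlg (P : Submodule K (TensorAlgebra K V)) : Type _ :=
  (relIdeal P).ringCon.Quotient

/-- The canonical projection `T(V) → T(V)/(P)`. -/
def toQuot (P : Submodule K (TensorAlgebra K V)) : TensorAlgebra K V →ₐ[K] QuotAlg P :=
  RingCon.mkₐ K (relIdeal P).ringCon

theorem toQuot_eq_zero_iff (P : Submodule K (TensorAlgebra K V)) (x : TensorAlgebra K V) :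
    toQuot P x = 0 ↔ x ∈ relIdeal P := by
  rw [TwoSidedIdeal.mem_iff, ← RingCon.eq]
  rfl

/-- The image in `T(V)/(P)` of `⨁_{i < n} V^{⊗i}`; so the filtration `F^n U` of `U = T(V)/(P)` is
`quotBelow P (n + 1)`, and `F^{n-1} U` is `quotBelow P n`. -/
def quotBelow (P : Submodule K (TensorAlgebra K V)) (n : ℕ) : Submodule K (QuotAlg P) :=
  (tensorBelow K V n).map (toQuot P).toLinearMap

/-- The degree `n` part `F^n U / F^{n-1} U` of the associated graded algebra of `U = T(V)/(P)`. -/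
abbrev GrPart (P : Submodule K (TensorAlgebra K V)) (n : ℕ) : Type _ :=
  ↥(quotBelow P (n + 1)) ⧸ (quotBelow P n).submoduleOf (quotBelow P (n + 1))

/-- For `P ⊆ F^N`, the space `R = π(P)` of leading parts, where `π : F^N → V^{⊗N}` is the projection
modulo `F^{N-1}`. -/
def leadingPart (N : ℕ) (P : Submodule K (TensorAlgebra K V)) :
    Submodule K (TensorAlgebra K V) :=
  (P ⊔ tensorBelow K V N) ⊓ tensorDeg K V N

/-- The degree `n` component `A_n` of `A = T(V)/(R)`: the image of `V^{⊗n}`. -/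
def quotDeg (R : Submodule K (TensorAlgebra K V)) (n : ℕ) : Submodule K (QuotAlg R) :=
  (tensorDeg K V n).map (toQuot R).toLinearMap

theorem tensorDeg_le_tensorBelow {n m : ℕ} (h : n < m) :
    tensorDeg K V n ≤ tensorBelow K V m :=
  le_iSup (fun i : Fin m => tensorDeg K V i) ⟨n, h⟩

/-- The map `V^{⊗n} → F^n U / F^{n-1} U` sending `x` to the class of its image in `U`. -/
def tensorToGr (P : Submodule K (TensorAlgebra K V)) (n : ℕ) :
    ↥(tensorDeg K V n) →ₗ[K] GrPart P n :=
  (Submodule.mkQ _).comp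
    ((toQuot P).toLinearMap.restrict (p := tensorDeg K V n) (q := quotBelow P (n + 1))
      fun _ hx => Submodule.mem_map_of_mem (tensorDeg_le_tensorBelow (Nat.lt_succ_self n) hx))

/-- The map `V^{⊗n} → A_n`. -/
def tensorToDeg (R : Submodule K (TensorAlgebra K V)) (n : ℕ) :
    ↥(tensorDeg K V n) →ₗ[K] ↥(quotDeg R n) :=
  (toQuot R).toLinearMap.restrict (p := tensorDeg K V n) (q := quotDeg R n)
    fun _ hx => Submodule.mem_map_of_mem hx

theorem tensorToDeg_surjective (R : Submodule K (TensorAlgebra K V)) (n : ℕ) :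
    Function.Surjective (tensorToDeg R n) := by
  rintro ⟨_, x, hx, rfl⟩
  exact ⟨⟨x, hx⟩, rfl⟩

theorem mul_mul_mem_tensorBelow {i j N : ℕ} {a y b : TensorAlgebra K V}
    (ha : a ∈ tensorDeg K V i) (hy : y ∈ tensorBelow K V N) (hb : b ∈ tensorDeg K V j) :
    a * y * b ∈ tensorBelow K V (i + N + j) := by
  unfold tensorBelow at hy
  induction hy using Submodule.iSup_induction' with
  | mem k y hy =>
    have h : a * y * b ∈ tensorDeg K V (i + k + j) := by
      unfold tensorDeg at *
      rw [pow_add, pow_add]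
      exact Submodule.mul_mem_mul (Submodule.mul_mem_mul ha hy) hb
    exact tensorDeg_le_tensorBelow (by omega) h
  | zero => simp
  | add y z _ _ h1 h2 =>
    rw [mul_add, add_mul]
    exact add_mem h1 h2

/-- Every homogeneous component of an element of `(R)` lies, modulo `(P)`, in lower filtration
degree. -/
theorem proj_mem_quotBelow (N : ℕ) (P : Submodule K (TensorAlgebra K V))
    {x : TensorAlgebra K V} (hx : x ∈ relIdeal (leadingPart N P)) (n : ℕ) :
    toQuot P (GradedAlgebra.proj (fun i => tensorDeg K V i) n x) ∈ quotBelow P n := by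
  have key : ∀ r ∈ leadingPart N P, ∀ a b : TensorAlgebra K V,
      toQuot P (GradedAlgebra.proj (fun i => tensorDeg K V i) n (a * r * b)) ∈
        quotBelow P n := by
    intro r hr a b
    induction a using DirectSum.Decomposition.inductionOn (fun i => tensorDeg K V i) with
    | zero => simp
    | add a a' h1 h2 => rw [add_mul, add_mul, map_add, map_add]; exact add_mem h1 h2
    | @homogeneous i a =>
      induction b using DirectSum.Decomposition.inductionOn (fun i => tensorDeg K V i) with
      | zero => simp
      | add b b' h1 h2 => rw [mul_add, map_add, map_add]; exact add_mem h1 h2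
      | @homogeneous j b =>
        obtain ⟨hr1, hr2⟩ := hr
        have hdeg : (a : TensorAlgebra K V) * r * b ∈ tensorDeg K V (i + N + j) := by
          have ha := a.2
          have hb := b.2
          unfold tensorDeg at *
          rw [pow_add, pow_add]
          exact Submodule.mul_mem_mul (Submodule.mul_mem_mul ha hr2) hb
        by_cases hn : i + N + j = n
        · subst hn
          rw [GradedAlgebra.proj_apply,
            DirectSum.decompose_of_mem_same (fun i => tensorDeg K V i) hdeg]
          obtain ⟨p, hp, y, hy, rfl⟩ := Submodule.mem_sup.1 hr1
          rw [mul_add, add_mul, map_add]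
          have h0 : toQuot P ((a : TensorAlgebra K V) * p * b) = 0 := by
            rw [map_mul, map_mul, (toQuot_eq_zero_iff P p).2 (TwoSidedIdeal.subset_span hp)]
            simp
          rw [h0, zero_add]
          exact Submodule.mem_map_of_mem (mul_mul_mem_tensorBelow a.2 hy b.2)
        · rw [GradedAlgebra.proj_apply,
            DirectSum.decompose_of_mem_ne (fun i => tensorDeg K V i) hdeg hn]
          simp
  rw [relIdeal, TwoSidedIdeal.mem_span_iff_mem_addSubgroup_closure] at hx
  induction hx using AddSubgroup.closure_induction with
  | mem x hx =>
    obtain ⟨y, ⟨a, _, r, hr, rfl⟩, b, _, rfl⟩ := hx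
    exact key r hr a b
  | zero => simp
  | add x y _ _ h1 h2 => rw [map_add, map_add]; exact add_mem h1 h2
  | neg x _ h => rw [map_neg, map_neg]; exact neg_mem h

theorem ker_tensorToDeg_le (N : ℕ) (P : Submodule K (TensorAlgebra K V)) (n : ℕ) :
    LinearMap.ker (tensorToDeg (leadingPart N P) n) ≤ LinearMap.ker (tensorToGr P n) := by
  rintro ⟨x, hx⟩ h
  have h0 : toQuot (leadingPart N P) x = 0 := congrArg Subtype.val h
  have h1 := proj_mem_quotBelow N P ((toQuot_eq_zero_iff _ _).1 h0) n
  rw [GradedAlgebra.proj_apply,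
    DirectSum.decompose_of_mem_same (fun i => tensorDeg K V i) hx] at h1
  exact (Submodule.Quotient.mk_eq_zero _).2 h1

/-- The degree `n` part `p_n : A_n → F^n U / F^{n-1} U` of the natural morphism `p : A → gr(U)`,
where `U = T(V)/(P)`, `A = T(V)/(R)` and `R = π(P)`: the class of `x ∈ V^{⊗n}` in `A_n` is sent to
the class of the image of `x` in `U`. -/
def naturalMap (N : ℕ) (P : Submodule K (TensorAlgebra K V)) (n : ℕ) :
    ↥(quotDeg (leadingPart N P) n) →ₗ[K] GrPart P n :=
  ((LinearMap.ker (tensorToDeg (leadingPart N P) n)).liftQ (tensorToGr P n)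
      (ker_tensorToDeg_le N P n)).comp
    ((tensorToDeg (leadingPart N P) n).quotKerEquivOfSurjective
      (tensorToDeg_surjective _ n)).symm.toLinearMap

theorem naturalMap_tensorToDeg (N : ℕ) (P : Submodule K (TensorAlgebra K V)) (n : ℕ)
    (x : ↥(tensorDeg K V n)) :
    naturalMap N P n (tensorToDeg (leadingPart N P) n x) = tensorToGr P n x := by
  have h : ((tensorToDeg (leadingPart N P) n).quotKerEquivOfSurjective
      (tensorToDeg_surjective _ n)).symm (tensorToDeg (leadingPart N P) n x) =
      Submodule.Quotient.mk x := by
    rw [LinearEquiv.symm_apply_eq]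
    rfl
  unfold naturalMap
  rw [LinearMap.comp_apply, LinearEquiv.coe_coe, h]
  rfl

/-- The PBW property of `U = T(V)/(P)`, for `P ⊆ F^N`: the natural graded morphism `A → gr(U)` is an
isomorphism. -/
def HasPBW (N : ℕ) (P : Submodule K (TensorAlgebra K V)) : Prop :=
  ∀ n : ℕ, Function.Bijective (naturalMap N P n)

/-! ### Koszulity of `N`-homogeneous algebras -/

/-- The algebra morphism `T(V) → End(T(V) × (V ⊗ T(V)))` for which `v ∈ V` acts by
`(t, u) ↦ (v t, v ⊗ t)`. -/
def peelAction : TensorAlgebra K V →ₐ[K]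
    Module.End K (TensorAlgebra K V × (V ⊗[K] TensorAlgebra K V)) :=
  TensorAlgebra.lift K
    { toFun := fun v =>
        ((LinearMap.mulLeft K (TensorAlgebra.ι K v)).prod (TensorProduct.mk K V _ v)).comp
          (LinearMap.fst K _ _)
      map_add' := by
        intro v w
        refine LinearMap.ext fun z => ?_
        simp [add_mul]
      map_smul' := by
        intro c v
        refine LinearMap.ext fun z => ?_
        simp }

/-- The linear map `T(V) → V ⊗ T(V)` that splits off the first tensor factor:
`v t ↦ v ⊗ t` and `1 ↦ 0`. -/
def peel : TensorAlgebra K V →ₗ[K] V ⊗[K] TensorAlgebra K V :=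
  (LinearMap.snd K _ _).comp
    ((LinearMap.applyₗ ((1 : TensorAlgebra K V), (0 : V ⊗[K] TensorAlgebra K V))).comp
      peelAction.toLinearMap)

theorem peel_one : peel (1 : TensorAlgebra K V) = 0 := by
  simp [peel]

theorem peelAction_fst (t : TensorAlgebra K V) (z : TensorAlgebra K V × (V ⊗[K] TensorAlgebra K V)) :
    (peelAction t z).1 = t * z.1 := by
  induction t using TensorAlgebra.induction generalizing z with
  | algebraMap r => simp [Algebra.smul_def]
  | ι v => simp [peelAction]
  | mul a b ha hb => rw [map_mul, Module.End.mul_apply, ha, hb, mul_assoc]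
  | add a b ha hb => rw [map_add, LinearMap.add_apply, Prod.fst_add, ha, hb, add_mul]

theorem peel_ι_mul (v : V) (t : TensorAlgebra K V) :
    peel (TensorAlgebra.ι K v * t) = v ⊗ₜ[K] t := by
  have h := peelAction_fst t ((1 : TensorAlgebra K V), (0 : V ⊗[K] TensorAlgebra K V))
  simp only [mul_one] at h
  have h2 : ∀ z, (peelAction (TensorAlgebra.ι K v) z).2 = v ⊗ₜ[K] z.1 := by
    intro z
    simp [peelAction]
  simp only [peel, LinearMap.comp_apply, AlgHom.toLinearMap_apply, map_mul,
    LinearMap.applyₗ_apply_apply, LinearMap.snd_apply, Module.End.mul_apply]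
  rw [h2, h]

/-- The linear endomorphism of `A ⊗ T(V)`, `A = T(V)/(R)`, that moves one tensor factor to the left:
`a ⊗ v t ↦ a v ⊗ t` for `v ∈ V`, and `a ⊗ 1 ↦ 0`. -/
def shiftMap (R : Submodule K (TensorAlgebra K V)) :
    Module.End K (QuotAlg R ⊗[K] TensorAlgebra K V) :=
  (LinearMap.rTensor (TensorAlgebra K V)
      (TensorProduct.lift
        ((LinearMap.mul K (QuotAlg R)).compl₂
          ((toQuot R).toLinearMap.comp (TensorAlgebra.ι K))))).comp
    ((TensorProduct.assoc K (QuotAlg R) V (TensorAlgebra K V)).symm.toLinearMap.comp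
      (LinearMap.lTensor (QuotAlg R) peel))

theorem shiftMap_tmul (R : Submodule K (TensorAlgebra K V)) (a : QuotAlg R) (v : V)
    (t : TensorAlgebra K V) :
    shiftMap R (a ⊗ₜ[K] (TensorAlgebra.ι K v * t)) =
      (a * toQuot R (TensorAlgebra.ι K v)) ⊗ₜ[K] t := by
  simp [shiftMap, peel_ι_mul]

/-- `W_m = ⋂_{i + N + j = m} V^{⊗i} ⊗ R ⊗ V^{⊗j} ⊆ V^{⊗m}`, which is `V^{⊗m}` for `m < N`. -/
def koszulW (N : ℕ) (R : Submodule K (TensorAlgebra K V)) (m : ℕ) :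
    Submodule K (TensorAlgebra K V) :=
  tensorDeg K V m ⊓
    ⨅ (i : ℕ) (j : ℕ) (_ : i + N + j = m), tensorDeg K V i * R * tensorDeg K V j

/-- The jump function: `2p ↦ N p` and `2p + 1 ↦ N p + 1`. -/
def jump (N i : ℕ) : ℕ := N * (i / 2) + i % 2

/-- The `i`-th term `A ⊗ W_{jump i}` of the Koszul complex of `A = T(V)/(R)`, as a subspace of
`A ⊗ T(V)`. -/
def koszulTerm (N : ℕ) (R : Submodule K (TensorAlgebra K V)) (i : ℕ) :
    Submodule K (QuotAlg R ⊗[K] TensorAlgebra K V) :=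
  LinearMap.range (LinearMap.lTensor (QuotAlg R) (koszulW N R (jump N i)).subtype)

/-- The differential from the `i`-th to the `(i-1)`-st term of the Koszul complex: it moves
`jump i - jump (i - 1)` tensor factors (one if `i` is odd, `N - 1` if `i` is even) to the left. -/
def koszulD (N : ℕ) (R : Submodule K (TensorAlgebra K V)) (i : ℕ) :
    Module.End K (QuotAlg R ⊗[K] TensorAlgebra K V) :=
  shiftMap R ^ (jump N i - jump N (i - 1))

/-- The `N`-homogeneous algebra `A = T(V)/(R)`, `R ⊆ V^{⊗N}`, is Koszul: its Koszul complex
`⋯ → A ⊗ W_{N+1} → A ⊗ R → A ⊗ V → A` is exact in positive degrees. -/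
def IsKoszulHomogeneous (N : ℕ) (R : Submodule K (TensorAlgebra K V)) : Prop :=
  ∀ i : ℕ, 1 ≤ i →
    (koszulTerm N R (i + 1)).map (koszulD N R (i + 1)) =
      koszulTerm N R i ⊓ LinearMap.ker (koszulD N R i)

/-- The nonhomogeneous algebra `U = T(V)/(P)`, `P ⊆ F^N`, is Koszul: its homogeneous part
`A = T(V)/(R)`, `R = π(P)`, is Koszul and `U` has the PBW property. -/
def IsKoszul (N : ℕ) (P : Submodule K (TensorAlgebra K V)) : Prop :=
  IsKoszulHomogeneous N (leadingPart N P) ∧ HasPBW N P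

end General

/-! ### Inhomogeneous Yang–Mills algebras -/

section YangMills

variable {K : Type*} [Field K] {s : ℕ}

/-- The generator `∇_λ` of the tensor algebra of `E = K^{s+1}`. -/
def nabla (l : Fin (s + 1)) : TensorAlgebra K (Fin (s + 1) → K) :=
  TensorAlgebra.ι K (Pi.single l 1)

/-- `W^ρ = g^{λμ} g^{νρ} [∇_λ, [∇_μ, ∇_ν]]`, where `(g^{λμ})` is the inverse matrix of
`g = (g_{λμ})`. -/
def ymW (g : Matrix (Fin (s + 1)) (Fin (s + 1)) K) (r : Fin (s + 1)) :
    TensorAlgebra K (Fin (s + 1) → K) :=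
  ∑ l, ∑ m, ∑ n, (g⁻¹ l m * g⁻¹ n r) • ⁅nabla (K := K) l, ⁅nabla (K := K) m, nabla n⁆⁆

/-- The current `J^ρ = j^{μνρ} ∇_μ ∇_ν + j^{λρ} ∇_λ + j^ρ 1`. -/
def current (j₃ : Fin (s + 1) → Fin (s + 1) → Fin (s + 1) → K)
    (j₂ : Fin (s + 1) → Fin (s + 1) → K) (j₁ : Fin (s + 1) → K) (r : Fin (s + 1)) :
    TensorAlgebra K (Fin (s + 1) → K) :=
  (∑ m, ∑ n, j₃ m n r • (nabla m * nabla n)) + (∑ l, j₂ l r • nabla l) + j₁ r • 1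

/-- The space of relations `W^ρ - J^ρ` of the inhomogeneous Yang–Mills algebra. -/
def ymRelations (g : Matrix (Fin (s + 1)) (Fin (s + 1)) K)
    (j₃ : Fin (s + 1) → Fin (s + 1) → Fin (s + 1) → K)
    (j₂ : Fin (s + 1) → Fin (s + 1) → K) (j₁ : Fin (s + 1) → K) :
    Submodule K (TensorAlgebra K (Fin (s + 1) → K)) :=
  Submodule.span K (Set.range fun r => ymW g r - current j₃ j₂ j₁ r)

end YangMills

end InhomYM

end

/-! The homogeneous Yang–Mills algebra `A` is Koszul whatever the current is, and an inhomogeneous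
deformation of it has the PBW property as soon as one syzygy lifts. The rest is linear algebra with
the coefficients of the current.

Since the characteristic is not 2, write `g⁻¹ = ∑ d_k v_k v_kᵀ` in a basis `v` with all `d_k ≠ 0`.
The relations become `r_l = ∑ d_k [v_k, [v_k, v_l]]`. Put `x = v_0`, `y_i = v_i` and `z_i = [x,
y_i]` for `i ≥ 1`. The relation `r_0` only says `∑ d_i [y_i, z_i] = 0`, and the others prescribe
`[x, z_i]`. So `A` is the Ore extension `B[x; δ]` of the one-relator algebra `B = T(y, z)/(∑ d_i
[y_i, z_i])`, and `A = ⊕ B xⁿ` (`lie_yzToYm`, `ymCoeff_mul_pow`, `ymCoeff_injective`).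

Write `r_k = ∑ q_{kl} v_l`. The Koszul complex is `0 → A → A^{s+1} → A^{s+1} → A`, with middle map
given by `q` and outer maps by the `d_k v_k` and the `v_l`. Exactness at the last `A^{s+1}` is the
description `I = T R + I V` of the ideal `I = (R)` (`exists_rcoord_toQuot`). Exactness at the other
one is the heart of the proof (`exists_eq_mul_of_sum_mul_rcoord`): it follows by comparing degrees
in `x`, and from the regularity of `y_i` in `B` (`yz_isRegular`). It also gives `W_4 = K ∑ d_k v_k
r_k` and `W_5 = 0`.

Exactness means that `∑ d_k [v_k, r_k] = 0` is essentially the only syzygy. Therefore PBW holds if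
and only if the defect `∑ d_k [v_k, J(v_k)]`, left when `r_k` is replaced by `r_k - J(v_k)`, lies in
the space of inhomogeneous relations itself (`mem_idealBelow_of_mem_defPairs`,
`hasPBW_ymDefRels_iff`). In the original basis the defect is `∑ [∇_ρ, J^ρ]`, so the condition reads
`∑ [∇_ρ, J^ρ] = -∑ b_ρ (W^ρ - J^ρ)` for some `b`. Comparing coefficients in degrees 3, 2, 1, 0 and
splitting tensors by symmetry gives the stated form of the current
(`exists_current_decomposition_iff`). -/

open scoped TensorProduct

noncomputable section

namespace InhomYM

/-! ### Right coordinates on the tensor algebra, degrees, and ideals generated by relations. -/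

section TensorCoordinates

variable {K : Type*} [Field K] {V : Type*} [AddCommGroup V] [Module K V]

open TensorAlgebra

/-- The algebra morphism `t ↦ !![t, D t; 0, ε t]`, where `ε` is the augmentation and `D` splits off
the last tensor factor and evaluates it with `f`. -/
def rcoordHom (f : V →ₗ[K] K) :
    TensorAlgebra K V →ₐ[K] Matrix (Fin 2) (Fin 2) (TensorAlgebra K V) :=
  TensorAlgebra.lift K
    { toFun := fun v => !![ι K v, algebraMap K _ (f v); 0, 0]
      map_add' := by intro v w; ext i j; fin_cases i <;> fin_cases j <;> simp
      map_smul' := by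
        intro c v; ext i j
        fin_cases i <;> fin_cases j <;> simp [Algebra.smul_def] }

theorem rcoordHom_ι (f : V →ₗ[K] K) (v : V) :
    rcoordHom f (ι K v) = !![ι K v, algebraMap K _ (f v); 0, 0] := by
  simp [rcoordHom]

theorem rcoordHom_entries (f : V →ₗ[K] K) (t : TensorAlgebra K V) :
    rcoordHom f t 0 0 = t ∧ rcoordHom f t 1 0 = 0 ∧
      rcoordHom f t 1 1 = algebraMap K _ (algebraMapInv t) := by
  induction t using TensorAlgebra.induction with
  | algebraMap r =>
    rw [AlgHom.commutes]
    simp [Matrix.algebraMap_matrix_apply, algebraMap_leftInverse _ _]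
  | ι v => rw [rcoordHom_ι]; simp [algebraMapInv]
  | mul a b ha hb =>
    obtain ⟨a1, a2, a3⟩ := ha
    obtain ⟨b1, b2, b3⟩ := hb
    rw [map_mul]
    simp [Matrix.mul_apply, Fin.sum_univ_two, a1, a2, a3, b1, b2, b3]
  | add a b ha hb =>
    obtain ⟨a1, a2, a3⟩ := ha
    obtain ⟨b1, b2, b3⟩ := hb
    rw [map_add]
    simp [a1, a2, a3, b1, b2, b3]

/-- The linear endomorphism of `T(V)` that splits off the last tensor factor and evaluates it
with `f`: `t v ↦ f(v) t` and `1 ↦ 0`. -/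
def rcoord (f : V →ₗ[K] K) : TensorAlgebra K V →ₗ[K] TensorAlgebra K V where
  toFun t := rcoordHom f t 0 1
  map_add' a b := by rw [map_add]; rfl
  map_smul' c a := by rw [map_smul]; rfl

/-- This is the upper right entry of a product of triangular matrices. The second term disappears
when `b` has no constant term, so on the augmentation ideal `rcoord f` is left `T(V)`-linear. -/
theorem rcoord_mul (f : V →ₗ[K] K) (a b : TensorAlgebra K V) :
    rcoord f (a * b) = a * rcoord f b + algebraMapInv b • rcoord f a := by
  change rcoordHom f (a * b) 0 1 = a * rcoordHom f b 0 1 + algebraMapInv b • rcoordHom f a 0 1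
  rw [map_mul, Matrix.mul_apply, Fin.sum_univ_two, (rcoordHom_entries f a).1,
    (rcoordHom_entries f b).2.2, Algebra.smul_def, Algebra.commutes]

theorem rcoord_ι (f : V →ₗ[K] K) (v : V) : rcoord f (ι K v) = algebraMap K _ (f v) := by
  change rcoordHom f (ι K v) 0 1 = _
  rw [rcoordHom_ι]
  simp

theorem algebraMapInv_ι (v : V) : algebraMapInv (ι K v) = 0 := by simp [algebraMapInv]

@[simp] theorem rcoord_mul_ι (f : V →ₗ[K] K) (t : TensorAlgebra K V) (v : V) :
    rcoord f (t * ι K v) = f v • t := by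
  rw [rcoord_mul, rcoord_ι, algebraMapInv_ι, zero_smul, add_zero, Algebra.smul_def,
    Algebra.commutes]

@[simp] theorem rcoord_algebraMap (f : V →ₗ[K] K) (c : K) :
    rcoord f (algebraMap K (TensorAlgebra K V) c) = 0 := by
  change rcoordHom f (algebraMap K _ c) 0 1 = _
  rw [AlgHom.commutes]
  simp [Matrix.algebraMap_matrix_apply]

@[simp] theorem rcoord_one (f : V →ₗ[K] K) : rcoord f (1 : TensorAlgebra K V) = 0 := by
  simpa using rcoord_algebraMap f (1 : K)

/-- Together with `sum_mul_ι_eq_zero`: the augmentation ideal is a free left `T(V)`-module on a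
basis of `V`, with coordinate functions `rcoord`. -/
theorem eq_sum_rcoord {κ : Type*} [Fintype κ] (v : Module.Basis κ K V) (t : TensorAlgebra K V) :
    t = algebraMap K _ (algebraMapInv t) + ∑ i, rcoord (v.coord i) t * ι K (v i) := by
  induction t using TensorAlgebra.induction with
  | algebraMap r => simp [algebraMap_leftInverse _ _]
  | ι w =>
    conv_lhs => rw [← v.sum_repr w]
    simp only [rcoord_ι, algebraMapInv_ι, map_sum, map_smul, map_zero, zero_add, Algebra.smul_def,
      Module.Basis.coord_apply]
  | mul a b ha hb =>
    have ha' := eq_sub_of_add_eq' ha.symm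
    have hb' := eq_sub_of_add_eq' hb.symm
    simp only [rcoord_mul, add_mul, Finset.sum_add_distrib, smul_mul_assoc, ← Finset.smul_sum,
      mul_assoc, ← Finset.mul_sum]
    rw [ha', hb', Algebra.smul_def, mul_sub, mul_sub, map_mul, map_mul,
      Algebra.commutes (algebraMapInv b) a, ← map_mul (algebraMap K (TensorAlgebra K V)),
      ← map_mul (algebraMap K (TensorAlgebra K V)), mul_comm (algebraMapInv b)]
    abel
  | add a b ha hb =>
    simp only [map_add, add_mul, Finset.sum_add_distrib]
    conv_lhs => rw [ha, hb]
    abel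

theorem sum_mul_ι_eq_zero {κ : Type*} [Fintype κ] [DecidableEq κ] (v : Module.Basis κ K V)
    {u : κ → TensorAlgebra K V} (h : ∑ i, u i * ι K (v i) = 0) (i : κ) : u i = 0 := by
  have := congrArg (rcoord (v.coord i)) h
  simpa [Finsupp.single_apply] using this

/-! ### Degrees -/

theorem one_mem_tensorDeg : (1 : TensorAlgebra K V) ∈ tensorDeg K V 0 := by
  unfold tensorDeg; rw [pow_zero]; exact Submodule.one_le.mp le_rfl

theorem ι_mem_tensorDeg (v : V) : ι K v ∈ tensorDeg K V 1 := by
  unfold tensorDeg; rw [pow_one]; exact ⟨v, rfl⟩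

theorem mul_mem_tensorDeg {i j n : ℕ} {a b : TensorAlgebra K V} (ha : a ∈ tensorDeg K V i)
    (hb : b ∈ tensorDeg K V j) (h : i + j = n) : a * b ∈ tensorDeg K V n := by
  subst h; unfold tensorDeg at *; rw [pow_add]; exact Submodule.mul_mem_mul ha hb

theorem tensorDeg_succ (n : ℕ) :
    tensorDeg K V (n + 1) = tensorDeg K V n * LinearMap.range (ι K (M := V)) := by
  unfold tensorDeg; rw [pow_succ]

theorem mem_tensorDeg_zero {t : TensorAlgebra K V} :
    t ∈ tensorDeg K V 0 ↔ ∃ c : K, t = algebraMap K _ c := by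
  unfold tensorDeg; rw [pow_zero, Submodule.mem_one]
  exact ⟨fun ⟨c, h⟩ => ⟨c, h.symm⟩, fun ⟨c, h⟩ => ⟨c, h.symm⟩⟩

theorem rcoord_mem_of_mem_mul {M : Submodule K (TensorAlgebra K V)} {t : TensorAlgebra K V}
    (ht : t ∈ M * LinearMap.range (ι K (M := V))) (f : V →ₗ[K] K) : rcoord f t ∈ M := by
  induction ht using Submodule.mul_induction_on' with
  | mem_mul_mem m hm n hn =>
    obtain ⟨v, rfl⟩ := hn
    rw [rcoord_mul_ι]; exact M.smul_mem _ hm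
  | add x _ y _ hx hy => rw [map_add]; exact add_mem hx hy

theorem algebraMapInv_of_mem_mul {M : Submodule K (TensorAlgebra K V)} {t : TensorAlgebra K V}
    (ht : t ∈ M * LinearMap.range (ι K (M := V))) : algebraMapInv t = 0 := by
  induction ht using Submodule.mul_induction_on' with
  | mem_mul_mem m hm n hn =>
    obtain ⟨v, rfl⟩ := hn
    rw [map_mul, algebraMapInv_ι, mul_zero]
  | add x _ y _ hx hy => rw [map_add, hx, hy, add_zero]

theorem rcoord_mem_tensorDeg {n : ℕ} {t : TensorAlgebra K V} (ht : t ∈ tensorDeg K V (n + 1))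
    (f : V →ₗ[K] K) : rcoord f t ∈ tensorDeg K V n :=
  rcoord_mem_of_mem_mul (tensorDeg_succ (K := K) (V := V) n ▸ ht) f

theorem algebraMapInv_of_mem_tensorDeg {n : ℕ} {t : TensorAlgebra K V}
    (ht : t ∈ tensorDeg K V (n + 1)) : algebraMapInv t = 0 :=
  algebraMapInv_of_mem_mul (tensorDeg_succ (K := K) (V := V) n ▸ ht)

theorem rcoord_mul_of_mem (f : V →ₗ[K] K) (a : TensorAlgebra K V) {b : TensorAlgebra K V}
    (hb : algebraMapInv b = 0) : rcoord f (a * b) = a * rcoord f b := by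
  rw [rcoord_mul, hb, zero_smul, add_zero]

theorem eq_sum_rcoord_of_mem {κ : Type*} [Fintype κ] (v : Module.Basis κ K V)
    {t : TensorAlgebra K V} (ht : algebraMapInv t = 0) :
    t = ∑ i, rcoord (v.coord i) t * ι K (v i) := by
  conv_lhs => rw [eq_sum_rcoord v t, ht, map_zero, zero_add]

variable (K V) in
/-- The projection of `T(V)` onto its component of degree `n`. -/
abbrev tproj (n : ℕ) : TensorAlgebra K V →ₗ[K] TensorAlgebra K V :=
  GradedAlgebra.proj (fun i => tensorDeg K V i) n

theorem tproj_mem (n : ℕ) (t : TensorAlgebra K V) : tproj K V n t ∈ tensorDeg K V n := by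
  rw [GradedAlgebra.proj_apply]; exact SetLike.coe_mem _

theorem tproj_of_mem {n : ℕ} {t : TensorAlgebra K V} (ht : t ∈ tensorDeg K V n) :
    tproj K V n t = t := by
  rw [GradedAlgebra.proj_apply, DirectSum.decompose_of_mem_same (fun i => tensorDeg K V i) ht]

theorem tproj_of_mem_ne {m n : ℕ} {t : TensorAlgebra K V} (ht : t ∈ tensorDeg K V m)
    (h : m ≠ n) : tproj K V n t = 0 := by
  rw [GradedAlgebra.proj_apply, DirectSum.decompose_of_mem_ne (fun i => tensorDeg K V i) ht h]

theorem tproj_induction {C : TensorAlgebra K V → Prop} (zero : C 0)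
    (mem : ∀ n, ∀ t ∈ tensorDeg K V n, C t) (add : ∀ a b, C a → C b → C (a + b))
    (t : TensorAlgebra K V) : C t := by
  induction t using DirectSum.Decomposition.inductionOn (fun i => tensorDeg K V i) with
  | zero => exact zero
  | add a b ha hb => exact add a b ha hb
  | @homogeneous i m => exact mem i m m.2

theorem tproj_mul {j : ℕ} {b : TensorAlgebra K V} (hb : b ∈ tensorDeg K V j) (n : ℕ)
    (a : TensorAlgebra K V) : tproj K V (n + j) (a * b) = tproj K V n a * b := by
  induction a using tproj_induction with
  | zero => simp
  | mem m a ha =>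
    by_cases h : m = n
    · subst h
      rw [tproj_of_mem ha, tproj_of_mem (mul_mem_tensorDeg ha hb rfl)]
    · rw [tproj_of_mem_ne ha h, tproj_of_mem_ne (mul_mem_tensorDeg ha hb rfl) (by omega), zero_mul]
  | add a c h1 h2 => rw [add_mul, map_add, h1, h2, map_add, add_mul]

theorem tproj_mul_of_lt {j n : ℕ} {b : TensorAlgebra K V} (hb : b ∈ tensorDeg K V j) (h : n < j)
    (a : TensorAlgebra K V) : tproj K V n (a * b) = 0 := by
  induction a using tproj_induction with
  | zero => simp
  | mem m a ha => exact tproj_of_mem_ne (mul_mem_tensorDeg ha hb rfl) (by omega)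
  | add a c h1 h2 => rw [add_mul, map_add, h1, h2, add_zero]

theorem rcoord_tproj (f : V →ₗ[K] K) (n : ℕ) (t : TensorAlgebra K V) :
    rcoord f (tproj K V (n + 1) t) = tproj K V n (rcoord f t) := by
  induction t using tproj_induction with
  | zero => simp
  | mem m t ht =>
    by_cases h : m = n + 1
    · subst h
      rw [tproj_of_mem ht, tproj_of_mem (rcoord_mem_tensorDeg ht f)]
    · rw [tproj_of_mem_ne ht h, map_zero]
      cases m with
      | zero => obtain ⟨c, rfl⟩ := mem_tensorDeg_zero.1 ht; simp
      | succ m => rw [tproj_of_mem_ne (rcoord_mem_tensorDeg ht f) (by omega)]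
  | add a c h1 h2 => simp only [map_add, h1, h2]

theorem mem_of_tproj_mem {M : Submodule K (TensorAlgebra K V)} {t : TensorAlgebra K V}
    (h : ∀ n, tproj K V n t ∈ M) : t ∈ M := by
  classical
  rw [← DirectSum.sum_support_decompose (fun i => tensorDeg K V i) t]
  exact sum_mem fun i _ => by simpa only [GradedAlgebra.proj_apply] using h i

theorem tproj_of_mem_tensorBelow {m n : ℕ} (h : m ≤ n) {t : TensorAlgebra K V}
    (ht : t ∈ tensorBelow K V m) : tproj K V n t = 0 := by
  have : tensorBelow K V m ≤ LinearMap.ker (tproj K V n) :=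
    iSup_le fun i => fun x hx => tproj_of_mem_ne hx (by omega)
  exact this ht

theorem tensorBelow_mono {m n : ℕ} (h : m ≤ n) : tensorBelow K V m ≤ tensorBelow K V n :=
  iSup_le fun i => tensorDeg_le_tensorBelow (by omega)

theorem tensorBelow_succ (n : ℕ) :
    tensorBelow K V (n + 1) = tensorBelow K V n ⊔ tensorDeg K V n := by
  apply le_antisymm
  · refine iSup_le fun i => ?_
    by_cases h : (i : ℕ) = n
    · rw [h]; exact le_sup_right
    · exact le_trans (tensorDeg_le_tensorBelow (by omega)) le_sup_left
  · exact sup_le (tensorBelow_mono (by omega)) (tensorDeg_le_tensorBelow (by omega))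

/-! ### The ideal of relations -/

theorem toQuot_surjective (R : Submodule K (TensorAlgebra K V)) :
    Function.Surjective (toQuot R) := RingCon.mkₐ_surjective _

theorem toQuot_of_mem {R : Submodule K (TensorAlgebra K V)} {r : TensorAlgebra K V} (h : r ∈ R) :
    toQuot R r = 0 :=
  (toQuot_eq_zero_iff R r).2 (TwoSidedIdeal.subset_span h)

/-- Induction principle for the ideal `(R)`. The set `S` only has to be a subspace, not an ideal,
because the products `a r b` already span `(R)`. -/
theorem mem_of_toQuot_eq_zero {R S : Submodule K (TensorAlgebra K V)}
    (h : ∀ r ∈ R, ∀ a b, a * r * b ∈ S) {x : TensorAlgebra K V} (hx : toQuot R x = 0) :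
    x ∈ S := by
  rw [toQuot_eq_zero_iff, relIdeal, TwoSidedIdeal.mem_span_iff_mem_addSubgroup_closure] at hx
  induction hx using AddSubgroup.closure_induction with
  | mem x hx =>
    obtain ⟨y, ⟨a, _, r, hr, rfl⟩, b, _, rfl⟩ := hx
    exact h r hr a b
  | zero => exact zero_mem _
  | add x y _ _ h1 h2 => exact add_mem h1 h2
  | neg x _ h => exact neg_mem h

/-- The algebra morphism out of `T(V)/(R)` induced by a morphism that vanishes on `R`. -/
def quotLift {S : Type*} [Ring S] [Algebra K S] (R : Submodule K (TensorAlgebra K V))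
    (f : TensorAlgebra K V →ₐ[K] S) (h : ∀ r ∈ R, f r = 0) : QuotAlg R →ₐ[K] S :=
  (relIdeal R).ringCon.liftₐ f (by
    have : relIdeal R ≤ TwoSidedIdeal.ker f := by
      refine TwoSidedIdeal.span_le.2 fun r hr => ?_
      exact (TwoSidedIdeal.mem_ker _).2 (h r hr)
    intro x y hxy
    have h1 : x - y ∈ relIdeal R := (TwoSidedIdeal.rel_iff _ _ _).1 hxy
    have h2 := (TwoSidedIdeal.mem_ker _).1 (this h1)
    rw [map_sub, sub_eq_zero] at h2
    exact h2)

@[simp] theorem quotLift_toQuot {S : Type*} [Ring S] [Algebra K S]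
    (R : Submodule K (TensorAlgebra K V))
    (f : TensorAlgebra K V →ₐ[K] S) (h : ∀ r ∈ R, f r = 0) (x : TensorAlgebra K V) :
    quotLift R f h (toQuot R x) = f x := rfl

/-- An ideal with homogeneous generators is homogeneous. Only the right factor `b` has to be split
into components, since `tproj_mul` lets the left factor absorb the projection. -/
theorem tproj_toQuot {N : ℕ} {R : Submodule K (TensorAlgebra K V)} (hR : R ≤ tensorDeg K V N)
    {x : TensorAlgebra K V} (hx : toQuot R x = 0) (n : ℕ) : toQuot R (tproj K V n x) = 0 := by
  refine mem_of_toQuot_eq_zero (S := LinearMap.ker ((toQuot R).toLinearMap.comp (tproj K V n)))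
    (fun r hr a b => ?_) hx
  rw [LinearMap.mem_ker, LinearMap.comp_apply, AlgHom.toLinearMap_apply]
  induction b using tproj_induction with
  | zero => simp
  | add b c h1 h2 => rw [mul_add, map_add, map_add, h1, h2, add_zero]
  | mem j b hb =>
    by_cases h : N + j ≤ n
    · obtain ⟨k, rfl⟩ := Nat.exists_eq_add_of_le h
      rw [mul_assoc, add_comm (N + j) k, tproj_mul (mul_mem_tensorDeg (hR hr) hb rfl), map_mul,
        map_mul, toQuot_of_mem hr, zero_mul, mul_zero]
    · rw [mul_assoc, tproj_mul_of_lt (mul_mem_tensorDeg (hR hr) hb rfl) (by omega), map_zero]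

theorem tproj_eq_zero_of_toQuot {N : ℕ} {R : Submodule K (TensorAlgebra K V)}
    (hR : R ≤ tensorDeg K V N) {x : TensorAlgebra K V} (hx : toQuot R x = 0) {n : ℕ} (hn : n < N) :
    tproj K V n x = 0 := by
  refine mem_of_toQuot_eq_zero (S := LinearMap.ker (tproj K V n)) (fun r hr a b => ?_) hx
  rw [LinearMap.mem_ker]
  induction b using tproj_induction with
  | zero => simp
  | add b c h1 h2 => rw [mul_add, map_add, h1, h2, add_zero]
  | mem j b hb =>
    rw [mul_assoc, tproj_mul_of_lt (mul_mem_tensorDeg (hR hr) hb rfl) (by omega)]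

theorem eq_zero_of_toQuot {N : ℕ} {R : Submodule K (TensorAlgebra K V)}
    (hR : R ≤ tensorDeg K V N) {n : ℕ} (hn : n < N) {x : TensorAlgebra K V}
    (hx : x ∈ tensorDeg K V n) (h : toQuot R x = 0) : x = 0 := by
  rw [← tproj_of_mem hx, tproj_eq_zero_of_toQuot hR h hn]

theorem mem_of_toQuot {N : ℕ} {R : Submodule K (TensorAlgebra K V)}
    (hR : R ≤ tensorDeg K V N) {x : TensorAlgebra K V}
    (hx : x ∈ tensorDeg K V N) (h : toQuot R x = 0) : x ∈ R := by
  rw [← tproj_of_mem hx]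
  refine mem_of_toQuot_eq_zero (S := R.comap (tproj K V N)) (fun r hr a b => ?_) h
  rw [Submodule.mem_comap]
  induction b using tproj_induction with
  | zero => simp
  | add b c h1 h2 => rw [mul_add, map_add]; exact add_mem h1 h2
  | mem j b hb =>
    rw [mul_assoc]
    -- In degree `N` only `j = 0` contributes, and then both outer factors have degree 0 and are
    -- scalars.
    by_cases hj : j = 0
    · subst hj
      have := tproj_mul (mul_mem_tensorDeg (hR hr) hb rfl) 0 a
      rw [add_zero, zero_add] at this
      rw [this]
      obtain ⟨c, rfl⟩ := mem_tensorDeg_zero.1 hb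
      obtain ⟨c', h'⟩ := mem_tensorDeg_zero.1 (tproj_mem 0 a)
      rw [h', ← Algebra.commutes, ← Algebra.smul_def, ← Algebra.smul_def]
      exact R.smul_mem _ (R.smul_mem _ hr)
    · rw [tproj_mul_of_lt (mul_mem_tensorDeg (hR hr) hb rfl) (by omega)]
      exact zero_mem _

/-- `I = T R + I V` for the ideal `I = (R)`. -/
theorem exists_rcoord_toQuot {κ : Type*} [Fintype κ] {r : κ → TensorAlgebra K V}
    (hr : ∀ k, algebraMapInv (r k) = 0) {x : TensorAlgebra K V}
    (hx : toQuot (Submodule.span K (Set.range r)) x = 0) :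
    ∃ c : κ → TensorAlgebra K V, ∀ f : V →ₗ[K] K,
      toQuot (Submodule.span K (Set.range r)) (rcoord f x) =
        toQuot (Submodule.span K (Set.range r)) (∑ k, c k * rcoord f (r k)) := by
  set R := Submodule.span K (Set.range r) with hR
  let m : (κ → TensorAlgebra K V) →ₗ[K] TensorAlgebra K V :=
    ∑ k, (LinearMap.mulRight K (r k)).comp (LinearMap.proj k)
  have hm : ∀ c, m c = ∑ k, c k * r k := fun c => by simp [m]
  -- In a product `a r b`, a constant `b` is absorbed into `a`; otherwise the last letter of `b`
  -- splits off and what remains is still in the ideal.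
  have key : x ∈ LinearMap.range m ⊔
      LinearMap.ker (toQuot R).toLinearMap * LinearMap.range (ι K (M := V)) := by
    refine mem_of_toQuot_eq_zero (fun r' hr' a b => ?_) hx
    induction b using tproj_induction with
    | zero => rw [mul_zero]; exact zero_mem _
    | add b c h1 h2 => rw [mul_add]; exact add_mem h1 h2
    | mem n b hb =>
      cases n with
      | zero =>
        obtain ⟨c, rfl⟩ := mem_tensorDeg_zero.1 hb
        obtain ⟨α, rfl⟩ := (Submodule.mem_span_range_iff_exists_fun K).1 hr'
        refine Submodule.mem_sup_left ⟨fun k => (c * α k) • a, ?_⟩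
        rw [hm, ← Algebra.commutes, ← Algebra.smul_def, Finset.mul_sum, Finset.smul_sum]
        simp [smul_smul]
      | succ n =>
        rw [tensorDeg_succ] at hb
        refine Submodule.mem_sup_right ?_
        induction hb using Submodule.mul_induction_on' with
        | mem_mul_mem b' _ v hv =>
          rw [← mul_assoc]
          refine Submodule.mul_mem_mul ?_ hv
          simp [toQuot_of_mem hr']
        | add y _ z _ hy hz => rw [mul_add]; exact add_mem hy hz
  obtain ⟨_, ⟨c, rfl⟩, u, hu, rfl⟩ := Submodule.mem_sup.1 key
  refine ⟨c, fun f => ?_⟩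
  have h0 : toQuot R (rcoord f u) = 0 := rcoord_mem_of_mem_mul hu f
  rw [map_add, map_add, h0, add_zero, hm, map_sum]
  exact congrArg _ (Finset.sum_congr rfl fun k _ => rcoord_mul_of_mem f _ (hr k))

/-- The homogeneous form of `exists_rcoord_toQuot`. -/
theorem exists_rcoord_toQuot_of_mem {κ : Type*} [Fintype κ] {N : ℕ} {r : κ → TensorAlgebra K V}
    (hr : ∀ k, r k ∈ tensorDeg K V (N + 1)) {n : ℕ} {x : TensorAlgebra K V}
    (hxn : x ∈ tensorDeg K V (n + N + 1))
    (hx : toQuot (Submodule.span K (Set.range r)) x = 0) :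
    ∃ c : κ → TensorAlgebra K V, (∀ k, c k ∈ tensorDeg K V n) ∧ ∀ f : V →ₗ[K] K,
      toQuot (Submodule.span K (Set.range r)) (rcoord f x) =
        toQuot (Submodule.span K (Set.range r)) (∑ k, c k * rcoord f (r k)) := by
  obtain ⟨c, hc⟩ := exists_rcoord_toQuot (fun k => algebraMapInv_of_mem_tensorDeg (hr k)) hx
  have hR : Submodule.span K (Set.range r) ≤ tensorDeg K V (N + 1) :=
    Submodule.span_le.2 (by rintro _ ⟨k, rfl⟩; exact hr k)
  refine ⟨fun k => tproj K V n (c k), fun k => tproj_mem _ _, fun f => ?_⟩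
  have h1 := hc f
  rw [← sub_eq_zero, ← map_sub] at h1 ⊢
  have h2 := tproj_toQuot hR h1 (n + N)
  rw [map_sub, ← rcoord_tproj, tproj_of_mem hxn, map_sum] at h2
  rw [← h2]
  congr 2
  exact Finset.sum_congr rfl fun k _ => (tproj_mul (rcoord_mem_tensorDeg (hr k) f) n _).symm

end TensorCoordinates

/-! ### The one-relator algebra `B = T(y, z)/(∑ d_i [y_i, z_i])` and its derivation `δ`. -/

section OreModel

open TensorAlgebra

/-- The `(i, k)` summand has the form `F(i, k) - F(k, i)` with `F(i, k) = d_i d_k (y_i² y_k² - 2 y_i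
y_k y_i y_k)`, so the double sum cancels. The identity serves twice: it makes `δ` compatible with
the relation of `B`, and it is the syzygy of the Yang–Mills relations that spans `W_4`. -/
theorem sum_smul_lie_lie_lie {K : Type*} [Field K] {S : Type*} [Ring S] [Algebra K S]
    {κ : Type*} [Fintype κ] (d : κ → K) (y : κ → S) :
    ∑ i, d i • ⁅y i, ∑ k, d k • ⁅y k, ⁅y k, y i⁆⁆⁆ = 0 := by
  have h : ∀ i k, d i • ⁅y i, d k • ⁅y k, ⁅y k, y i⁆⁆⁆ =
      (d i * d k) • (y i * y i * y k * y k - 2 * (y i * y k * y i * y k)) -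
        (d k * d i) • (y k * y k * y i * y i - 2 * (y k * y i * y k * y i)) := by
    intro i k
    rw [mul_comm (d k) (d i), ← smul_sub, mul_smul]
    simp only [Ring.lie_def, mul_smul_comm, smul_mul_assoc, ← smul_sub]
    congr 2
    noncomm_ring
  have h' : ∀ i, d i • ⁅y i, ∑ k, d k • ⁅y k, ⁅y k, y i⁆⁆⁆ =
      ∑ k, d i • ⁅y i, d k • ⁅y k, ⁅y k, y i⁆⁆⁆ := by
    intro i
    simp only [Ring.lie_def, Finset.mul_sum, Finset.sum_mul, ← Finset.sum_sub_distrib,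
      Finset.smul_sum]
  simp only [h', h, Finset.sum_sub_distrib]
  rw [sub_eq_zero, Finset.sum_comm]

variable {K : Type*} [Field K] {s : ℕ}

/-- The generators `y_i` (on the left) and `z_i` (on the right) of the free algebra on `2s`
letters. -/
def yzGen (j : Fin s ⊕ Fin s) : TensorAlgebra K (Fin s ⊕ Fin s → K) :=
  ι K (Pi.basisFun K _ j)

/-- The relation `∑ d_i [y_i, z_i]`. -/
def yzRel (d : Fin s → K) : TensorAlgebra K (Fin s ⊕ Fin s → K) :=
  ∑ i, d i • ⁅yzGen (K := K) (Sum.inl i), yzGen (Sum.inr i)⁆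

/-- The space spanned by the relation `∑ d_i [y_i, z_i]`. -/
def yzRels (d : Fin s → K) : Submodule K (TensorAlgebra K (Fin s ⊕ Fin s → K)) :=
  Submodule.span K (Set.range fun _ : Unit => yzRel d)

/-- The class of the generator with index `j` in `T(y, z)/(∑ d_i [y_i, z_i])`. -/
def yz (d : Fin s → K) (j : Fin s ⊕ Fin s) : QuotAlg (yzRels d) := toQuot _ (yzGen j)

theorem yzRel_mem (d : Fin s → K) : yzRel d ∈ tensorDeg K (Fin s ⊕ Fin s → K) 2 := by
  refine sum_mem fun i _ => Submodule.smul_mem _ _ ?_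
  rw [Ring.lie_def]
  exact sub_mem (mul_mem_tensorDeg (ι_mem_tensorDeg _) (ι_mem_tensorDeg _) rfl)
    (mul_mem_tensorDeg (ι_mem_tensorDeg _) (ι_mem_tensorDeg _) rfl)

theorem yzRels_le (d : Fin s → K) : yzRels d ≤ tensorDeg K (Fin s ⊕ Fin s → K) 2 :=
  Submodule.span_le.2 (by rintro _ ⟨_, rfl⟩; exact yzRel_mem d)

theorem sum_lie_yz (d : Fin s → K) :
    ∑ i, d i • ⁅yz d (Sum.inl i), yz d (Sum.inr i)⁆ = 0 := by
  have h : toQuot (yzRels d) (yzRel d) = 0 := toQuot_of_mem (Submodule.subset_span ⟨(), rfl⟩)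
  simpa only [yz, yzRel, map_sum, map_smul, Ring.lie_def, map_sub, map_mul] using h

theorem rcoord_yzRel (d : Fin s → K) (i : Fin s) :
    rcoord ((Pi.basisFun K _).coord (Sum.inr i)) (yzRel d) = d i • yzGen (Sum.inl i) := by
  simp only [yzRel, yzGen, Ring.lie_def, map_sum, map_smul, map_sub, rcoord_mul_ι]
  rw [Finset.sum_eq_single i]
  · simp
  · intro k _ hk
    simp [hk.symm]
  · simp

/-- If `t y_i` is in the ideal, then `I = T R + I V` provides one coefficient `c` of the single
relation. The coordinate of `t y_i` along `z_i` is zero, which gives `d_i c y_i ∈ I`, hence `c ∈ I`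
by induction on the degree. The coordinate along `y_i` then gives `t ∈ I`. -/
theorem yz_isRegular_of_mem {d : Fin s → K} (hd : ∀ i, d i ≠ 0) (i : Fin s) (n : ℕ) :
    ∀ t ∈ tensorDeg K (Fin s ⊕ Fin s → K) n,
      toQuot (yzRels d) (t * yzGen (Sum.inl i)) = 0 → toQuot (yzRels d) t = 0 := by
  have hself : ∀ t : TensorAlgebra K (Fin s ⊕ Fin s → K),
      rcoord ((Pi.basisFun K _).coord (Sum.inl i)) (t * yzGen (Sum.inl i)) = t := by
    intro t
    rw [yzGen, rcoord_mul_ι]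
    simp
  have hother : ∀ t : TensorAlgebra K (Fin s ⊕ Fin s → K),
      rcoord ((Pi.basisFun K _).coord (Sum.inr i)) (t * yzGen (Sum.inl i)) = 0 := by
    intro t
    rw [yzGen, rcoord_mul_ι]
    simp
  induction n with
  | zero =>
    intro t ht h
    have h0 := eq_zero_of_toQuot (yzRels_le d) (by norm_num : 0 + 1 < 2)
      (mul_mem_tensorDeg ht (ι_mem_tensorDeg _) rfl) h
    rw [← hself t, yzGen, h0, map_zero, map_zero]
  | succ n ih =>
    intro t ht h
    obtain ⟨c, hc, hf⟩ := exists_rcoord_toQuot_of_mem (N := 1) (fun _ : Unit => yzRel_mem d)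
      (mul_mem_tensorDeg ht (ι_mem_tensorDeg _) rfl) h
    have h1 := hf ((Pi.basisFun K _).coord (Sum.inr i))
    rw [← yzGen, hother, map_zero] at h1
    simp only [Fintype.sum_unique, rcoord_yzRel, mul_smul_comm, map_smul] at h1
    have h2 := ih _ (hc _) ((smul_eq_zero.1 h1.symm).resolve_left (hd i))
    have h3 := hf ((Pi.basisFun K _).coord (Sum.inl i))
    rw [← yzGen, hself, Fintype.sum_unique, map_mul] at h3
    change toQuot (yzRels d) t = toQuot (yzRels d) _ * toQuot (yzRels d) _ at h3
    rw [h3, h2, zero_mul]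

/-- Right multiplication by `y_i` is injective. -/
theorem yz_isRegular {d : Fin s → K} (hd : ∀ i, d i ≠ 0) (i : Fin s) {b : QuotAlg (yzRels d)}
    (h : b * yz d (Sum.inl i) = 0) : b = 0 := by
  obtain ⟨t, rfl⟩ := toQuot_surjective _ b
  rw [yz, ← map_mul] at h
  change t ∈ LinearMap.ker (toQuot (yzRels d)).toLinearMap
  refine mem_of_tproj_mem fun n => yz_isRegular_of_mem hd i n _ (tproj_mem _ _) ?_
  have h1 := tproj_toQuot (yzRels_le d) h (n + 1)
  rwa [yzGen, tproj_mul (ι_mem_tensorDeg _)] at h1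

/-- The image of `z_i` under the derivation with `y_i ↦ z_i`. -/
def yzDerivInr (d₀ : K) (d : Fin s → K) (i : Fin s) : QuotAlg (yzRels d) :=
  -(d₀⁻¹ • ∑ k, d k • ⁅yz d (Sum.inl k), ⁅yz d (Sum.inl k), yz d (Sum.inl i)⁆⁆)

theorem map_yzRel {S : Type*} [Ring S] [Algebra K S] (d : Fin s → K)
    (f : TensorAlgebra K (Fin s ⊕ Fin s → K) →ₐ[K] S) :
    f (yzRel d) = ∑ i, d i • ⁅f (yzGen (Sum.inl i)), f (yzGen (Sum.inr i))⁆ := by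
  simp only [yzRel, map_sum, map_smul, Ring.lie_def, map_sub, map_mul]

/-- The `ε`-part is `∑ d_i ([δ y_i, z_i] + [y_i, δ z_i])`, where the first brackets vanish because
`δ y_i = z_i`. Working in the dual numbers turns a derivation into an algebra morphism, which can be
defined on generators and pushed to the quotient. -/
theorem sum_smul_lie_trivSqZeroExt {S : Type*} [Ring S] [Algebra K S] {κ : Type*} [Fintype κ]
    (d : κ → K) (y z : κ → TrivSqZeroExt S S) (h : ∀ i, (y i).snd = (z i).fst)
    (h1 : ∑ i, d i • ⁅(y i).fst, (z i).fst⁆ = 0)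
    (h2 : ∑ i, d i • ⁅(y i).fst, (z i).snd⁆ = 0) :
    ∑ i, d i • ⁅y i, z i⁆ = 0 := by
  apply TrivSqZeroExt.ext
  · simpa [Ring.lie_def, TrivSqZeroExt.fst_sum] using h1
  · simp only [Ring.lie_def] at h2
    simp only [Ring.lie_def, TrivSqZeroExt.snd_sum, TrivSqZeroExt.snd_smul,
      TrivSqZeroExt.snd_sub, TrivSqZeroExt.snd_mul, h, smul_eq_mul, MulOpposite.smul_eq_mul_unop,
      MulOpposite.unop_op, TrivSqZeroExt.snd_zero]
    rw [← h2]
    refine Finset.sum_congr rfl fun i _ => ?_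
    congr 1
    abel

theorem sum_lie_yzDerivInr (d₀ : K) (d : Fin s → K) :
    ∑ i, d i • ⁅yz d (Sum.inl i), yzDerivInr d₀ d i⁆ = 0 := by
  have h : ∀ i, d i • ⁅yz d (Sum.inl i), yzDerivInr d₀ d i⁆ =
      -(d₀⁻¹ • (d i • ⁅yz d (Sum.inl i),
        ∑ k, d k • ⁅yz d (Sum.inl k), ⁅yz d (Sum.inl k), yz d (Sum.inl i)⁆⁆⁆)) := by
    intro i
    rw [yzDerivInr]
    generalize ∑ k, d k • ⁅yz d (Sum.inl k), ⁅yz d (Sum.inl k), yz d (Sum.inl i)⁆⁆ = u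
    rw [smul_comm d₀⁻¹, ← smul_neg]
    simp only [Ring.lie_def, mul_neg, neg_mul, mul_smul_comm, smul_mul_assoc]
    rw [← smul_sub, neg_sub_neg, ← smul_neg, ← smul_neg, neg_sub]
  simp only [h]
  rw [Finset.sum_neg_distrib, ← Finset.smul_sum, sum_smul_lie_lie_lie, smul_zero, neg_zero]

/-- The value of `b ↦ b + ε δ(b)` on the generator with index `j`. -/
def yzDerivGen (d₀ : K) (d : Fin s → K) (j : Fin s ⊕ Fin s) :
    TrivSqZeroExt (QuotAlg (yzRels d)) (QuotAlg (yzRels d)) :=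
  TrivSqZeroExt.inl (yz d j) +
    TrivSqZeroExt.inr (Sum.elim (fun i => yz d (Sum.inr i)) (yzDerivInr d₀ d) j)

theorem yzDerivGen_fst (d₀ : K) (d : Fin s → K) (j : Fin s ⊕ Fin s) :
    (yzDerivGen d₀ d j).fst = yz d j := by
  simp [yzDerivGen]

theorem yzDerivGen_snd (d₀ : K) (d : Fin s → K) (j : Fin s ⊕ Fin s) :
    (yzDerivGen d₀ d j).snd = Sum.elim (fun i => yz d (Sum.inr i)) (yzDerivInr d₀ d) j := by
  simp [yzDerivGen]

/-- The algebra morphism `b ↦ b + ε δ(b)` to the dual numbers. -/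
def yzDerivHom (d₀ : K) (d : Fin s → K) :
    QuotAlg (yzRels d) →ₐ[K] TrivSqZeroExt (QuotAlg (yzRels d)) (QuotAlg (yzRels d)) :=
  quotLift _ (TensorAlgebra.lift K ((Pi.basisFun K _).constr K (yzDerivGen d₀ d))) (by
    have hgen : ∀ j, TensorAlgebra.lift K ((Pi.basisFun K _).constr K (yzDerivGen d₀ d))
        (yzGen j) = yzDerivGen d₀ d j := by
      intro j
      rw [yzGen, TensorAlgebra.lift_ι_apply, Module.Basis.constr_basis]
    intro r hr
    obtain ⟨c, rfl⟩ := (Submodule.mem_span_range_iff_exists_fun K).1 hr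
    rw [Fintype.sum_unique, map_smul]
    have : TensorAlgebra.lift K ((Pi.basisFun K _).constr K (yzDerivGen d₀ d)) (yzRel d) = 0 := by
      rw [map_yzRel]
      simp only [hgen]
      refine sum_smul_lie_trivSqZeroExt d _ _ (fun i => ?_) ?_ ?_
      · rw [yzDerivGen_fst, yzDerivGen_snd, Sum.elim_inl]
      · simp only [yzDerivGen_fst, sum_lie_yz]
      · simp only [yzDerivGen_fst, yzDerivGen_snd, Sum.elim_inr, sum_lie_yzDerivInr]
    rw [this, smul_zero])

theorem yzDerivHom_yz (d₀ : K) (d : Fin s → K) (j : Fin s ⊕ Fin s) :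
    yzDerivHom d₀ d (yz d j) = yzDerivGen d₀ d j := by
  rw [yz, yzDerivHom, quotLift_toQuot, yzGen, TensorAlgebra.lift_ι_apply,
    Module.Basis.constr_basis]

theorem yzDerivHom_fst (d₀ : K) (d : Fin s → K) (b : QuotAlg (yzRels d)) :
    (yzDerivHom d₀ d b).fst = b := by
  have : (TrivSqZeroExt.fstHom K _ _).comp (yzDerivHom d₀ d) = AlgHom.id K _ := by
    have : ((TrivSqZeroExt.fstHom K _ _).comp (yzDerivHom d₀ d)).comp (toQuot (yzRels d)) =
        (AlgHom.id K _).comp (toQuot (yzRels d)) := by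
      apply TensorAlgebra.hom_ext
      refine (Pi.basisFun K _).ext fun j => ?_
      change (yzDerivHom d₀ d (yz d j)).fst = yz d j
      rw [yzDerivHom_yz, yzDerivGen_fst]
    refine AlgHom.ext fun b => ?_
    obtain ⟨t, rfl⟩ := toQuot_surjective _ b
    exact DFunLike.congr_fun this t
  exact DFunLike.congr_fun this b

/-- The derivation `δ` with `δ(y_i) = z_i` and `δ(z_i) = -d₀⁻¹ ∑ d_k [y_k, [y_k, y_i]]`. -/
def yzDeriv (d₀ : K) (d : Fin s → K) : QuotAlg (yzRels d) →ₗ[K] QuotAlg (yzRels d) where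
  toFun b := (yzDerivHom d₀ d b).snd
  map_add' a b := by rw [map_add]; rfl
  map_smul' c a := by rw [map_smul]; rfl

theorem yzDeriv_mul (d₀ : K) (d : Fin s → K) (a b : QuotAlg (yzRels d)) :
    yzDeriv d₀ d (a * b) = a * yzDeriv d₀ d b + yzDeriv d₀ d a * b := by
  have h : (yzDerivHom d₀ d (a * b)).snd =
      (yzDerivHom d₀ d a).fst * (yzDerivHom d₀ d b).snd +
        (yzDerivHom d₀ d a).snd * (yzDerivHom d₀ d b).fst := by
    rw [map_mul]; rfl
  rw [yzDerivHom_fst, yzDerivHom_fst] at h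
  exact h

theorem yzDeriv_one (d₀ : K) (d : Fin s → K) : yzDeriv d₀ d 1 = 0 := by
  change (yzDerivHom d₀ d 1).snd = 0
  rw [map_one]; rfl

theorem yzDeriv_inl (d₀ : K) (d : Fin s → K) (i : Fin s) :
    yzDeriv d₀ d (yz d (Sum.inl i)) = yz d (Sum.inr i) := by
  change (yzDerivHom d₀ d _).snd = _
  rw [yzDerivHom_yz, yzDerivGen_snd]; rfl

theorem yzDeriv_inr (d₀ : K) (d : Fin s → K) (i : Fin s) :
    yzDeriv d₀ d (yz d (Sum.inr i)) = yzDerivInr d₀ d i := by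
  change (yzDerivHom d₀ d _).snd = _
  rw [yzDerivHom_yz, yzDerivGen_snd]; rfl

end OreModel

/-! ### The Yang–Mills relations in an orthogonal basis, and the morphism from `B` to the Yang–Mills
algebra. -/

section YangMillsBasis

open TensorAlgebra

variable {K : Type*} [Field K] {V : Type*} [AddCommGroup V] [Module K V]

/-- The cubic map `u ↦ ∑ d_k [v_k, [v_k, u]]`. -/
def ymMap {κ : Type*} [Fintype κ] (v : κ → V) (d : κ → K) : V →ₗ[K] TensorAlgebra K V where
  toFun u := ∑ k, d k • ⁅ι K (v k), ⁅ι K (v k), ι K u⁆⁆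
  map_add' a b := by
    rw [← Finset.sum_add_distrib]
    refine Finset.sum_congr rfl fun k _ => ?_
    rw [map_add, ← smul_add]
    simp only [Ring.lie_def]
    congr 1
    noncomm_ring
  map_smul' c a := by
    rw [RingHom.id_apply, Finset.smul_sum]
    refine Finset.sum_congr rfl fun k _ => ?_
    rw [map_smul, smul_comm c]
    simp only [Ring.lie_def, mul_smul_comm, smul_mul_assoc, ← smul_sub]

theorem ymMap_apply {κ : Type*} [Fintype κ] (v : κ → V) (d : κ → K) (u : V) :
    ymMap v d u = ∑ k, d k • ⁅ι K (v k), ⁅ι K (v k), ι K u⁆⁆ := rfl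

theorem map_lie' {S T : Type*} [Ring S] [Ring T] [Algebra K S] [Algebra K T] (f : S →ₐ[K] T)
    (a b : S) : f ⁅a, b⁆ = ⁅f a, f b⁆ := by
  simp only [Ring.lie_def, map_sub, map_mul]

theorem map_ymMap {κ : Type*} [Fintype κ] {S : Type*} [Ring S] [Algebra K S] (v : κ → V)
    (d : κ → K) (u : V) (f : TensorAlgebra K V →ₐ[K] S) :
    f (ymMap v d u) = ∑ k, d k • ⁅f (ι K (v k)), ⁅f (ι K (v k)), f (ι K u)⁆⁆ := by
  simp only [ymMap_apply, map_sum, map_smul, map_lie']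

theorem ymMap_mem {κ : Type*} [Fintype κ] (v : κ → V) (d : κ → K) (u : V) :
    ymMap v d u ∈ tensorDeg K V 3 := by
  have h : ∀ (n : ℕ) (a : V), ∀ t ∈ tensorDeg K V n, ⁅ι K a, t⁆ ∈ tensorDeg K V (n + 1) := by
    intro n a t ht
    rw [Ring.lie_def]
    exact sub_mem (mul_mem_tensorDeg (ι_mem_tensorDeg _) ht (add_comm _ _))
      (mul_mem_tensorDeg ht (ι_mem_tensorDeg _) rfl)
  exact sum_mem fun k _ => Submodule.smul_mem _ _ (h 2 _ _ (h 1 _ _ (ι_mem_tensorDeg _)))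

theorem rcoord_ymMap {κ : Type*} [Fintype κ] (v : Module.Basis κ K V) (d : κ → K) (u : V) (l : κ) :
    rcoord (v.coord l) (ymMap v d u) =
      v.coord l u • ∑ k, d k • (ι K (v k) * ι K (v k)) +
        d l • (ι K u * ι K (v l) - 2 * (ι K (v l) * ι K u)) := by
  classical
  have h : ∀ k, ⁅ι K (v k), ⁅ι K (v k), ι K u⁆⁆ =
      ι K (v k) * ι K (v k) * ι K u + (ι K u * ι K (v k) - 2 * (ι K (v k) * ι K u)) * ι K (v k) := by
    intro k
    simp only [Ring.lie_def]
    noncomm_ring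
  simp only [ymMap_apply, h, map_sum, map_smul, map_add, rcoord_mul_ι, smul_add,
    Finset.sum_add_distrib, Finset.smul_sum]
  congr 1
  · exact Finset.sum_congr rfl fun k _ => smul_comm _ _ _
  · rw [Finset.sum_eq_single l]
    · simp
    · intro k _ hk
      simp [hk]
    · simp

/-- The span of the Yang–Mills relations `∑ d_k [v_k, [v_k, v_l]]`. -/
def ymRels {κ : Type*} [Fintype κ] (v : κ → V) (d : κ → K) : Submodule K (TensorAlgebra K V) :=
  Submodule.span K (Set.range fun k => ymMap v d (v k))

theorem ymRels_le {κ : Type*} [Fintype κ] (v : κ → V) (d : κ → K) :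
    ymRels v d ≤ tensorDeg K V 3 :=
  Submodule.span_le.2 (by rintro _ ⟨_, rfl⟩; exact ymMap_mem _ _ _)

theorem toQuot_ymMap {κ : Type*} [Fintype κ] (v : κ → V) (d : κ → K) (k : κ) :
    toQuot (ymRels v d) (ymMap v d (v k)) = 0 :=
  toQuot_of_mem (Submodule.subset_span ⟨k, rfl⟩)

/-- The class of `v_k` in the Yang–Mills algebra. -/
def ymGen {κ : Type*} [Fintype κ] (v : κ → V) (d : κ → K) (k : κ) : QuotAlg (ymRels v d) :=
  toQuot _ (ι K (v k))

theorem sum_lie_lie_ymGen {κ : Type*} [Fintype κ] (v : κ → V) (d : κ → K) (l : κ) :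
    ∑ k, d k • ⁅ymGen v d k, ⁅ymGen v d k, ymGen v d l⁆⁆ = 0 := by
  rw [← toQuot_ymMap v d l, map_ymMap]
  rfl

variable {s : ℕ} (v : Module.Basis (Fin (s + 1)) K V) (d : Fin (s + 1) → K)

/-- With `z_i = [v_0, v_i]`, the relation of index 0 is the negative of the defining relation of
`B`. -/
theorem sum_lie_lie_ymGen_zero :
    ∑ i : Fin s, d i.succ • ⁅ymGen v d i.succ, ⁅ymGen v d 0, ymGen v d i.succ⁆⁆ = 0 := by
  have h := sum_lie_lie_ymGen v d 0
  have h0 : ∀ a : QuotAlg (ymRels v d), ⁅a, ⁅a, a⁆⁆ = 0 := fun a => by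
    simp only [Ring.lie_def, sub_self, mul_zero, zero_mul]
  rw [Fin.sum_univ_succ, h0, smul_zero, zero_add] at h
  rw [← neg_eq_zero, ← h, ← Finset.sum_neg_distrib]
  refine Finset.sum_congr rfl fun i _ => ?_
  rw [← smul_neg]
  simp only [Ring.lie_def]
  congr 1
  noncomm_ring

/-- The relations of positive index, solved for `[v_0, z_i]`. The right-hand side is the value
prescribed for `δ(z_i)`, and this is why `δ` contains `d_0⁻¹`. -/
theorem lie_lie_ymGen_succ (hd : d 0 ≠ 0) (i : Fin s) :
    ⁅ymGen v d 0, ⁅ymGen v d 0, ymGen v d i.succ⁆⁆ =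
      -((d 0)⁻¹ • ∑ k : Fin s,
        d k.succ • ⁅ymGen v d k.succ, ⁅ymGen v d k.succ, ymGen v d i.succ⁆⁆) := by
  have h := sum_lie_lie_ymGen v d i.succ
  rw [Fin.sum_univ_succ] at h
  rw [← eq_neg_iff_add_eq_zero] at h
  rw [← smul_neg, ← h, inv_smul_smul₀ hd]

/-- The algebra morphism `y_i ↦ v_i`, `z_i ↦ [v_0, v_i]` to the Yang–Mills algebra. -/
def yzToYm : QuotAlg (yzRels fun i : Fin s => d i.succ) →ₐ[K] QuotAlg (ymRels v d) :=
  quotLift _ (TensorAlgebra.lift K ((Pi.basisFun K _).constr K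
      (Sum.elim (fun i => ymGen v d i.succ) fun i => ⁅ymGen v d 0, ymGen v d i.succ⁆))) (by
    intro r hr
    obtain ⟨c, rfl⟩ := (Submodule.mem_span_range_iff_exists_fun K).1 hr
    rw [Fintype.sum_unique, map_smul, map_yzRel]
    simp only [yzGen, TensorAlgebra.lift_ι_apply, Module.Basis.constr_basis, Sum.elim_inl,
      Sum.elim_inr, sum_lie_lie_ymGen_zero, smul_zero])

theorem yzToYm_inl (i : Fin s) :
    yzToYm v d (yz _ (Sum.inl i)) = ymGen v d i.succ := by
  rw [yz, yzToYm, quotLift_toQuot, yzGen, TensorAlgebra.lift_ι_apply,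
    Module.Basis.constr_basis, Sum.elim_inl]

theorem yzToYm_inr (i : Fin s) :
    yzToYm v d (yz _ (Sum.inr i)) = ⁅ymGen v d 0, ymGen v d i.succ⁆ := by
  rw [yz, yzToYm, quotLift_toQuot, yzGen, TensorAlgebra.lift_ι_apply,
    Module.Basis.constr_basis, Sum.elim_inr]

/-- The commutation rule `x b = b x + δ(b)` of the Ore extension. Both `[x, ·]` and `δ` obey the
Leibniz rule, so the generators suffice. -/
theorem lie_yzToYm (hd : d 0 ≠ 0) (b : QuotAlg (yzRels fun i : Fin s => d i.succ)) :
    ymGen v d 0 * yzToYm v d b = yzToYm v d b * ymGen v d 0 +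
      yzToYm v d (yzDeriv (d 0) _ b) := by
  have hgen : ∀ j, ymGen v d 0 * yzToYm v d (yz _ j) = yzToYm v d (yz _ j) * ymGen v d 0 +
      yzToYm v d (yzDeriv (d 0) _ (yz _ j)) := by
    rintro (i | i)
    · rw [yzDeriv_inl, yzToYm_inl, yzToYm_inr, Ring.lie_def]
      abel
    · rw [yzDeriv_inr, yzToYm_inr, yzDerivInr, map_neg, map_smul, map_sum]
      simp only [map_smul, map_lie', yzToYm_inl]
      rw [← lie_lie_ymGen_succ v d hd, Ring.lie_def (ymGen v d 0) ⁅_, _⁆]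
      abel
  obtain ⟨t, rfl⟩ := toQuot_surjective _ b
  induction t using TensorAlgebra.induction with
  | algebraMap r =>
    rw [AlgHom.commutes, AlgHom.commutes, Algebra.algebraMap_eq_smul_one
      (A := QuotAlg (yzRels fun i : Fin s => d i.succ)), map_smul, yzDeriv_one, smul_zero, map_zero,
      add_zero, Algebra.commutes]
  | ι w =>
    rw [← (Pi.basisFun K _).sum_repr w]
    simp only [map_sum, map_smul, Finset.mul_sum, Finset.sum_mul, ← Finset.sum_add_distrib,
      mul_smul_comm, smul_mul_assoc, ← smul_add]
    exact Finset.sum_congr rfl fun j _ => congrArg _ (hgen j)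
  | mul a b ha hb =>
    rw [map_mul, map_mul, yzDeriv_mul, map_add, map_mul, map_mul, ← mul_assoc, ha, add_mul,
      mul_assoc _ (ymGen v d 0), hb, mul_add]
    simp only [mul_assoc]
    abel
  | add a b ha hb =>
    simp only [map_add, mul_add, add_mul, ha, hb]
    abel

end YangMillsBasis

/-! ### The Yang–Mills algebra as the Ore extension `B[x; δ]`. -/

section OreRepresentation

open TensorAlgebra

variable {K : Type*} [Field K] {s : ℕ}

/-- The action of `x` on sequences in `T(y, z)/(∑ d_i [y_i, z_i])`, a sequence `f` standing for the
series `∑ f_n x^n`. -/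
def oreX (d₀ : K) (d : Fin s → K) : Module.End K (ℕ → QuotAlg (yzRels d)) where
  -- This encodes `x · b xⁿ = b xⁿ⁺¹ + δ(b) xⁿ`: the first summand is `f (n - 1)`, read as 0 for `n
  -- = 0`.
  toFun f n := Nat.casesOn n 0 f + yzDeriv d₀ d (f n)
  map_add' f g := by
    funext n
    cases n with
    | zero =>
      change 0 + yzDeriv d₀ d (f 0 + g 0) = 0 + yzDeriv d₀ d (f 0) + (0 + yzDeriv d₀ d (g 0))
      rw [map_add]
      abel
    | succ n =>
      change f n + g n + yzDeriv d₀ d (f (n + 1) + g (n + 1)) =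
        f n + yzDeriv d₀ d (f (n + 1)) + (g n + yzDeriv d₀ d (g (n + 1)))
      rw [map_add]
      abel
  map_smul' c f := by
    funext n
    cases n with
    | zero =>
      change 0 + yzDeriv d₀ d (c • f 0) = c • (0 + yzDeriv d₀ d (f 0))
      rw [map_smul, zero_add, zero_add]
    | succ n =>
      change c • f n + yzDeriv d₀ d (c • f (n + 1)) = c • (f n + yzDeriv d₀ d (f (n + 1)))
      rw [map_smul, smul_add]

theorem oreX_apply_zero (d₀ : K) (d : Fin s → K) (f : ℕ → QuotAlg (yzRels d)) :
    oreX d₀ d f 0 = yzDeriv d₀ d (f 0) := zero_add _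

theorem oreX_apply_succ (d₀ : K) (d : Fin s → K) (f : ℕ → QuotAlg (yzRels d)) (n : ℕ) :
    oreX d₀ d f (n + 1) = f n + yzDeriv d₀ d (f (n + 1)) := rfl

/-- The action of `T(y, z)/(∑ d_i [y_i, z_i])` on sequences by left multiplication. -/
def oreMul (d : Fin s → K) :
    QuotAlg (yzRels d) →ₐ[K] Module.End K (ℕ → QuotAlg (yzRels d)) :=
  Algebra.lsmul K K (ℕ → QuotAlg (yzRels d))

theorem oreMul_apply (d : Fin s → K) (b : QuotAlg (yzRels d)) (f : ℕ → QuotAlg (yzRels d))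
    (n : ℕ) : oreMul d b f n = b * f n := rfl

theorem lie_oreX_oreMul (d₀ : K) (d : Fin s → K) (b : QuotAlg (yzRels d)) :
    ⁅oreX d₀ d, oreMul d b⁆ = oreMul d (yzDeriv d₀ d b) := by
  rw [Ring.lie_def]
  refine LinearMap.ext fun f => funext fun n => ?_
  rw [LinearMap.sub_apply, Module.End.mul_apply, Module.End.mul_apply, Pi.sub_apply,
    oreMul_apply, oreMul_apply]
  cases n with
  | zero => rw [oreX_apply_zero, oreX_apply_zero, oreMul_apply, yzDeriv_mul]; abel
  | succ n =>
    rw [oreX_apply_succ, oreX_apply_succ, oreMul_apply, oreMul_apply, yzDeriv_mul, mul_add]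
    abel

variable {V : Type*} [AddCommGroup V] [Module K V]
  (v : Module.Basis (Fin (s + 1)) K V) {d : Fin (s + 1) → K}

/-- The action of the generators of the Yang–Mills algebra on sequences. -/
def oreGen (d : Fin (s + 1) → K) (k : Fin (s + 1)) :
    Module.End K (ℕ → QuotAlg (yzRels fun i : Fin s => d i.succ)) :=
  Fin.cases (oreX (d 0) _) (fun i => oreMul _ (yz _ (Sum.inl i))) k

theorem lie_lie_eq_neg {S : Type*} [Ring S] (a b : S) : ⁅b, ⁅b, a⁆⁆ = -⁅b, ⁅a, b⁆⁆ := by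
  simp only [Ring.lie_def]
  noncomm_ring

theorem oreGen_zero : oreGen d 0 = oreX (d 0) _ := rfl

theorem oreGen_succ (i : Fin s) : oreGen d i.succ = oreMul _ (yz _ (Sum.inl i)) := rfl

/-- As operators `[x, b] = δ(b)`. For index 0 the sum is therefore minus the relation of `B`; for
positive index, the value chosen for `δ(z_j)` cancels the remaining terms. -/
theorem sum_lie_lie_oreGen (hd : d 0 ≠ 0) (l : Fin (s + 1)) :
    ∑ k, d k • ⁅oreGen d k, ⁅oreGen d k, oreGen d l⁆⁆ = 0 := by
  rw [Fin.sum_univ_succ]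
  induction l using Fin.cases with
  | zero =>
    have h0 : ⁅oreGen d 0, ⁅oreGen d 0, oreGen d 0⁆⁆ = 0 := by
      simp only [Ring.lie_def, sub_self, mul_zero, zero_mul]
    have h1 : ∀ i : Fin s, ⁅oreGen d i.succ, ⁅oreGen d i.succ, oreGen d 0⁆⁆ =
        -(oreMul _ ⁅yz (fun i : Fin s => d i.succ) (Sum.inl i),
          yz (fun i : Fin s => d i.succ) (Sum.inr i)⁆) := by
      intro i
      rw [← yzDeriv_inl (d 0), map_lie', ← lie_oreX_oreMul, oreGen_succ, oreGen_zero]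
      exact lie_lie_eq_neg _ _
    simp only [h0, h1, smul_zero, zero_add, smul_neg, ← map_smul]
    rw [Finset.sum_neg_distrib, ← map_sum, sum_lie_yz, map_zero, neg_zero]
  | succ j =>
    have h0 : ⁅oreGen d 0, ⁅oreGen d 0, oreGen d j.succ⁆⁆ =
        oreMul _ (yzDerivInr (d 0) (fun i : Fin s => d i.succ) j) := by
      rw [← yzDeriv_inr, ← yzDeriv_inl (d 0), ← lie_oreX_oreMul, ← lie_oreX_oreMul]
      rfl
    have h1 : ∀ i : Fin s, ⁅oreGen d i.succ, ⁅oreGen d i.succ, oreGen d j.succ⁆⁆ =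
        oreMul _ ⁅yz (fun i : Fin s => d i.succ) (Sum.inl i),
          ⁅yz (fun i : Fin s => d i.succ) (Sum.inl i),
            yz (fun i : Fin s => d i.succ) (Sum.inl j)⁆⁆ := by
      intro i
      rw [map_lie', map_lie']
      rfl
    simp only [h0, h1, ← map_smul]
    rw [← map_sum, ← map_add, yzDerivInr, smul_neg, smul_inv_smul₀ hd, neg_add_cancel, map_zero]

/-- The action of the Yang–Mills algebra on sequences. -/
def oreRep (hd : d 0 ≠ 0) : QuotAlg (ymRels v d) →ₐ[K]
    Module.End K (ℕ → QuotAlg (yzRels fun i : Fin s => d i.succ)) :=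
  quotLift _ (TensorAlgebra.lift K (v.constr K (oreGen d))) (by
    intro r hr
    obtain ⟨c, rfl⟩ := (Submodule.mem_span_range_iff_exists_fun K).1 hr
    rw [map_sum]
    refine Finset.sum_eq_zero fun l _ => ?_
    rw [map_smul, map_ymMap]
    simp only [TensorAlgebra.lift_ι_apply, Module.Basis.constr_basis]
    rw [sum_lie_lie_oreGen hd, smul_zero])

theorem oreRep_ymGen (hd : d 0 ≠ 0) (k : Fin (s + 1)) :
    oreRep v hd (ymGen v d k) = oreGen d k := by
  rw [ymGen, oreRep, quotLift_toQuot, TensorAlgebra.lift_ι_apply, Module.Basis.constr_basis]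

theorem oreRep_yzToYm (hd : d 0 ≠ 0) (b : QuotAlg (yzRels fun i : Fin s => d i.succ)) :
    oreRep v hd (yzToYm v d b) = oreMul _ b := by
  have h : ((oreRep v hd).comp (yzToYm v d)).comp (toQuot _) = (oreMul _).comp (toQuot _) := by
    apply TensorAlgebra.hom_ext
    refine (Pi.basisFun K _).ext fun j => ?_
    change oreRep v hd (yzToYm v d (yz _ j)) = oreMul _ (yz _ j)
    rcases j with i | i
    · rw [yzToYm_inl, oreRep_ymGen]
      rfl
    · rw [yzToYm_inr, map_lie', oreRep_ymGen, oreRep_ymGen, ← yzDeriv_inl (d 0),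
        ← lie_oreX_oreMul]
      rfl
  obtain ⟨t, rfl⟩ := toQuot_surjective _ b
  exact DFunLike.congr_fun h t

/-- The coefficients `b_n` of an element `∑ b_n x^n` of the Yang–Mills algebra. -/
def ymCoeff (hd : d 0 ≠ 0) :
    QuotAlg (ymRels v d) →ₗ[K] (ℕ → QuotAlg (yzRels fun i : Fin s => d i.succ)) :=
  (LinearMap.applyₗ (Pi.single 0 1)).comp (oreRep v hd).toLinearMap

/-- The sequence supported at 0 with value 1 stands for the unit; since `δ(1) = 0`, the operator `x`
merely shifts it. -/
theorem oreX_pow_single (d₀ : K) (d' : Fin s → K) (n : ℕ) :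
    (oreX d₀ d' ^ n) (Pi.single 0 1) = Pi.single n 1 := by
  induction n with
  | zero => rfl
  | succ n ih =>
    rw [pow_succ', Module.End.mul_apply, ih]
    funext m
    cases m with
    | zero =>
      rw [oreX_apply_zero]
      cases n with
      | zero => simp [yzDeriv_one]
      | succ n => simp
    | succ m =>
      rw [oreX_apply_succ]
      have : yzDeriv d₀ d' ((Pi.single n 1 : ℕ → QuotAlg (yzRels d')) (m + 1)) = 0 := by
        rw [Pi.single_apply]
        split_ifs
        · exact yzDeriv_one _ _
        · exact map_zero _
      rw [this, add_zero]
      simp [Pi.single_apply]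

/-- The coefficients of `b xⁿ` can be recovered, which proves that the sum of the `B xⁿ` is direct
and that `B` embeds in the Yang–Mills algebra. -/
theorem ymCoeff_mul_pow (hd : d 0 ≠ 0) (b : QuotAlg (yzRels fun i : Fin s => d i.succ)) (n : ℕ) :
    ymCoeff v hd (yzToYm v d b * ymGen v d 0 ^ n) = Pi.single n b := by
  change oreRep v hd (yzToYm v d b * ymGen v d 0 ^ n) (Pi.single 0 1) = _
  rw [map_mul, map_pow, oreRep_yzToYm, oreRep_ymGen, Module.End.mul_apply]
  change oreMul _ b ((oreX _ _ ^ n) _) = _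
  rw [oreX_pow_single]
  funext m
  rw [oreMul_apply, Pi.single_apply, Pi.single_apply, mul_ite, mul_one, mul_zero]

/-- The elements `∑_{k < n} b_k x^k` of the Yang–Mills algebra. -/
def ymXDegLT (d : Fin (s + 1) → K) (n : ℕ) : Submodule K (QuotAlg (ymRels v d)) :=
  ⨆ k : Fin n, LinearMap.range
    ((LinearMap.mulRight K (ymGen v d 0 ^ (k : ℕ))).comp (yzToYm v d).toLinearMap)

theorem mul_pow_mem_ymXDegLT (b : QuotAlg (yzRels fun i : Fin s => d i.succ)) {k n : ℕ}
    (h : k < n) : yzToYm v d b * ymGen v d 0 ^ k ∈ ymXDegLT v d n :=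
  le_iSup (fun k : Fin n => LinearMap.range
    ((LinearMap.mulRight K (ymGen v d 0 ^ (k : ℕ))).comp (yzToYm v d).toLinearMap)) ⟨k, h⟩ ⟨b, rfl⟩

theorem ymXDegLT_le {n : ℕ} {S : Submodule K (QuotAlg (ymRels v d))}
    (h : ∀ b, ∀ k < n, yzToYm v d b * ymGen v d 0 ^ k ∈ S) : ymXDegLT v d n ≤ S :=
  iSup_le fun k => by rintro _ ⟨b, rfl⟩; exact h b k k.2

theorem ymXDegLT_mono {m n : ℕ} (h : m ≤ n) : ymXDegLT v d m ≤ ymXDegLT v d n :=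
  ymXDegLT_le v fun b _ hk => mul_pow_mem_ymXDegLT v b (by omega)

theorem yzToYm_mul_mem {n : ℕ} {a : QuotAlg (ymRels v d)} (ha : a ∈ ymXDegLT v d n)
    (b : QuotAlg (yzRels fun i : Fin s => d i.succ)) : yzToYm v d b * a ∈ ymXDegLT v d n := by
  have : ymXDegLT v d n ≤ (ymXDegLT v d n).comap (LinearMap.mulLeft K (yzToYm v d b)) :=
    ymXDegLT_le v fun c k hk => by
      rw [Submodule.mem_comap, LinearMap.mulLeft_apply, ← mul_assoc, ← map_mul]
      exact mul_pow_mem_ymXDegLT v _ hk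
  exact this ha

theorem ymGen_zero_mul_mem (hd : d 0 ≠ 0) {n : ℕ} {a : QuotAlg (ymRels v d)}
    (ha : a ∈ ymXDegLT v d n) : ymGen v d 0 * a ∈ ymXDegLT v d (n + 1) := by
  have : ymXDegLT v d n ≤ (ymXDegLT v d (n + 1)).comap (LinearMap.mulLeft K (ymGen v d 0)) :=
    ymXDegLT_le v fun b k hk => by
      rw [Submodule.mem_comap, LinearMap.mulLeft_apply, ← mul_assoc, lie_yzToYm v d hd, add_mul,
        mul_assoc, ← pow_succ']
      exact add_mem (mul_pow_mem_ymXDegLT v b (by omega)) (mul_pow_mem_ymXDegLT v _ (by omega))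
  exact this ha

/-- The `B xⁿ` span everything: their sum contains 1 and is stable under left multiplication by the
generators, because `x b = b x + δ(b)` raises the degree in `x` by at most one. -/
theorem exists_mem_ymXDegLT (hd : d 0 ≠ 0) (a : QuotAlg (ymRels v d)) :
    ∃ n, a ∈ ymXDegLT v d n := by
  have hone : (1 : QuotAlg (ymRels v d)) ∈ ymXDegLT v d 1 := by
    have := mul_pow_mem_ymXDegLT v (d := d) 1 zero_lt_one
    rwa [map_one, pow_zero, one_mul] at this
  have key : ∀ t : TensorAlgebra K V, ∀ a, (∃ n, a ∈ ymXDegLT v d n) →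
      ∃ n, toQuot (ymRels v d) t * a ∈ ymXDegLT v d n := by
    intro t
    induction t using TensorAlgebra.induction with
    | algebraMap r =>
      rintro a ⟨n, ha⟩
      exact ⟨n, by rw [AlgHom.commutes, ← Algebra.smul_def]; exact Submodule.smul_mem _ _ ha⟩
    | ι w =>
      rintro a ⟨n, ha⟩
      refine ⟨n + 1, ?_⟩
      rw [← v.sum_repr w]
      simp only [map_sum, map_smul, Finset.sum_mul, smul_mul_assoc]
      refine sum_mem fun k _ => Submodule.smul_mem _ _ ?_
      change ymGen v d k * a ∈ _
      induction k using Fin.cases with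
      | zero => exact ymGen_zero_mul_mem v hd ha
      | succ i =>
        rw [← yzToYm_inl]
        exact yzToYm_mul_mem v (ymXDegLT_mono v (by omega) ha) _
    | mul x y hx hy =>
      intro a ha
      rw [map_mul, mul_assoc]
      exact hx _ (hy _ ha)
    | add x y hx hy =>
      intro a ha
      obtain ⟨m, hm⟩ := hx a ha
      obtain ⟨n, hn⟩ := hy a ha
      rw [map_add, add_mul]
      exact ⟨max m n, add_mem (ymXDegLT_mono v (le_max_left _ _) hm)
        (ymXDegLT_mono v (le_max_right _ _) hn)⟩
  obtain ⟨t, rfl⟩ := toQuot_surjective _ a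
  simpa using key t 1 ⟨1, hone⟩

/-- Moving `x^k` to the right past an element of `B` creates only powers of `x` with exponent at
most `k`. -/
theorem mul_ymGen_succ_mem (hd : d 0 ≠ 0) {n : ℕ} {a : QuotAlg (ymRels v d)}
    (ha : a ∈ ymXDegLT v d n) (i : Fin s) : a * ymGen v d i.succ ∈ ymXDegLT v d n := by
  have hpow : ∀ (k : ℕ) (b : QuotAlg (yzRels fun i : Fin s => d i.succ)),
      ymGen v d 0 ^ k * yzToYm v d b ∈ ymXDegLT v d (k + 1) := by
    intro k b
    induction k with
    | zero => simpa using mul_pow_mem_ymXDegLT v b zero_lt_one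
    | succ k ih => rw [pow_succ', mul_assoc]; exact ymGen_zero_mul_mem v hd ih
  have : ymXDegLT v d n ≤ (ymXDegLT v d n).comap (LinearMap.mulRight K (ymGen v d i.succ)) :=
    ymXDegLT_le v fun b k hk => by
      rw [Submodule.mem_comap, LinearMap.mulRight_apply, mul_assoc, ← yzToYm_inl]
      exact yzToYm_mul_mem v (ymXDegLT_mono v (by omega) (hpow k _)) b
  exact this ha

theorem ymCoeff_of_mem (hd : d 0 ≠ 0) {n m : ℕ} (h : n ≤ m) {a : QuotAlg (ymRels v d)}
    (ha : a ∈ ymXDegLT v d n) : ymCoeff v hd a m = 0 := by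
  have : ymXDegLT v d n ≤ LinearMap.ker ((LinearMap.proj m).comp (ymCoeff v hd)) :=
    ymXDegLT_le v fun b k hk => by
      rw [LinearMap.mem_ker, LinearMap.comp_apply, ymCoeff_mul_pow, LinearMap.proj_apply,
        Pi.single_eq_of_ne (by omega)]
  exact this ha

theorem eq_add_of_mem_ymXDegLT (hd : d 0 ≠ 0) {n : ℕ} {a : QuotAlg (ymRels v d)}
    (ha : a ∈ ymXDegLT v d (n + 1)) :
    a - yzToYm v d (ymCoeff v hd a n) * ymGen v d 0 ^ n ∈ ymXDegLT v d n := by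
  let f : QuotAlg (ymRels v d) →ₗ[K] QuotAlg (ymRels v d) :=
    LinearMap.id - ((LinearMap.mulRight K (ymGen v d 0 ^ n)).comp (yzToYm v d).toLinearMap).comp
      ((LinearMap.proj n).comp (ymCoeff v hd))
  have : ymXDegLT v d (n + 1) ≤ (ymXDegLT v d n).comap f :=
    ymXDegLT_le v fun b k hk => by
      change yzToYm v d b * ymGen v d 0 ^ k -
        yzToYm v d (ymCoeff v hd (yzToYm v d b * ymGen v d 0 ^ k) n) * ymGen v d 0 ^ n ∈ ymXDegLT v d n
      rw [ymCoeff_mul_pow]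
      by_cases h : k = n
      · subst h
        rw [Pi.single_eq_same, sub_self]
        exact zero_mem _
      · rw [Pi.single_eq_of_ne (Ne.symm h), map_zero, zero_mul, sub_zero]
        exact mul_pow_mem_ymXDegLT v b (by omega)
  exact this ha

theorem mem_ymXDegLT_of_coeff (hd : d 0 ≠ 0) {n : ℕ} {a : QuotAlg (ymRels v d)}
    (ha : a ∈ ymXDegLT v d (n + 1)) (h : ymCoeff v hd a n = 0) : a ∈ ymXDegLT v d n := by
  simpa [h] using eq_add_of_mem_ymXDegLT v hd ha

theorem ymXDegLT_zero : ymXDegLT v d 0 = ⊥ := by simp [ymXDegLT]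

/-- An element with zero coefficients loses its top power of `x`, repeatedly, until nothing is left.
-/
theorem ymCoeff_injective (hd : d 0 ≠ 0) : Function.Injective (ymCoeff v hd) := by
  rw [← LinearMap.ker_eq_bot, LinearMap.ker_eq_bot']
  intro a ha
  obtain ⟨n, hn⟩ := exists_mem_ymXDegLT v hd a
  induction n with
  | zero => rwa [ymXDegLT_zero, Submodule.mem_bot] at hn
  | succ n ih => exact ih (mem_ymXDegLT_of_coeff v hd hn (by rw [ha]; rfl))

theorem ymCoeff_mul_ymGen_zero (hd : d 0 ≠ 0) (a : QuotAlg (ymRels v d)) (n : ℕ) :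
    ymCoeff v hd (a * ymGen v d 0) (n + 1) = ymCoeff v hd a n := by
  obtain ⟨m, hm⟩ := exists_mem_ymXDegLT v hd a
  have : ymXDegLT v d m ≤ LinearMap.eqLocus
      (((LinearMap.proj (n + 1)).comp (ymCoeff v hd)).comp (LinearMap.mulRight K (ymGen v d 0)))
      ((LinearMap.proj n).comp (ymCoeff v hd)) :=
    ymXDegLT_le v fun b k hk => by
      change ymCoeff v hd (yzToYm v d b * ymGen v d 0 ^ k * ymGen v d 0) (n + 1) =
        ymCoeff v hd (yzToYm v d b * ymGen v d 0 ^ k) n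
      rw [mul_assoc, ← pow_succ, ymCoeff_mul_pow, ymCoeff_mul_pow]
      simp [Pi.single_apply]
  exact this hm

theorem exists_eq_yzToYm_add_mul (hd : d 0 ≠ 0) (a : QuotAlg (ymRels v d)) :
    ∃ b a', a = yzToYm v d b + a' * ymGen v d 0 := by
  obtain ⟨n, hn⟩ := exists_mem_ymXDegLT v hd a
  have : ymXDegLT v d n ≤ LinearMap.range (yzToYm v d).toLinearMap ⊔
      LinearMap.range (LinearMap.mulRight K (ymGen v d 0)) :=
    ymXDegLT_le v fun b k hk => by
      cases k with
      | zero => exact Submodule.mem_sup_left ⟨b, by simp⟩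
      | succ k =>
        exact Submodule.mem_sup_right ⟨yzToYm v d b * ymGen v d 0 ^ k, by
          rw [LinearMap.mulRight_apply, mul_assoc, ← pow_succ]⟩
  obtain ⟨_, ⟨b, rfl⟩, _, ⟨a', rfl⟩, h⟩ := Submodule.mem_sup.1 (this hn)
  exact ⟨b, a', h.symm⟩

/-- Right multiplication by `v_0` is injective on the Yang–Mills algebra. -/
theorem ymGen_zero_isRegular (hd : d 0 ≠ 0) {a : QuotAlg (ymRels v d)}
    (h : a * ymGen v d 0 = 0) : a = 0 := by
  apply ymCoeff_injective v hd
  funext n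
  rw [← ymCoeff_mul_ymGen_zero, h, map_zero]
  rfl

end OreRepresentation

/-! ### Exactness of the middle part `A → A^{s+1} → A^{s+1}` of the Koszul complex. -/

section YangMillsExactness

open TensorAlgebra

variable {K : Type*} [Field K]

/-- The entries of the matrix `q` with `∑ d_k [y_k, [y_k, y_i]] = ∑ q_{il} y_l`. -/
def ymEntry {S : Type*} [Ring S] [Algebra K S] {κ : Type*} [Fintype κ] [DecidableEq κ] (d : κ → K)
    (y : κ → S) (i l : κ) : S :=
  (if i = l then ∑ k, d k • (y k * y k) else 0) + d l • (y i * y l - 2 * (y l * y i))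

/-- For the Yang–Mills generators the right-hand side is zero, so this says that the two maps of the
complex compose to zero. -/
theorem sum_smul_mul_ymEntry {S : Type*} [Ring S] [Algebra K S] {κ : Type*} [Fintype κ]
    [DecidableEq κ] (d : κ → K) (y : κ → S) (l : κ) :
    ∑ k, (d k • y k) * ymEntry d y k l = d l • ∑ k, d k • ⁅y k, ⁅y k, y l⁆⁆ := by
  have h : ∀ k, ⁅y k, ⁅y k, y l⁆⁆ =
      y l * (y k * y k) + y k * (y k * y l - 2 * (y l * y k)) := by
    intro k
    simp only [Ring.lie_def]
    noncomm_ring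
  simp only [ymEntry, h, mul_add, smul_add, Finset.sum_add_distrib, mul_ite, mul_zero,
    Finset.sum_ite_eq', Finset.mem_univ, if_true, smul_mul_assoc, mul_smul_comm, Finset.mul_sum,
    Finset.smul_sum]
  congr 1
  exact Finset.sum_congr rfl fun k _ => smul_comm _ _ _

theorem toQuot_rcoord_ymMap {V : Type*} [AddCommGroup V] [Module K V] {κ : Type*} [Fintype κ]
    [DecidableEq κ] (v : Module.Basis κ K V) (d : κ → K) (k l : κ) :
    toQuot (ymRels v d) (rcoord (v.coord l) (ymMap v d (v k))) =
      ymEntry d (ymGen v d) k l := by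
  have h2 : toQuot (ymRels v d) 2 = 2 := map_ofNat _ 2
  rw [rcoord_ymMap, ymEntry, map_add, map_smul, map_smul, map_sub, map_mul, map_mul, map_mul, h2]
  congr 1
  simp only [Module.Basis.coord_apply, Module.Basis.repr_self, Finsupp.single_apply, map_sum,
    map_smul, map_mul]
  split_ifs
  · rw [one_smul]; rfl
  · rw [zero_smul]

variable {V : Type*} [AddCommGroup V] [Module K V] {s : ℕ}
  (v : Module.Basis (Fin (s + 1)) K V) {d : Fin (s + 1) → K}

theorem ymGen_zero_mul_ymGen_succ (hd : d 0 ≠ 0) (i : Fin s) :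
    ymGen v d 0 * ymGen v d i.succ =
      ymGen v d i.succ * ymGen v d 0 + yzToYm v d (yz _ (Sum.inr i)) := by
  rw [← yzToYm_inl, lie_yzToYm v d hd, yzDeriv_inl]

/-- Since `x y_i = y_i x + z_i`, the entry `q_{0i} = d_i (x y_i - 2 y_i x)` equals `d_i (z_i - y_i
x)`: it has degree 1 in `x` with leading coefficient `-d_i y_i`. -/
theorem yzToYm_mul_entry (hd : d 0 ≠ 0) (b : QuotAlg (yzRels fun i : Fin s => d i.succ))
    (i : Fin s) :
    yzToYm v d b * ymEntry d (ymGen v d) 0 i.succ = d i.succ •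
      (yzToYm v d (b * yz _ (Sum.inr i)) * ymGen v d 0 ^ 0 -
        yzToYm v d (b * yz _ (Sum.inl i)) * ymGen v d 0 ^ 1) := by
  rw [ymEntry, if_neg (Fin.succ_ne_zero i).symm, zero_add, ymGen_zero_mul_ymGen_succ v hd,
    mul_smul_comm, map_mul, map_mul, yzToYm_inl]
  congr 1
  noncomm_ring

/-- In the block of `q` with positive indices, `x` occurs only in the diagonal term `d_0 x²`, while
row 0 has degree 1 in `x`. Hence the top coefficients of the `c_j` cannot cancel, so `c = 0`. What
is left is `b (z_i - y_i x) = 0`, whose coefficient at `x` is `-b y_i`, and `y_i` is regular in `B`.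
-/
theorem eq_zero_of_sum_mul_ymEntry (hd : ∀ k, d k ≠ 0) (hs : 1 ≤ s)
    (b : QuotAlg (yzRels fun i : Fin s => d i.succ)) (c : Fin s → QuotAlg (ymRels v d))
    (h : ∀ i : Fin s, yzToYm v d b * ymEntry d (ymGen v d) 0 i.succ +
      ∑ j : Fin s, c j * ymEntry d (ymGen v d) j.succ i.succ = 0) :
    b = 0 ∧ c = 0 := by
  have hc : ∀ n, (∀ j, c j ∈ ymXDegLT v d n) → c = 0 := by
    intro n
    induction n with
    | zero =>
      intro hn
      funext j
      simpa [ymXDegLT_zero] using hn j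
    | succ n ih =>
      refine fun hn => ih fun i => mem_ymXDegLT_of_coeff v (hd 0) (hn i) ?_
      have hsum : ∑ j : Fin s, c j * ymEntry d (ymGen v d) j.succ i.succ =
          d 0 • (c i * ymGen v d 0 * ymGen v d 0) +
            (∑ k : Fin s, d k.succ • (c i * ymGen v d k.succ * ymGen v d k.succ) +
            ∑ j : Fin s, d i.succ • (c j * ymGen v d j.succ * ymGen v d i.succ -
              (2 : K) • (c j * ymGen v d i.succ * ymGen v d j.succ))) := by
        rw [← add_assoc]
        simp only [ymEntry, mul_add, Finset.sum_add_distrib, mul_ite, mul_zero, Fin.succ_inj,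
          Finset.sum_ite_eq', Finset.mem_univ, if_true]
        congr 1
        · rw [Fin.sum_univ_succ, mul_add, mul_smul_comm, mul_assoc, Finset.mul_sum]
          congr 1
          exact Finset.sum_congr rfl fun k _ => by rw [mul_smul_comm, mul_assoc]
        · refine Finset.sum_congr rfl fun k _ => ?_
          rw [mul_smul_comm, ofNat_smul_eq_nsmul K 2]
          congr 1
          noncomm_ring
      have hmem : ∑ k : Fin s, d k.succ • (c i * ymGen v d k.succ * ymGen v d k.succ) +
            ∑ j : Fin s, d i.succ • (c j * ymGen v d j.succ * ymGen v d i.succ -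
              (2 : K) • (c j * ymGen v d i.succ * ymGen v d j.succ)) ∈ ymXDegLT v d (n + 1) := by
        have hm := fun (j k l : Fin s) =>
          mul_ymGen_succ_mem v (hd 0) (mul_ymGen_succ_mem v (hd 0) (hn j) k) l
        exact add_mem (sum_mem fun k _ => Submodule.smul_mem _ _ (hm _ _ _))
          (sum_mem fun k _ => Submodule.smul_mem _ _
            (sub_mem (hm _ _ _) (Submodule.smul_mem _ _ (hm _ _ _))))
      have hmem' : yzToYm v d b * ymEntry d (ymGen v d) 0 i.succ ∈ ymXDegLT v d 2 := by
        rw [yzToYm_mul_entry v (hd 0)]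
        exact Submodule.smul_mem _ _ (sub_mem (mul_pow_mem_ymXDegLT v _ (by norm_num))
          (mul_pow_mem_ymXDegLT v _ (by norm_num)))
      -- If the `c_j` have degree at most `n` in `x`, the coefficient of `x^{n+2}` in the `i`-th
      -- equation is `d_0` times the coefficient of `xⁿ` in `c_i`; all other terms have smaller
      -- degree.
      have h1 := congrArg (fun a => ymCoeff v (hd 0) a (n + 1 + 1)) (h i)
      simp only [hsum, map_add, map_smul, Pi.add_apply, Pi.smul_apply, map_zero, Pi.zero_apply,
        ymCoeff_mul_ymGen_zero] at h1
      have h2 := ymCoeff_of_mem v (hd 0) (by omega : n + 1 ≤ n + 1 + 1) hmem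
      rw [map_add, Pi.add_apply] at h2
      rw [h2, ymCoeff_of_mem v (hd 0) (by omega : 2 ≤ n + 1 + 1) hmem', zero_add, add_zero] at h1
      exact (smul_eq_zero.1 h1).resolve_left (hd 0)
  have hc0 : c = 0 := by
    choose n hn using fun j => exists_mem_ymXDegLT v (hd 0) (c j)
    exact hc (Finset.univ.sup n) fun j =>
      ymXDegLT_mono v (Finset.le_sup (Finset.mem_univ j)) (hn j)
  refine ⟨?_, hc0⟩
  -- One index `i ≥ 1` is needed here, and `s ≥ 1` provides it.
  have h0 := h ⟨0, hs⟩
  simp only [hc0, Pi.zero_apply, zero_mul, Finset.sum_const_zero, add_zero] at h0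
  rw [yzToYm_mul_entry v (hd 0)] at h0
  have h1 := (smul_eq_zero.1 h0).resolve_left (hd _)
  have h2 := congrFun (congrArg (ymCoeff v (hd 0)) h1) 1
  rw [map_sub, ymCoeff_mul_pow, ymCoeff_mul_pow, Pi.sub_apply, Pi.single_eq_same,
    Pi.single_eq_of_ne one_ne_zero, zero_sub, map_zero, Pi.zero_apply, neg_eq_zero] at h2
  exact yz_isRegular (fun i => hd i.succ) _ h2

/-- Exactness of `A → A^{s+1} → A^{s+1}` for the Yang–Mills algebra `A`. -/
theorem exists_eq_mul_of_sum_mul_rcoord (hd : ∀ k, d k ≠ 0) (hs : 1 ≤ s)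
    (a : Fin (s + 1) → QuotAlg (ymRels v d))
    (h : ∀ l, ∑ k, a k * toQuot (ymRels v d) (rcoord (v.coord l) (ymMap v d (v k))) = 0) :
    ∃ a', ∀ k, a k = a' * (d k • ymGen v d k) := by
  simp only [toQuot_rcoord_ymMap] at h
  -- Subtracting the multiple `d_0⁻¹ a'` of the trivial solution `(d_k v_k)` leaves an entry of
  -- index 0 in `B`, which is the case of the preceding lemma.
  obtain ⟨b, a', hb⟩ := exists_eq_yzToYm_add_mul v (hd 0) (a 0)
  refine ⟨(d 0)⁻¹ • a', ?_⟩
  have h0 : a 0 - (d 0)⁻¹ • a' * (d 0 • ymGen v d 0) = yzToYm v d b := by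
    rw [smul_mul_smul_comm, inv_mul_cancel₀ (hd 0), one_smul, hb, add_sub_cancel_right]
  have key := eq_zero_of_sum_mul_ymEntry v hd hs b
    (fun i => a i.succ - (d 0)⁻¹ • a' * (d i.succ • ymGen v d i.succ)) (fun i => by
      rw [← h0, ← Fin.sum_univ_succ
        (fun j => (a j - (d 0)⁻¹ • a' * (d j • ymGen v d j)) * ymEntry d (ymGen v d) j i.succ)]
      simp only [sub_mul, Finset.sum_sub_distrib, h, mul_assoc, ← Finset.mul_sum]
      rw [sum_smul_mul_ymEntry, sum_lie_lie_ymGen, smul_zero, mul_zero, sub_zero])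
  intro k
  rw [← sub_eq_zero]
  induction k using Fin.cases with
  | zero => rw [h0, key.1, map_zero]
  | succ i => exact congrFun key.2 i

/-- The homogeneous form of `exists_eq_mul_of_sum_mul_rcoord`, for representatives in the tensor
algebra. -/
theorem exists_toQuot_eq_of_mem (hd : ∀ k, d k ≠ 0) (hs : 1 ≤ s) {n : ℕ}
    {c : Fin (s + 1) → TensorAlgebra K V} (hc : ∀ k, c k ∈ tensorDeg K V n)
    (h : ∀ l, toQuot (ymRels v d) (∑ k, c k * rcoord (v.coord l) (ymMap v d (v k))) = 0) :
    ∃ a, (∀ m, n = m + 1 → a ∈ tensorDeg K V m) ∧ (n = 0 → a = 0) ∧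
      ∀ k, toQuot (ymRels v d) (c k - a * (d k • ι K (v k))) = 0 := by
  obtain ⟨a', ha'⟩ := exists_eq_mul_of_sum_mul_rcoord v hd hs (fun k => toQuot _ (c k))
    (fun l => by rw [← h l, map_sum]; simp only [map_mul])
  obtain ⟨t, rfl⟩ := toQuot_surjective _ a'
  have h1 : ∀ k, toQuot (ymRels v d) (c k - t * (d k • ι K (v k))) = 0 := fun k => by
    rw [map_sub, sub_eq_zero, ha' k, map_mul, map_smul]; rfl
  cases n with
  | zero =>
    -- The factor `a` should have degree `-1`, hence be zero: the degree 0 component of `t (d_k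
    -- v_k)` vanishes.
    refine ⟨0, by simp, fun _ => rfl, fun k => ?_⟩
    have h2 := tproj_toQuot (ymRels_le v d) (h1 k) 0
    rw [map_sub, tproj_of_mem (hc k), tproj_mul_of_lt
      (Submodule.smul_mem _ _ (ι_mem_tensorDeg _)) zero_lt_one] at h2
    rwa [zero_mul]
  | succ n =>
    refine ⟨tproj K V n t, fun m hm => ?_, by simp, fun k => ?_⟩
    · rw [← Nat.succ_injective hm]
      exact tproj_mem _ _
    · have h2 := tproj_toQuot (ymRels_le v d) (h1 k) (n + 1)
      rwa [map_sub, tproj_of_mem (hc k),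
        tproj_mul (Submodule.smul_mem _ _ (ι_mem_tensorDeg _))] at h2

/-- `∑ v_k r_k d_k = ∑ r_k v_k d_k` for the Yang–Mills relations `r_k`. -/
theorem sum_smul_mul_ymMap {κ : Type*} [Fintype κ] (v : κ → V) (d : κ → K) :
    ∑ k, (d k • ι K (v k)) * ymMap v d (v k) = ∑ k, ymMap v d (v k) * (d k • ι K (v k)) := by
  rw [← sub_eq_zero, ← Finset.sum_sub_distrib, ← sum_smul_lie_lie_lie d fun k => ι K (v k)]
  refine Finset.sum_congr rfl fun k _ => ?_
  rw [smul_mul_assoc, mul_smul_comm, ← smul_sub, ← Ring.lie_def]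
  rfl

end YangMillsExactness

/-! ### The spaces `W_m` and the Koszulity of the Yang–Mills algebra. -/

section KoszulComplex

open TensorAlgebra

variable {K : Type*} [Field K]

theorem mem_range_lTensor_span {A T : Type*} [AddCommGroup A] [Module K A] [AddCommGroup T]
    [Module K T] {κ : Type*} [Fintype κ] (f : κ → T) (x : A ⊗[K] T) :
    x ∈ LinearMap.range (LinearMap.lTensor A (Submodule.span K (Set.range f)).subtype) ↔
      ∃ a : κ → A, x = ∑ k, a k ⊗ₜ[K] f k := by
  constructor
  · rintro ⟨y, rfl⟩
    induction y with
    | zero => exact ⟨0, by simp⟩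
    | tmul a t =>
      obtain ⟨t, ht⟩ := t
      obtain ⟨c, rfl⟩ := (Submodule.mem_span_range_iff_exists_fun K).1 ht
      refine ⟨fun k => c k • a, ?_⟩
      simp [TensorProduct.tmul_sum, TensorProduct.smul_tmul]
    | add y z hy hz =>
      obtain ⟨a, ha⟩ := hy
      obtain ⟨b, hb⟩ := hz
      exact ⟨a + b, by rw [map_add, ha, hb]; simp [TensorProduct.add_tmul, Finset.sum_add_distrib]⟩
  · rintro ⟨a, rfl⟩
    exact ⟨∑ k, a k ⊗ₜ[K] ⟨f k, Submodule.subset_span ⟨k, rfl⟩⟩, by simp⟩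

theorem eq_zero_of_sum_tmul_eq_zero {A T : Type*} [AddCommGroup A] [Module K A] [AddCommGroup T]
    [Module K T] {κ : Type*} [Fintype κ] {f : κ → T} (hf : LinearIndependent K f) {a : κ → A}
    (h : ∑ k, a k ⊗ₜ[K] f k = 0) (k : κ) : a k = 0 := by
  classical
  obtain ⟨g, hg⟩ := LinearMap.exists_leftInverse_of_injective (Fintype.linearCombination K f)
    (LinearMap.ker_eq_bot.2 hf.fintypeLinearCombination_injective)
  have hgf : ∀ l, g (f l) k = if l = k then 1 else 0 := by
    intro l
    have := LinearMap.congr_fun hg (Pi.single l 1)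
    rw [LinearMap.comp_apply, Fintype.linearCombination_apply_single, one_smul] at this
    rw [this, LinearMap.id_apply, Pi.single_apply]
    simp only [eq_comm]
  have h1 := congrArg (TensorProduct.rid K A)
    (congrArg (LinearMap.lTensor A ((LinearMap.proj k).comp g)) h)
  simpa [hgf, ite_smul] using h1

variable {V : Type*} [AddCommGroup V] [Module K V]

theorem shiftMap_pow_tmul (R : Submodule K (TensorAlgebra K V)) {n : ℕ} {t : TensorAlgebra K V}
    (ht : t ∈ tensorDeg K V n) (a : QuotAlg R) (u : TensorAlgebra K V) :
    (shiftMap R ^ n) (a ⊗ₜ[K] (t * u)) = (a * toQuot R t) ⊗ₜ[K] u := by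
  induction n generalizing t a with
  | zero =>
    obtain ⟨c, rfl⟩ := mem_tensorDeg_zero.1 ht
    rw [pow_zero, Module.End.one_apply, AlgHom.commutes, ← Algebra.smul_def, ← Algebra.commutes,
      ← Algebra.smul_def, TensorProduct.smul_tmul]
  | succ n ih =>
    unfold tensorDeg at ht
    rw [pow_succ'] at ht
    induction ht using Submodule.mul_induction_on' with
    | mem_mul_mem x hx y hy =>
      obtain ⟨w, rfl⟩ := hx
      rw [pow_succ, Module.End.mul_apply, mul_assoc, shiftMap_tmul, ih hy, map_mul, mul_assoc]
    | add x _ y _ hx hy => rw [add_mul, TensorProduct.tmul_add, map_add, hx, hy, map_add, mul_add,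
        TensorProduct.add_tmul]

theorem rcoord_mem_mul_mul {R : Submodule K (TensorAlgebra K V)} {i j : ℕ}
    {u : TensorAlgebra K V} (h : u ∈ tensorDeg K V i * R * tensorDeg K V (j + 1))
    (f : V →ₗ[K] K) : rcoord f u ∈ tensorDeg K V i * R * tensorDeg K V j := by
  rw [tensorDeg_succ, ← mul_assoc] at h
  exact rcoord_mem_of_mem_mul h f

theorem toQuot_of_mem_mul_mul {R : Submodule K (TensorAlgebra K V)} {i j : ℕ}
    {u : TensorAlgebra K V} (h : u ∈ tensorDeg K V i * R * tensorDeg K V j) :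
    toQuot R u = 0 := by
  have : tensorDeg K V i * R * tensorDeg K V j ≤ LinearMap.ker (toQuot R).toLinearMap := by
    rw [Submodule.mul_le]
    intro m hm n _
    have : tensorDeg K V i * R ≤ LinearMap.ker (toQuot R).toLinearMap := by
      rw [Submodule.mul_le]
      intro a _ r hr
      simp [toQuot_of_mem hr]
    have := this hm
    simp only [LinearMap.mem_ker, AlgHom.toLinearMap_apply] at this ⊢
    rw [map_mul, this, zero_mul]
  exact this h

theorem mul_tensorDeg_zero (M : Submodule K (TensorAlgebra K V)) : M * tensorDeg K V 0 = M := by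
  unfold tensorDeg
  rw [pow_zero, mul_one]

theorem tensorDeg_zero_mul (M : Submodule K (TensorAlgebra K V)) : tensorDeg K V 0 * M = M := by
  unfold tensorDeg
  rw [pow_zero, one_mul]

theorem exists_eq_sum_mul_of_mem {κ : Type*} [Fintype κ] {r : κ → TensorAlgebra K V} {n : ℕ}
    {u : TensorAlgebra K V} (h : u ∈ tensorDeg K V n * Submodule.span K (Set.range r)) :
    ∃ c : κ → TensorAlgebra K V, (∀ k, c k ∈ tensorDeg K V n) ∧ u = ∑ k, c k * r k := by
  induction h using Submodule.mul_induction_on' with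
  | mem_mul_mem t ht x hx =>
    obtain ⟨c, rfl⟩ := (Submodule.mem_span_range_iff_exists_fun K).1 hx
    exact ⟨fun k => c k • t, fun k => Submodule.smul_mem _ _ ht, by simp [Finset.mul_sum]⟩
  | add x _ y _ hx hy =>
    obtain ⟨a, ha, rfl⟩ := hx
    obtain ⟨b, hb, rfl⟩ := hy
    exact ⟨a + b, fun k => add_mem (ha k) (hb k), by simp [add_mul, Finset.sum_add_distrib]⟩

theorem mem_koszulW {N m : ℕ} {R : Submodule K (TensorAlgebra K V)} {u : TensorAlgebra K V} :
    u ∈ koszulW N R m ↔ u ∈ tensorDeg K V m ∧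
      ∀ i j, i + N + j = m → u ∈ tensorDeg K V i * R * tensorDeg K V j := by
  simp [koszulW, Submodule.mem_iInf]

theorem koszulW_self {N : ℕ} {R : Submodule K (TensorAlgebra K V)} (hR : R ≤ tensorDeg K V N) :
    koszulW N R N = R := by
  ext u
  rw [mem_koszulW]
  constructor
  · rintro ⟨-, h⟩
    have := h 0 0 (by omega)
    rwa [tensorDeg_zero_mul, mul_tensorDeg_zero] at this
  · refine fun h => ⟨hR h, fun i j hij => ?_⟩
    obtain ⟨rfl, rfl⟩ : i = 0 ∧ j = 0 := by omega
    rwa [tensorDeg_zero_mul, mul_tensorDeg_zero]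

theorem koszulW_of_lt {N m : ℕ} {R : Submodule K (TensorAlgebra K V)} (h : m < N) :
    koszulW N R m = tensorDeg K V m := by
  ext u
  rw [mem_koszulW]
  exact ⟨fun h => h.1, fun hu => ⟨hu, fun i j hij => by omega⟩⟩

theorem rcoord_mem_koszulW {N m : ℕ} {R : Submodule K (TensorAlgebra K V)}
    {u : TensorAlgebra K V} (hu : u ∈ koszulW N R (m + 1)) (f : V →ₗ[K] K) :
    rcoord f u ∈ koszulW N R m := by
  rw [mem_koszulW] at hu ⊢
  exact ⟨rcoord_mem_tensorDeg hu.1 f, fun i j hij => rcoord_mem_mul_mul (hu.2 i (j + 1) (by omega)) f⟩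

/-- Right coordinates map `W_{n+1}` into `W_n`, and an element without constant term is determined
by its right coordinates. -/
theorem koszulW_eq_bot_of_le {κ : Type*} [Fintype κ] (v : Module.Basis κ K V) {N m n : ℕ}
    {R : Submodule K (TensorAlgebra K V)} (h : koszulW N R m = ⊥) (hmn : m ≤ n) :
    koszulW N R n = ⊥ := by
  induction n, hmn using Nat.le_induction with
  | base => exact h
  | succ n _ ih =>
    rw [eq_bot_iff]
    intro u hu
    have h0 : ∀ f, rcoord f u = 0 := fun f => by
      have := rcoord_mem_koszulW hu f
      rwa [ih, Submodule.mem_bot] at this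
    rw [Submodule.mem_bot, eq_sum_rcoord_of_mem v
      (algebraMapInv_of_mem_tensorDeg (mem_koszulW.1 hu).1)]
    simp [h0]

variable {s : ℕ} (v : Module.Basis (Fin (s + 1)) K V) {d : Fin (s + 1) → K}

/-- The generator `∑ d_k v_k r_k = ∑ r_k v_k d_k` of `W_4`, where `r_k` are the Yang–Mills
relations. -/
def ymTop (d : Fin (s + 1) → K) : TensorAlgebra K V :=
  ∑ k, (d k • ι K (v k)) * ymMap v d (v k)

/-- The second expression `∑ r_k d_k v_k` of the generator displays its last tensor factor. -/
theorem rcoord_ymTop (l : Fin (s + 1)) :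
    rcoord (v.coord l) (ymTop v d) = d l • ymMap v d (v l) := by
  rw [ymTop, sum_smul_mul_ymMap, map_sum, Finset.sum_eq_single l]
  · rw [mul_smul_comm, map_smul, rcoord_mul_ι]
    simp
  · intro k _ hk
    rw [mul_smul_comm, map_smul, rcoord_mul_ι]
    simp [hk]
  · simp

theorem rcoord_mul_ymMap (f : V →ₗ[K] K) (a : TensorAlgebra K V) (u : V) :
    rcoord f (a * ymMap v d u) = a * rcoord f (ymMap v d u) :=
  rcoord_mul_of_mem f a (algebraMapInv_of_mem_tensorDeg (ymMap_mem _ _ _))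

theorem rcoord_sum_mul_ymMap (f : V →ₗ[K] K) (c : Fin (s + 1) → TensorAlgebra K V) :
    rcoord f (∑ k, c k * ymMap v d (v k)) = ∑ k, c k * rcoord f (ymMap v d (v k)) := by
  rw [map_sum]
  exact Finset.sum_congr rfl fun k _ => rcoord_mul_ymMap v f _ _

/-- In degrees at most two, `exists_toQuot_eq_of_mem` holds in the tensor algebra itself. -/
theorem exists_eq_mul_of_mem (hd : ∀ k, d k ≠ 0) (hs : 1 ≤ s) {n : ℕ} (hn : n + 1 < 3)
    {c : Fin (s + 1) → TensorAlgebra K V} (hc : ∀ k, c k ∈ tensorDeg K V (n + 1))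
    (h : ∀ l, toQuot (ymRels v d) (∑ k, c k * rcoord (v.coord l) (ymMap v d (v k))) = 0) :
    ∃ a ∈ tensorDeg K V n, ∀ k, c k = a * (d k • ι K (v k)) := by
  obtain ⟨a, ha, -, hk⟩ := exists_toQuot_eq_of_mem v hd hs hc h
  refine ⟨a, ha n rfl, fun k => ?_⟩
  rw [← sub_eq_zero]
  exact eq_zero_of_toQuot (ymRels_le v d) hn (sub_mem (hc k)
    (mul_mem_tensorDeg (ha n rfl) (Submodule.smul_mem _ _ (ι_mem_tensorDeg _)) rfl)) (hk k)

/-- A linear relation is a syzygy with coefficients of degree 0, and exactness makes it a multiple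
of `(d_k v_k)` by an element of degree `-1`. -/
theorem linearIndependent_ymMap (hd : ∀ k, d k ≠ 0) (hs : 1 ≤ s) :
    LinearIndependent K fun k => ymMap v d (v k) := by
  rw [Fintype.linearIndependent_iff]
  intro c hc k
  obtain ⟨a, -, ha, hk⟩ := exists_toQuot_eq_of_mem v hd hs (n := 0)
    (c := fun k => algebraMap K _ (c k)) (fun k => mem_tensorDeg_zero.2 ⟨_, rfl⟩) (fun l => by
      rw [← rcoord_sum_mul_ymMap]
      simp only [← Algebra.smul_def, hc, map_zero])
  have h1 := hk k
  rw [ha rfl, zero_mul, sub_zero] at h1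
  have h2 := eq_zero_of_toQuot (ymRels_le v d) (by norm_num : 0 < 3)
    (mem_tensorDeg_zero.2 ⟨_, rfl⟩) h1
  rwa [algebraMap_eq_zero_iff] at h2

theorem ymTop_mem (i j : ℕ) (hij : i + 3 + j = 4) :
    ymTop v d ∈ tensorDeg K V i * ymRels v d * tensorDeg K V j := by
  have hr : ∀ k, ymMap v d (v k) ∈ ymRels v d := fun k => Submodule.subset_span ⟨k, rfl⟩
  have hθ : ∀ k, d k • ι K (v k) ∈ tensorDeg K V 1 :=
    fun k => Submodule.smul_mem _ _ (ι_mem_tensorDeg _)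
  obtain ⟨rfl, rfl⟩ | ⟨rfl, rfl⟩ : (i = 0 ∧ j = 1) ∨ (i = 1 ∧ j = 0) := by omega
  · rw [tensorDeg_zero_mul, ymTop, sum_smul_mul_ymMap]
    exact sum_mem fun k _ => Submodule.mul_mem_mul (hr k) (hθ k)
  · rw [mul_tensorDeg_zero, ymTop]
    exact sum_mem fun k _ => Submodule.mul_mem_mul (hθ k) (hr k)

theorem ymTop_mem_tensorDeg : ymTop v d ∈ tensorDeg K V 4 :=
  sum_mem fun _ _ => mul_mem_tensorDeg (Submodule.smul_mem _ _ (ι_mem_tensorDeg _))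
    (ymMap_mem _ _ _) rfl

/-- Write `u = ∑ c_k r_k`. That `u` also lies in `V^{⊗n} ⊗ R ⊗ V` makes `∑ c_k q_{kl}` vanish in
`A`, so `c_k = a d_k v_k` by exactness. The `c_k` have degree below 3, where `T(V)` and `A` agree,
so the equality holds in `T(V)`. -/
theorem exists_eq_mul_ymTop (hd : ∀ k, d k ≠ 0) (hs : 1 ≤ s) {n : ℕ} (hn : n + 1 < 3)
    {u : TensorAlgebra K V} (hu : u ∈ koszulW 3 (ymRels v d) (n + 4)) :
    ∃ a ∈ tensorDeg K V n, u = a * ymTop v d := by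
  rw [mem_koszulW] at hu
  have h1 := hu.2 (n + 1) 0 (by omega)
  rw [mul_tensorDeg_zero] at h1
  obtain ⟨c, hc, rfl⟩ := exists_eq_sum_mul_of_mem h1
  obtain ⟨a, ha, hk⟩ := exists_eq_mul_of_mem v hd hs hn hc fun l => by
    rw [← rcoord_sum_mul_ymMap]
    exact toQuot_of_mem_mul_mul (rcoord_mem_mul_mul (hu.2 n 1 (by omega)) _)
  refine ⟨a, ha, ?_⟩
  simp only [hk, ymTop, Finset.mul_sum, mul_assoc]

theorem koszulW_four (hd : ∀ k, d k ≠ 0) (hs : 1 ≤ s) :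
    koszulW 3 (ymRels v d) 4 = Submodule.span K (Set.range fun _ : Unit => ymTop v d) := by
  apply le_antisymm
  · intro u hu
    obtain ⟨a, ha, rfl⟩ := exists_eq_mul_ymTop v hd hs (n := 0) (by norm_num) hu
    obtain ⟨c, rfl⟩ := mem_tensorDeg_zero.1 ha
    rw [← Algebra.smul_def]
    exact Submodule.smul_mem _ _ (Submodule.subset_span ⟨(), rfl⟩)
  · rw [Submodule.span_le]
    rintro _ ⟨_, rfl⟩
    exact mem_koszulW.2 ⟨ymTop_mem_tensorDeg v, ymTop_mem v⟩

/-- An element `a ∑ r_k d_k v_k`, with `a` of degree 1, that lies in `R ⊗ V ⊗ V` satisfies `a q_{0l}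
= 0` in `A`, so `(a, 0, …, 0)` is a syzygy. By exactness it is `c (d_k v_k)` with a scalar `c`; the
zero in position 1 forces `c = 0`. -/
theorem koszulW_five (hd : ∀ k, d k ≠ 0) (hs : 1 ≤ s) : koszulW 3 (ymRels v d) 5 = ⊥ := by
  rw [eq_bot_iff]
  intro u hu
  obtain ⟨a, ha, rfl⟩ := exists_eq_mul_ymTop v hd hs (n := 1) (by norm_num) hu
  have h1 : ∀ l, toQuot (ymRels v d) (a * rcoord (v.coord l) (ymMap v d (v 0))) = 0 := by
    intro l
    have h2 := toQuot_of_mem_mul_mul (rcoord_mem_mul_mul (rcoord_mem_mul_mul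
      ((mem_koszulW.1 hu).2 0 2 rfl) (v.coord 0)) (v.coord l))
    rw [rcoord_mul_of_mem _ _ (algebraMapInv_of_mem_tensorDeg (ymTop_mem_tensorDeg v)),
      rcoord_ymTop, mul_smul_comm, map_smul, map_smul, rcoord_mul_ymMap] at h2
    exact (smul_eq_zero.1 h2).resolve_left (hd 0)
  obtain ⟨b, hb, hk⟩ := exists_eq_mul_of_mem v hd hs (n := 0) (by norm_num)
    (c := fun k => if k = 0 then a else 0) (fun k => by
      split_ifs
      · exact ha
      · exact zero_mem _) (fun l => by simpa using h1 l)
  obtain ⟨c, rfl⟩ := mem_tensorDeg_zero.1 hb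
  have h3 := hk (Fin.succ ⟨0, hs⟩)
  rw [if_neg (Fin.succ_ne_zero _), ← Algebra.smul_def] at h3
  have h4 : c = 0 := by
    have h5 := (smul_eq_zero.1 h3.symm).resolve_right
    refine h5 fun h6 => ?_
    have h7 := (smul_eq_zero.1 h6).resolve_left (hd _)
    rw [ι_eq_zero_iff] at h7
    exact v.ne_zero _ h7
  have h5 := hk 0
  rw [if_pos rfl, h4, map_zero, zero_mul] at h5
  rw [h5, zero_mul]
  exact zero_mem _

theorem mem_koszulTerm_one (x : QuotAlg (ymRels v d) ⊗[K] TensorAlgebra K V) :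
    x ∈ koszulTerm 3 (ymRels v d) 1 ↔ ∃ a : Fin (s + 1) → QuotAlg (ymRels v d),
      x = ∑ k, a k ⊗ₜ[K] ι K (v k) := by
  have h : koszulW 3 (ymRels v d) (jump 3 1) =
      Submodule.span K (Set.range fun k => ι K (v k)) := by
    change koszulW 3 (ymRels v d) 1 = _
    rw [koszulW_of_lt (by norm_num)]
    unfold tensorDeg
    rw [pow_one, LinearMap.range_eq_map, ← v.span_eq, Submodule.map_span, ← Set.range_comp]
    rfl
  rw [koszulTerm, h, mem_range_lTensor_span]

theorem mem_koszulTerm_two (x : QuotAlg (ymRels v d) ⊗[K] TensorAlgebra K V) :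
    x ∈ koszulTerm 3 (ymRels v d) 2 ↔ ∃ a : Fin (s + 1) → QuotAlg (ymRels v d),
      x = ∑ k, a k ⊗ₜ[K] ymMap v d (v k) := by
  have h : koszulW 3 (ymRels v d) (jump 3 2) = ymRels v d := koszulW_self (ymRels_le v d)
  rw [koszulTerm, h]
  exact mem_range_lTensor_span _ _

theorem mem_koszulTerm_three (hd : ∀ k, d k ≠ 0) (hs : 1 ≤ s)
    (x : QuotAlg (ymRels v d) ⊗[K] TensorAlgebra K V) :
    x ∈ koszulTerm 3 (ymRels v d) 3 ↔ ∃ a : QuotAlg (ymRels v d), x = a ⊗ₜ[K] ymTop v d := by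
  have h : koszulW 3 (ymRels v d) (jump 3 3) = _ := koszulW_four v hd hs
  rw [koszulTerm, h, mem_range_lTensor_span]
  constructor
  · rintro ⟨a, rfl⟩
    exact ⟨a (), by simp⟩
  · rintro ⟨a, rfl⟩
    exact ⟨fun _ => a, by simp⟩

theorem koszulTerm_eq_bot (hd : ∀ k, d k ≠ 0) (hs : 1 ≤ s) {i : ℕ} (hi : 4 ≤ i) :
    koszulTerm 3 (ymRels v d) i = ⊥ := by
  have h : koszulW 3 (ymRels v d) (jump 3 i) = ⊥ :=
    koszulW_eq_bot_of_le v (koszulW_five v hd hs) (by unfold jump; omega)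
  rw [koszulTerm, h, LinearMap.range_eq_bot]
  refine TensorProduct.ext' fun a t => ?_
  rw [LinearMap.lTensor_tmul, Submodule.subtype_apply, (Submodule.mem_bot K).1 t.2,
    TensorProduct.tmul_zero, LinearMap.zero_apply]

theorem koszulD_one_tmul (R : Submodule K (TensorAlgebra K V)) (a : QuotAlg R) (w : V) :
    koszulD 3 R 1 (a ⊗ₜ[K] ι K w) = (a * toQuot R (ι K w)) ⊗ₜ[K] 1 := by
  have := shiftMap_pow_tmul R (ι_mem_tensorDeg w) a 1
  rwa [mul_one] at this

theorem koszulD_two_tmul (a : QuotAlg (ymRels v d)) (u : V) :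
    koszulD 3 (ymRels v d) 2 (a ⊗ₜ[K] ymMap v d u) =
      ∑ l, (a * toQuot _ (rcoord (v.coord l) (ymMap v d u))) ⊗ₜ[K] ι K (v l) := by
  conv_lhs => rw [eq_sum_rcoord_of_mem v (algebraMapInv_of_mem_tensorDeg (ymMap_mem v d u))]
  rw [TensorProduct.tmul_sum, map_sum]
  exact Finset.sum_congr rfl fun l _ =>
    shiftMap_pow_tmul _ (n := 2) (rcoord_mem_tensorDeg (ymMap_mem v d u) _) _ _

theorem koszulD_three_tmul (a : QuotAlg (ymRels v d)) :
    koszulD 3 (ymRels v d) 3 (a ⊗ₜ[K] ymTop v d) =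
      ∑ k, (a * (d k • ymGen v d k)) ⊗ₜ[K] ymMap v d (v k) := by
  rw [ymTop, TensorProduct.tmul_sum, map_sum]
  refine Finset.sum_congr rfl fun l _ => ?_
  have := shiftMap_pow_tmul (ymRels v d) (Submodule.smul_mem _ (d l) (ι_mem_tensorDeg (v l))) a
    (ymMap v d (v l))
  rw [map_smul] at this
  exact this

theorem linearIndependent_ι : LinearIndependent K fun k => ι K (v k) :=
  v.linearIndependent.map' (ι K) (LinearMap.ker_eq_bot.2 (ι_leftInverse (R := K) (M := V)).injective)

/-- The Yang–Mills algebra is Koszul. -/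
theorem isKoszulHomogeneous_ymRels (hd : ∀ k, d k ≠ 0) (hs : 1 ≤ s) :
    IsKoszulHomogeneous 3 (ymRels v d) := by
  intro i hi
  obtain rfl | rfl | rfl | h : i = 1 ∨ i = 2 ∨ i = 3 ∨ 4 ≤ i := by omega
  · apply le_antisymm
    · rintro _ ⟨x, hx, rfl⟩
      obtain ⟨a, rfl⟩ := (mem_koszulTerm_two v x).1 hx
      rw [map_sum]
      refine sum_mem fun k _ => ?_
      rw [koszulD_two_tmul]
      refine ⟨(mem_koszulTerm_one v _).2 ⟨_, rfl⟩, ?_⟩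
      rw [SetLike.mem_coe, LinearMap.mem_ker, map_sum]
      simp only [koszulD_one_tmul, mul_assoc, ← map_mul]
      rw [← TensorProduct.sum_tmul, ← Finset.mul_sum, ← map_sum, ← eq_sum_rcoord_of_mem v
        (algebraMapInv_of_mem_tensorDeg (ymMap_mem v d _)), toQuot_ymMap, mul_zero,
        TensorProduct.zero_tmul]
    · rintro x ⟨hx, hx0⟩
      obtain ⟨a, rfl⟩ := (mem_koszulTerm_one v x).1 hx
      rw [SetLike.mem_coe, LinearMap.mem_ker, map_sum] at hx0
      simp only [koszulD_one_tmul] at hx0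
      rw [← TensorProduct.sum_tmul] at hx0
      choose t ht using fun k => toQuot_surjective _ (a k)
      have h0 : toQuot (ymRels v d) (∑ k, t k * ι K (v k)) = 0 := by
        rw [map_sum]
        simp only [map_mul, ht]
        exact eq_zero_of_sum_tmul_eq_zero (κ := Unit) (f := fun _ => (1 : TensorAlgebra K V))
          (LinearIndependent.of_subsingleton () one_ne_zero) (a := fun _ => _) (by simpa using hx0) ()
      -- Exactness at `A ⊗ V` is the equality `I = T R + I V`: the `c_k` from this decomposition
      -- give a preimage.
      obtain ⟨c, hc⟩ := exists_rcoord_toQuot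
        (fun k => algebraMapInv_of_mem_tensorDeg (ymMap_mem v d (v k))) h0
      refine ⟨∑ k, toQuot _ (c k) ⊗ₜ[K] ymMap v d (v k), (mem_koszulTerm_two v _).2 ⟨_, rfl⟩, ?_⟩
      rw [map_sum]
      simp_rw [koszulD_two_tmul v]
      rw [Finset.sum_comm]
      refine Finset.sum_congr rfl fun l _ => ?_
      have h1 := hc (v.coord l)
      rw [map_sum, Finset.sum_eq_single l, map_sum] at h1
      · rw [← TensorProduct.sum_tmul, ← ht l]
        simp only [map_mul] at h1
        simp only [rcoord_mul_ι, Module.Basis.coord_apply, Module.Basis.repr_self,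
          Finsupp.single_eq_same, one_smul] at h1
        exact congrArg (· ⊗ₜ[K] ι K (v l)) h1.symm
      · intro k _ hk
        simp [hk]
      · simp
  · apply le_antisymm
    · rintro _ ⟨x, hx, rfl⟩
      obtain ⟨a, rfl⟩ := (mem_koszulTerm_three v hd hs x).1 hx
      rw [koszulD_three_tmul]
      refine ⟨(mem_koszulTerm_two v _).2 ⟨_, rfl⟩, ?_⟩
      rw [SetLike.mem_coe, LinearMap.mem_ker, map_sum]
      simp only [koszulD_two_tmul]
      rw [Finset.sum_comm]
      refine Finset.sum_eq_zero fun l _ => ?_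
      rw [← TensorProduct.sum_tmul]
      simp only [toQuot_rcoord_ymMap, mul_assoc, ← Finset.mul_sum, sum_smul_mul_ymEntry,
        sum_lie_lie_ymGen, smul_zero, mul_zero, TensorProduct.zero_tmul]
    · rintro x ⟨hx, hx0⟩
      obtain ⟨a, rfl⟩ := (mem_koszulTerm_two v x).1 hx
      rw [SetLike.mem_coe, LinearMap.mem_ker, map_sum] at hx0
      simp only [koszulD_two_tmul] at hx0
      rw [Finset.sum_comm] at hx0
      simp only [← TensorProduct.sum_tmul] at hx0
      obtain ⟨a', ha'⟩ := exists_eq_mul_of_sum_mul_rcoord v hd hs a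
        (eq_zero_of_sum_tmul_eq_zero (linearIndependent_ι v) hx0)
      refine ⟨a' ⊗ₜ[K] ymTop v d, (mem_koszulTerm_three v hd hs _).2 ⟨_, rfl⟩, ?_⟩
      rw [koszulD_three_tmul]
      simp only [ha']
  -- The next term is zero, so injectivity of `A ⊗ W_4 → A ⊗ R` is needed. The component along `r_0`
  -- is right multiplication by `d_0 v_0`, which is injective.
  · rw [koszulTerm_eq_bot v hd hs le_rfl, Submodule.map_bot, eq_comm, eq_bot_iff]
    rintro x ⟨hx, hx0⟩
    obtain ⟨a, rfl⟩ := (mem_koszulTerm_three v hd hs x).1 hx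
    rw [SetLike.mem_coe, LinearMap.mem_ker, koszulD_three_tmul] at hx0
    have h1 := eq_zero_of_sum_tmul_eq_zero (linearIndependent_ymMap v hd hs) hx0 0
    rw [mul_smul_comm] at h1
    rw [ymGen_zero_isRegular v (hd 0) ((smul_eq_zero.1 h1).resolve_left (hd 0)),
      TensorProduct.zero_tmul]
    exact zero_mem _
  · rw [koszulTerm_eq_bot v hd hs h, koszulTerm_eq_bot v hd hs (by omega), Submodule.map_bot,
      bot_inf_eq]

end KoszulComplex

/-! ### The ideal of inhomogeneous relations, filtered by formal degree. -/

section PBW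

open TensorAlgebra

variable {K : Type*} [Field K] {V : Type*} [AddCommGroup V] [Module K V]

theorem naturalMap_surjective (N : ℕ) (P : Submodule K (TensorAlgebra K V)) (n : ℕ) :
    Function.Surjective (naturalMap N P n) := by
  intro z
  obtain ⟨⟨_, x, hx, rfl⟩, rfl⟩ := Submodule.Quotient.mk_surjective _ z
  rw [SetLike.mem_coe, tensorBelow_succ] at hx
  obtain ⟨y, hy, t, ht, rfl⟩ := Submodule.mem_sup.1 hx
  refine ⟨tensorToDeg (leadingPart N P) n ⟨t, ht⟩, ?_⟩
  rw [naturalMap_tensorToDeg]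
  refine (Submodule.Quotient.eq _).2 ?_
  change toQuot P t - toQuot P (y + t) ∈ quotBelow P n
  rw [map_add, sub_add_cancel_right]
  exact neg_mem (Submodule.mem_map_of_mem hy)

/-- The natural map is always surjective; its injectivity says that the leading part of an element
of `(P)` belongs to the ideal generated by the leading parts of `P`. -/
theorem hasPBW_iff (N : ℕ) (P : Submodule K (TensorAlgebra K V)) :
    HasPBW N P ↔ ∀ n, ∀ x ∈ tensorDeg K V n, ∀ y ∈ tensorBelow K V n, toQuot P (x + y) = 0 →
      toQuot (leadingPart N P) x = 0 := by
  have hker : ∀ n (x : tensorDeg K V n), naturalMap N P n (tensorToDeg _ n x) = 0 ↔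
      ∃ y ∈ tensorBelow K V n, toQuot P (x + y) = 0 := by
    intro n x
    rw [naturalMap_tensorToDeg]
    change Submodule.Quotient.mk _ = _ ↔ _
    rw [Submodule.Quotient.mk_eq_zero]
    change toQuot P x ∈ quotBelow P n ↔ _
    constructor
    · rintro ⟨y, hy, h⟩
      refine ⟨-y, neg_mem hy, ?_⟩
      rw [map_add, map_neg]
      change toQuot P y = _ at h
      rw [h, add_neg_cancel]
    · rintro ⟨y, hy, h⟩
      refine ⟨-y, neg_mem hy, ?_⟩
      rw [map_add] at h
      change toQuot P (-y) = _
      rw [map_neg]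
      exact (eq_neg_of_add_eq_zero_left h).symm
  have hdeg : ∀ n (x : tensorDeg K V n), tensorToDeg (leadingPart N P) n x = 0 ↔
      toQuot (leadingPart N P) x = 0 := by
    intro n x
    rw [Subtype.ext_iff]
    rfl
  constructor
  · intro h n x hx y hy hxy
    have h1 := (hker n ⟨x, hx⟩).2 ⟨y, hy, hxy⟩
    have h2 := (h n).1 (h1.trans (map_zero _).symm)
    exact (hdeg n ⟨x, hx⟩).1 h2
  · refine fun h n => ⟨?_, naturalMap_surjective N P n⟩
    rw [← LinearMap.ker_eq_bot, LinearMap.ker_eq_bot']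
    intro z hz
    obtain ⟨x, rfl⟩ := tensorToDeg_surjective _ n z
    obtain ⟨y, hy, hxy⟩ := (hker n x).1 hz
    exact (hdeg n x).2 (h n x x.2 y hy hxy)

theorem tproj_add_mem_of_mem_tensorBelow {n : ℕ} {x : TensorAlgebra K V}
    (hx : x ∈ tensorBelow K V (n + 1)) : x - tproj K V n x ∈ tensorBelow K V n := by
  rw [tensorBelow_succ] at hx
  obtain ⟨y, hy, t, ht, rfl⟩ := Submodule.mem_sup.1 hx
  rw [map_add, tproj_of_mem_tensorBelow le_rfl hy, tproj_of_mem ht, zero_add, add_sub_cancel_right]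
  exact hy

theorem mul_mem_tensorBelow {i n m : ℕ} {a y : TensorAlgebra K V} (ha : a ∈ tensorDeg K V i)
    (hy : y ∈ tensorBelow K V n) (h : i + n = m) : a * y ∈ tensorBelow K V m := by
  have := mul_mul_mem_tensorBelow ha hy (one_mem_tensorDeg (K := K) (V := V))
  rwa [mul_one, add_zero, h] at this

theorem mem_mul_mem_tensorBelow {i n m : ℕ} {a y : TensorAlgebra K V} (ha : a ∈ tensorDeg K V i)
    (hy : y ∈ tensorBelow K V n) (h : n + i = m) : y * a ∈ tensorBelow K V m := by
  have := mul_mul_mem_tensorBelow (one_mem_tensorDeg (K := K) (V := V)) hy ha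
  rwa [one_mul, zero_add, h] at this

/-- The part of the ideal `(P)`, `P ⊆ F^3`, spanned by the products `a p b` of formal degree less
than `n`. -/
def idealBelow (P : Submodule K (TensorAlgebra K V)) (n : ℕ) : Submodule K (TensorAlgebra K V) :=
  ⨆ (i : ℕ) (j : ℕ) (_ : i + 3 + j < n), tensorDeg K V i * P * tensorDeg K V j

theorem mul_mem_idealBelow {P : Submodule K (TensorAlgebra K V)} {i j n : ℕ} (h : i + 3 + j < n) :
    tensorDeg K V i * P * tensorDeg K V j ≤ idealBelow P n :=
  le_iSup_of_le i (le_iSup_of_le j (le_iSup_of_le h le_rfl))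

theorem idealBelow_le {P : Submodule K (TensorAlgebra K V)} {n : ℕ}
    {S : Submodule K (TensorAlgebra K V)}
    (h : ∀ i j, i + 3 + j < n → ∀ a ∈ tensorDeg K V i, ∀ p ∈ P, ∀ b ∈ tensorDeg K V j,
      a * p * b ∈ S) : idealBelow P n ≤ S := by
  refine iSup_le fun i => iSup_le fun j => iSup_le fun hij => ?_
  rw [Submodule.mul_le]
  intro x hx b hb
  have : tensorDeg K V i * P ≤ S.comap (LinearMap.mulRight K b) := by
    rw [Submodule.mul_le]
    intro a ha p hp
    exact h i j hij a ha p hp b hb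
  exact this hx

theorem mul_mul_mem_idealBelow {P : Submodule K (TensorAlgebra K V)} {i j n : ℕ}
    (h : i + 3 + j < n) {a p b : TensorAlgebra K V} (ha : a ∈ tensorDeg K V i) (hp : p ∈ P)
    (hb : b ∈ tensorDeg K V j) : a * p * b ∈ idealBelow P n :=
  mul_mem_idealBelow h (Submodule.mul_mem_mul (Submodule.mul_mem_mul ha hp) hb)

theorem mul_rel_mem_idealBelow {P : Submodule K (TensorAlgebra K V)} {n : ℕ}
    {t p : TensorAlgebra K V} (ht : t ∈ tensorBelow K V n) (hp : p ∈ P) :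
    t * p ∈ idealBelow P (n + 3) := by
  have : tensorBelow K V n ≤ (idealBelow P (n + 3)).comap (LinearMap.mulRight K p) := by
    refine iSup_le fun i a ha => ?_
    have := mul_mul_mem_idealBelow (by omega : (i : ℕ) + 3 + 0 < n + 3) ha hp one_mem_tensorDeg
    rwa [mul_one] at this
  exact this ht

theorem idealBelow_mul_mem {P : Submodule K (TensorAlgebra K V)} {m n k : ℕ}
    {x t : TensorAlgebra K V} (hx : x ∈ idealBelow P (m + 1)) (ht : t ∈ tensorBelow K V k)
    (h : m + k ≤ n) : x * t ∈ idealBelow P n := by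
  have : tensorBelow K V k ≤ (idealBelow P n).comap (LinearMap.mulLeft K x) := by
    refine iSup_le fun l b hb => ?_
    have : idealBelow P (m + 1) ≤ (idealBelow P n).comap (LinearMap.mulRight K b) :=
      idealBelow_le fun i j hij a ha p hp c hc => by
        rw [Submodule.mem_comap, LinearMap.mulRight_apply, mul_assoc]
        exact mul_mul_mem_idealBelow (by omega) ha hp (mul_mem_tensorDeg hc hb rfl)
    exact this hx
  exact this ht

theorem idealBelow_mono {P : Submodule K (TensorAlgebra K V)} {m n : ℕ} (h : m ≤ n) :
    idealBelow P m ≤ idealBelow P n :=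
  idealBelow_le fun _ _ hij _ ha _ hp _ hb => mul_mul_mem_idealBelow (by omega) ha hp hb

theorem exists_mem_idealBelow {P : Submodule K (TensorAlgebra K V)} {x : TensorAlgebra K V}
    (hx : toQuot P x = 0) : ∃ n, x ∈ idealBelow P n := by
  have hdir : Directed (· ≤ ·) (idealBelow P) :=
    Monotone.directed_le fun _ _ h => idealBelow_mono h
  rw [← Submodule.mem_iSup_of_directed _ hdir]
  refine mem_of_toQuot_eq_zero (fun p hp a b => ?_) hx
  induction a using tproj_induction with
  | zero => simp
  | add a c h1 h2 => rw [add_mul, add_mul]; exact add_mem h1 h2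
  | mem i a ha =>
    induction b using tproj_induction with
    | zero => simp
    | add b c h1 h2 => rw [mul_add]; exact add_mem h1 h2
    | mem j b hb =>
      exact le_iSup (idealBelow P) (i + 3 + j + 1)
        (mul_mul_mem_idealBelow (Nat.lt_succ_self _) ha hp hb)

theorem mul_mul_rel_mem_tensorBelow {P : Submodule K (TensorAlgebra K V)}
    (hP : P ≤ tensorBelow K V 4) {n : ℕ} : idealBelow P n ≤ tensorBelow K V n :=
  idealBelow_le fun _ _ hij _ ha _ hp _ hb =>
    tensorBelow_mono (by omega) (mul_mul_mem_tensorBelow ha (hP hp) hb)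

section Deformation

variable {κ : Type*} [Fintype κ] (v : κ → V) (d : κ → K) (J : V →ₗ[K] TensorAlgebra K V)

/-- The relations `r_k - J(v_k)` of an inhomogeneous Yang–Mills algebra. -/
def ymDefRels : Submodule K (TensorAlgebra K V) :=
  Submodule.span K (Set.range fun k => ymMap v d (v k) - J (v k))

theorem ymDefRels_le {J : V →ₗ[K] TensorAlgebra K V} (hJ : ∀ u, J u ∈ tensorBelow K V 3) :
    ymDefRels v d J ≤ tensorBelow K V 4 := by
  refine Submodule.span_le.2 ?_
  rintro _ ⟨k, rfl⟩
  exact sub_mem (tensorDeg_le_tensorBelow (by norm_num) (ymMap_mem v d _))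
    (tensorBelow_mono (by norm_num) (hJ _))

theorem mem_ymDefRels (k : κ) : ymMap v d (v k) - J (v k) ∈ ymDefRels v d J :=
  Submodule.subset_span ⟨k, rfl⟩

theorem leadingPart_ymDefRels {J : V →ₗ[K] TensorAlgebra K V}
    (hJ : ∀ u, J u ∈ tensorBelow K V 3) : leadingPart 3 (ymDefRels v d J) = ymRels v d := by
  apply le_antisymm
  · rintro x ⟨hx, hx3⟩
    obtain ⟨p, hp, y, hy, rfl⟩ := Submodule.mem_sup.1 hx
    rw [← tproj_of_mem hx3]
    refine Submodule.add_mem (ymRels v d) ?_ ?_ |> (map_add (tproj K V 3) p y ▸ ·)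
    · have : ymDefRels v d J ≤ (ymRels v d).comap (tproj K V 3) := by
        refine Submodule.span_le.2 ?_
        rintro _ ⟨k, rfl⟩
        rw [SetLike.mem_coe, Submodule.mem_comap, map_sub, tproj_of_mem (ymMap_mem v d _),
          tproj_of_mem_tensorBelow le_rfl (hJ _), sub_zero]
        exact Submodule.subset_span ⟨k, rfl⟩
      exact this hp
    · rw [tproj_of_mem_tensorBelow le_rfl hy]
      exact zero_mem _
  · refine Submodule.span_le.2 ?_
    rintro _ ⟨k, rfl⟩
    refine ⟨?_, ymMap_mem v d _⟩
    change ymMap v d (v k) ∈ ymDefRels v d J ⊔ tensorBelow K V 3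
    rw [← sub_add_cancel (ymMap v d (v k)) (J (v k))]
    exact Submodule.add_mem_sup (mem_ymDefRels v d J k) (hJ _)

/-- The pairs `(∑ a r_k b, ∑ a (r_k - J(v_k)) b)`, homogeneous of degree `n` in the first entry. -/
def defPairs (n : ℕ) : Submodule K (TensorAlgebra K V × TensorAlgebra K V) :=
  Submodule.span K {z | ∃ i j k, i + 3 + j = n ∧ ∃ a ∈ tensorDeg K V i, ∃ b ∈ tensorDeg K V j,
    z = (a * ymMap v d (v k) * b, a * (ymMap v d (v k) - J (v k)) * b)}

variable {v d J}

theorem mul_mul_mem_defPairs {i j n : ℕ} (h : i + 3 + j = n) {a b : TensorAlgebra K V}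
    (ha : a ∈ tensorDeg K V i) (hb : b ∈ tensorDeg K V j) (k : κ) :
    (a * ymMap v d (v k) * b, a * (ymMap v d (v k) - J (v k)) * b) ∈ defPairs v d J n :=
  Submodule.subset_span ⟨i, j, k, h, a, ha, b, hb, rfl⟩

theorem defPairs_le {n : ℕ} {S : Submodule K (TensorAlgebra K V × TensorAlgebra K V)}
    (h : ∀ i j k, i + 3 + j = n → ∀ a ∈ tensorDeg K V i, ∀ b ∈ tensorDeg K V j,
      (a * ymMap v d (v k) * b, a * (ymMap v d (v k) - J (v k)) * b) ∈ S) :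
    defPairs v d J n ≤ S := by
  refine Submodule.span_le.2 ?_
  rintro _ ⟨i, j, k, hij, a, ha, b, hb, rfl⟩
  exact h i j k hij a ha b hb

theorem defPairs_fst_mem {n : ℕ} {z : TensorAlgebra K V × TensorAlgebra K V}
    (hz : z ∈ defPairs v d J n) : z.1 ∈ tensorDeg K V n := by
  have : defPairs v d J n ≤ (tensorDeg K V n).comap (LinearMap.fst K _ _) :=
    defPairs_le fun i j k hij a ha b hb =>
      mul_mem_tensorDeg (mul_mem_tensorDeg ha (ymMap_mem v d _) rfl) hb hij
  exact this hz

theorem toQuot_defPairs_fst {n : ℕ} {z : TensorAlgebra K V × TensorAlgebra K V}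
    (hz : z ∈ defPairs v d J n) : toQuot (ymRels v d) z.1 = 0 := by
  have : defPairs v d J n ≤
      LinearMap.ker ((toQuot (ymRels v d)).toLinearMap.comp (LinearMap.fst K _ _)) :=
    defPairs_le fun i j k hij a ha b hb => by
      change toQuot (ymRels v d) (a * ymMap v d (v k) * b) = 0
      rw [map_mul, map_mul, toQuot_ymMap, mul_zero, zero_mul]
  exact this hz

theorem defPairs_snd_mem {n : ℕ} {z : TensorAlgebra K V × TensorAlgebra K V}
    (hz : z ∈ defPairs v d J n) : z.2 ∈ idealBelow (ymDefRels v d J) (n + 1) := by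
  have : defPairs v d J n ≤
      (idealBelow (ymDefRels v d J) (n + 1)).comap (LinearMap.snd K _ _) :=
    defPairs_le fun i j k hij a ha b hb =>
      mul_mul_mem_idealBelow (by omega) ha (mem_ymDefRels v d J k) hb
  exact this hz

theorem defPairs_sub_mem (hJ : ∀ u, J u ∈ tensorBelow K V 3) {n : ℕ}
    {z : TensorAlgebra K V × TensorAlgebra K V} (hz : z ∈ defPairs v d J n) :
    z.1 - z.2 ∈ tensorBelow K V n := by
  have : defPairs v d J n ≤
      (tensorBelow K V n).comap (LinearMap.fst K _ _ - LinearMap.snd K _ _) :=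
    defPairs_le fun i j k hij a ha b hb => by
      change a * ymMap v d (v k) * b - a * (ymMap v d (v k) - J (v k)) * b ∈
        tensorBelow K V n
      rw [← sub_mul, ← mul_sub, sub_sub_cancel, ← hij]
      exact mul_mul_mem_tensorBelow ha (hJ _) hb
  exact this hz

theorem defPairs_mul_mem {m n l : ℕ} {z : TensorAlgebra K V × TensorAlgebra K V}
    (hz : z ∈ defPairs v d J m) {t : TensorAlgebra K V} (ht : t ∈ tensorDeg K V l)
    (h : m + l = n) : (z.1 * t, z.2 * t) ∈ defPairs v d J n := by
  have : defPairs v d J m ≤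
      (defPairs v d J n).comap ((LinearMap.mulRight K t).prodMap (LinearMap.mulRight K t)) :=
    defPairs_le fun i j k hij a ha b hb => by
      rw [Submodule.mem_comap, LinearMap.prodMap_apply, LinearMap.mulRight_apply,
        LinearMap.mulRight_apply, mul_assoc _ b, mul_assoc _ b]
      exact mul_mul_mem_defPairs (by omega) ha (mul_mem_tensorDeg hb ht rfl) k
  exact this hz

/-- A lift of an element of the homogeneous ideal to the inhomogeneous one. The lift is not unique,
and two choices differ by the second entry of a pair `(0, p)`; the PBW property amounts to
controlling such `p`. -/
theorem exists_mem_defPairs {n : ℕ} {x : TensorAlgebra K V} (hx : x ∈ tensorDeg K V n)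
    (h : toQuot (ymRels v d) x = 0) : ∃ y, (x, y) ∈ defPairs v d J n := by
  have key : tproj K V n x ∈ (defPairs v d J n).map (LinearMap.fst K _ _) := by
    refine mem_of_toQuot_eq_zero
      (S := ((defPairs v d J n).map (LinearMap.fst K _ _)).comap (tproj K V n))
      (fun r hr a b => ?_) h
    obtain ⟨c, rfl⟩ := (Submodule.mem_span_range_iff_exists_fun K).1 hr
    rw [Finset.mul_sum, Finset.sum_mul]
    refine sum_mem fun k _ => ?_
    rw [mul_smul_comm, smul_mul_assoc]
    refine Submodule.smul_mem _ _ ?_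
    induction a using tproj_induction with
    | zero => simp
    | add a c h1 h2 => rw [add_mul, add_mul]; exact add_mem h1 h2
    | mem i a ha =>
      induction b using tproj_induction with
      | zero => simp
      | add b c h1 h2 => rw [mul_add]; exact add_mem h1 h2
      | mem j b hb =>
        have hdeg := mul_mem_tensorDeg (mul_mem_tensorDeg ha (ymMap_mem v d (v k)) rfl) hb rfl
        rw [Submodule.mem_comap]
        by_cases hij : i + 3 + j = n
        · subst hij
          rw [tproj_of_mem hdeg]
          exact ⟨_, mul_mul_mem_defPairs rfl ha hb k, rfl⟩
        · rw [tproj_of_mem_ne hdeg hij]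
          exact zero_mem _
  rw [tproj_of_mem hx] at key
  obtain ⟨⟨_, y⟩, hz, rfl⟩ := key
  exact ⟨y, hz⟩

end Deformation

end PBW

/-! ### The PBW criterion: a single syzygy has to lift. -/

section PBWCriterion

open TensorAlgebra

variable {K : Type*} [Field K] {V : Type*} [AddCommGroup V] [Module K V]

theorem rcoord_sum_mul_ι {κ : Type*} [Fintype κ] (v : Module.Basis κ K V)
    (u : κ → TensorAlgebra K V) (l : κ) :
    rcoord (v.coord l) (∑ i, u i * ι K (v i)) = u l := by
  classical
  rw [map_sum, Finset.sum_eq_single l]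
  · simp
  · intro k _ hk
    simp [hk]
  · simp

theorem defPairs_of_lt {κ : Type*} [Fintype κ] {v : κ → V} {d : κ → K}
    {J : V →ₗ[K] TensorAlgebra K V} {n : ℕ} (hn : n < 3) : defPairs v d J n = ⊥ := by
  rw [eq_bot_iff]
  exact defPairs_le fun i j k hij => by omega

/-- The decomposition `I = T R + I V`, carried out simultaneously in both entries of a pair. -/
theorem exists_eq_of_mem_defPairs {κ : Type*} [Fintype κ] {v : Module.Basis κ K V} {d : κ → K}
    {J : V →ₗ[K] TensorAlgebra K V} {m : ℕ} {z : TensorAlgebra K V × TensorAlgebra K V}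
    (hz : z ∈ defPairs v d J (m + 3)) :
    ∃ (c : κ → TensorAlgebra K V) (w : κ → TensorAlgebra K V × TensorAlgebra K V),
      (∀ k, c k ∈ tensorDeg K V m) ∧ (∀ l, w l ∈ defPairs v d J (m + 2)) ∧
      z.1 = ∑ k, c k * ymMap v d (v k) + ∑ l, (w l).1 * ι K (v l) ∧
      z.2 = ∑ k, c k * (ymMap v d (v k) - J (v k)) + ∑ l, (w l).2 * ι K (v l) := by
  classical
  induction hz using Submodule.span_induction with
  | mem z hz =>
    obtain ⟨i, j, k, hij, a, ha, b, hb, rfl⟩ := hz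
    cases j with
    | zero =>
      obtain rfl : i = m := by omega
      obtain ⟨c, rfl⟩ := mem_tensorDeg_zero.1 hb
      refine ⟨Pi.single k (c • a), 0, fun l => ?_, fun l => zero_mem _, ?_, ?_⟩
      · by_cases h : l = k
        · subst h
          rw [Pi.single_eq_same]
          exact Submodule.smul_mem _ _ ha
        · rw [Pi.single_eq_of_ne h]
          exact zero_mem _
      all_goals
        rw [Finset.sum_eq_single k (fun l _ hl => by rw [Pi.single_eq_of_ne hl, zero_mul])
          (by simp), Pi.single_eq_same, smul_mul_assoc, Algebra.smul_def, Algebra.commutes]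
        simp
    | succ j =>
      refine ⟨0, fun l => (a * ymMap v d (v k) * rcoord (v.coord l) b,
        a * (ymMap v d (v k) - J (v k)) * rcoord (v.coord l) b), fun _ => zero_mem _,
        fun l => mul_mul_mem_defPairs (by omega) ha (rcoord_mem_tensorDeg hb _) k, ?_, ?_⟩
      all_goals
        conv_lhs => rw [eq_sum_rcoord_of_mem v (algebraMapInv_of_mem_tensorDeg hb)]
        simp only [Pi.zero_apply, zero_mul, Finset.sum_const_zero, zero_add, Finset.mul_sum,
          mul_assoc]
  | zero => exact ⟨0, 0, fun _ => zero_mem _, fun _ => zero_mem _, by simp, by simp⟩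
  | add y z _ _ hy hz =>
    obtain ⟨c, w, hc, hw, h1, h2⟩ := hy
    obtain ⟨c', w', hc', hw', h1', h2'⟩ := hz
    refine ⟨c + c', w + w', fun k => add_mem (hc k) (hc' k), fun l => add_mem (hw l) (hw' l), ?_, ?_⟩
    · rw [Prod.fst_add, h1, h1']
      simp only [Pi.add_apply, Prod.fst_add, add_mul, Finset.sum_add_distrib]
      abel
    · rw [Prod.snd_add, h2, h2']
      simp only [Pi.add_apply, Prod.snd_add, add_mul, Finset.sum_add_distrib]
      abel
  | smul a z _ hz =>
    obtain ⟨c, w, hc, hw, h1, h2⟩ := hz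
    refine ⟨a • c, a • w, fun k => Submodule.smul_mem _ _ (hc k),
      fun l => Submodule.smul_mem _ _ (hw l), ?_, ?_⟩
    · rw [Prod.smul_fst, h1]
      simp only [Pi.smul_apply, Prod.smul_fst, smul_mul_assoc, smul_add, Finset.smul_sum]
    · rw [Prod.smul_snd, h2]
      simp only [Pi.smul_apply, Prod.smul_snd, smul_mul_assoc, smul_add, Finset.smul_sum]

/-- The syzygy `∑ d_k [v_k, r_k] = 0`, evaluated on the inhomogeneous relations, leaves the defect
`∑ d_k [v_k, J(v_k)]`. -/
theorem sum_smul_mul_defRel {κ : Type*} [Fintype κ] (v : κ → V) (d : κ → K)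
    (J : V →ₗ[K] TensorAlgebra K V) :
    ∑ k, (d k • ι K (v k)) * (ymMap v d (v k) - J (v k)) =
      ∑ k, (ymMap v d (v k) - J (v k)) * (d k • ι K (v k)) -
        ∑ k, d k • (ι K (v k) * J (v k) - J (v k) * ι K (v k)) := by
  simp only [mul_sub, sub_mul, Finset.sum_sub_distrib, smul_sub]
  rw [sum_smul_mul_ymMap]
  simp only [smul_mul_assoc, mul_smul_comm]
  abel

variable {s : ℕ} {v : Module.Basis (Fin (s + 1)) K V} {d : Fin (s + 1) → K}
  {J : V →ₗ[K] TensorAlgebra K V}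

/-- The syzygies of the Yang–Mills relations lift to the inhomogeneous relations. -/
theorem mem_idealBelow_of_mem_defPairs (hd : ∀ k, d k ≠ 0) (hs : 1 ≤ s)
    (hJ : ∀ u, J u ∈ tensorBelow K V 3)
    (h : ∑ k, d k • (ι K (v k) * J (v k) - J (v k) * ι K (v k)) ∈ ymDefRels v d J) (n : ℕ) :
    ∀ p, (0, p) ∈ defPairs v d J n → p ∈ idealBelow (ymDefRels v d J) n := by
  induction n with
  | zero =>
    intro p hp
    rw [defPairs_of_lt (by norm_num), Submodule.mem_bot, Prod.mk_eq_zero] at hp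
    rw [hp.2]
    exact zero_mem _
  | succ n ih =>
  intro p hp
  by_cases hn : n + 1 < 3
  · rw [defPairs_of_lt hn, Submodule.mem_bot, Prod.mk_eq_zero] at hp
    rw [hp.2]
    exact zero_mem _
  obtain ⟨m, rfl⟩ : ∃ m, n = m + 2 := ⟨n - 2, by omega⟩
  obtain ⟨c, w, hc, hw, h1, h2⟩ := exists_eq_of_mem_defPairs hp
  dsimp only at h1 h2
  -- As the first entry is 0, its right coordinates give `∑ c_k q_{kl} = -(w l).1`, which is in the
  -- ideal. Exactness yields `c_k = a d_k v_k + e_k` with `e_k` in the ideal, and `e'_k` below is a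
  -- lift of `e_k`.
  obtain ⟨a, ha, ha0, hak⟩ := exists_toQuot_eq_of_mem v hd hs hc fun l => by
    have h3 := congrArg (rcoord (v.coord l)) h1
    rw [map_zero, map_add, rcoord_sum_mul_ymMap, rcoord_sum_mul_ι] at h3
    rw [← neg_eq_of_add_eq_zero_left h3.symm, map_neg, toQuot_defPairs_fst (hw l), neg_zero]
  set q : Fin (s + 1) → Fin (s + 1) → TensorAlgebra K V :=
    fun k l => rcoord (v.coord l) (ymMap v d (v k)) with hq
  have hqmem : ∀ k l, q k l ∈ tensorDeg K V 2 := fun k l => rcoord_mem_tensorDeg (ymMap_mem v d _) _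
  have hqsum : ∀ k, ∑ l, q k l * ι K (v l) = ymMap v d (v k) := fun k =>
    (eq_sum_rcoord_of_mem v (algebraMapInv_of_mem_tensorDeg (ymMap_mem v d _))).symm
  set e : Fin (s + 1) → TensorAlgebra K V := fun k => c k - a * (d k • ι K (v k)) with he
  have hamem : ∀ k, a * (d k • ι K (v k)) ∈ tensorDeg K V m := by
    intro k
    cases m with
    | zero => rw [ha0 rfl, zero_mul]; exact zero_mem _
    | succ m => exact mul_mem_tensorDeg (ha m rfl) (Submodule.smul_mem _ _ (ι_mem_tensorDeg _)) rfl
  choose e' he' using fun k => exists_mem_defPairs (J := J) (sub_mem (hc k) (hamem k)) (hak k)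
  have hapair : ∀ k, (a * ymMap v d (v k), a * (ymMap v d (v k) - J (v k))) ∈
      defPairs v d J (m + 2) := by
    intro k
    cases m with
    | zero => rw [ha0 rfl, zero_mul, zero_mul]; exact zero_mem _
    | succ m =>
      have := mul_mul_mem_defPairs (J := J) (v := v) (d := d) (by omega : m + 3 + 0 = m + 1 + 2)
        (ha m rfl) one_mem_tensorDeg k
      rwa [mul_one, mul_one] at this
  -- These pairs collect every term with a letter `v_l` on the right: the original `w_l`, the part
  -- of `a ∑ d_k v_k r_k` rewritten as `a ∑ r_l d_l v_l`, and `∑ e_k r_k` with `r_k` expanded in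
  -- right coordinates. Their first entries vanish and their degree is one less, so the induction
  -- hypothesis applies to them.
  let w' : Fin (s + 1) → TensorAlgebra K V × TensorAlgebra K V := fun l =>
    w l + d l • (a * ymMap v d (v l), a * (ymMap v d (v l) - J (v l))) +
      ∑ k, (e k * q k l, e' k * q k l)
  have hw' : ∀ l, w' l ∈ defPairs v d J (m + 2) := fun l =>
    add_mem (add_mem (hw l) (Submodule.smul_mem _ _ (hapair l)))
      (sum_mem fun k _ => defPairs_mul_mem (he' k) (hqmem k l) rfl)
  have hc' : ∀ k, c k = a * (d k • ι K (v k)) + e k := fun k => (add_sub_cancel _ _).symm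
  have hfst : ∀ l, (w' l).1 = 0 := by
    apply sum_mul_ι_eq_zero v
    have : ∀ l, (w' l).1 * ι K (v l) = (w l).1 * ι K (v l) +
        a * (ymMap v d (v l) * (d l • ι K (v l))) + ∑ k, e k * (q k l * ι K (v l)) := by
      intro l
      simp only [w', Prod.fst_add, Prod.fst_sum, Prod.smul_fst, add_mul, Finset.sum_mul, mul_assoc,
        smul_mul_assoc, mul_smul_comm]
    simp only [this, Finset.sum_add_distrib]
    rw [Finset.sum_comm]
    simp only [← Finset.mul_sum, hqsum]
    rw [← sum_smul_mul_ymMap, h1]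
    simp only [hc', add_mul, Finset.sum_add_distrib, Finset.mul_sum, mul_assoc]
    abel
  have hsnd : ∀ l, (w' l).2 * ι K (v l) ∈ idealBelow (ymDefRels v d J) (m + 3) := by
    intro l
    have h3 := ih (w' l).2 (by rw [← hfst l]; exact hw' l)
    exact idealBelow_mul_mem (idealBelow_mono (by omega : m + 2 ≤ m + 1 + 1) h3)
      (tensorDeg_le_tensorBelow (by norm_num : 1 < 2) (ι_mem_tensorDeg _)) (by omega)
  have hp' : p = ∑ l, (w' l).2 * ι K (v l) +
      (∑ k, ((e k - e' k) * (ymMap v d (v k) - J (v k)) - e' k * J (v k)) -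
        a * ∑ k, d k • (ι K (v k) * J (v k) - J (v k) * ι K (v k))) := by
    have : ∀ l, (w' l).2 * ι K (v l) = (w l).2 * ι K (v l) +
        a * ((ymMap v d (v l) - J (v l)) * (d l • ι K (v l))) +
          ∑ k, e' k * (q k l * ι K (v l)) := by
      intro l
      simp only [w', Prod.snd_add, Prod.snd_sum, Prod.smul_snd, add_mul, Finset.sum_mul, mul_assoc,
        smul_mul_assoc, mul_smul_comm]
    simp only [this, Finset.sum_add_distrib]
    rw [Finset.sum_comm]
    simp only [← Finset.mul_sum, hqsum]
    have h4 := sum_smul_mul_defRel v d J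
    rw [eq_sub_iff_add_eq] at h4
    rw [← h4, h2]
    have h5 : ∀ k, e k * (ymMap v d (v k) - J (v k)) = e' k * ymMap v d (v k) +
        ((e k - e' k) * (ymMap v d (v k) - J (v k)) - e' k * J (v k)) := by
      intro k
      noncomm_ring
    simp only [hc', add_mul, h5, Finset.sum_add_distrib, mul_add, Finset.mul_sum, mul_assoc]
    abel
  -- The correction terms all have formal degree below `m + 3`: `e_k - e'_k` lies in filtration
  -- degree below `m`, `J` has degree at most 2, and the defect is a relation multiplied by `a` of
  -- degree `m - 1`, with `a = 0` when `m = 0`.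
  rw [hp']
  refine add_mem (sum_mem fun l _ => hsnd l) (sub_mem (sum_mem fun k _ => sub_mem ?_ ?_) ?_)
  · exact mul_rel_mem_idealBelow (defPairs_sub_mem hJ (he' k)) (mem_ymDefRels _ _ _ k)
  · exact idealBelow_mul_mem (defPairs_snd_mem (he' k)) (hJ _) le_rfl
  · cases m with
    | zero => rw [ha0 rfl, zero_mul]; exact zero_mem _
    | succ m =>
      exact mul_rel_mem_idealBelow (tensorDeg_le_tensorBelow (Nat.lt_succ_self m) (ha m rfl)) h

theorem exists_eq_add_of_mem_idealBelow {κ : Type*} [Fintype κ] {v : κ → V} {d : κ → K} {n : ℕ}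
    {x : TensorAlgebra K V} (hx : x ∈ idealBelow (ymDefRels v d J) (n + 1)) :
    ∃ z ∈ defPairs v d J n, ∃ y ∈ idealBelow (ymDefRels v d J) n, x = z.2 + y := by
  have : idealBelow (ymDefRels v d J) (n + 1) ≤
      (defPairs v d J n).map (LinearMap.snd K _ _) ⊔ idealBelow (ymDefRels v d J) n := by
    refine idealBelow_le fun i j hij a ha p hp b hb => ?_
    by_cases h : i + 3 + j < n
    · exact Submodule.mem_sup_right (mul_mul_mem_idealBelow h ha hp hb)
    · obtain ⟨c, rfl⟩ := (Submodule.mem_span_range_iff_exists_fun K).1 hp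
      refine Submodule.mem_sup_left ?_
      rw [Finset.mul_sum, Finset.sum_mul]
      refine sum_mem fun k _ => ?_
      rw [mul_smul_comm, smul_mul_assoc]
      exact Submodule.smul_mem _ _
        ⟨_, mul_mul_mem_defPairs (J := J) (v := v) (d := d) (by omega) ha hb k, rfl⟩
  obtain ⟨_, ⟨z, hz, rfl⟩, y, hy, rfl⟩ := Submodule.mem_sup.1 (this hx)
  exact ⟨z, hz, y, hy, rfl⟩

theorem tproj_defPairs_snd {κ : Type*} [Fintype κ] {v : κ → V} {d : κ → K}
    (hJ : ∀ u, J u ∈ tensorBelow K V 3) {n : ℕ} {z : TensorAlgebra K V × TensorAlgebra K V}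
    (hz : z ∈ defPairs v d J n) : tproj K V n z.2 = z.1 := by
  have h1 := tproj_of_mem_tensorBelow le_rfl (defPairs_sub_mem hJ hz)
  rw [map_sub, tproj_of_mem (defPairs_fst_mem hz), sub_eq_zero] at h1
  exact h1.symm

/-- If `x` is expressed with formal degree `m ≥ n`, the part of formal degree `m` is the second
entry of a pair whose first entry is the degree `m` component of `x`, namely 0. By the lifting of
syzygies this part can be rewritten in lower formal degree. -/
theorem mem_idealBelow_of_mem_tensorBelow (hd : ∀ k, d k ≠ 0) (hs : 1 ≤ s)
    (hJ : ∀ u, J u ∈ tensorBelow K V 3)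
    (h : ∑ k, d k • (ι K (v k) * J (v k) - J (v k) * ι K (v k)) ∈ ymDefRels v d J) {n : ℕ}
    {x : TensorAlgebra K V} (hx : x ∈ tensorBelow K V n) (hx0 : toQuot (ymDefRels v d J) x = 0) :
    x ∈ idealBelow (ymDefRels v d J) n := by
  obtain ⟨m, hm⟩ := exists_mem_idealBelow hx0
  obtain hmn | hnm := le_total m n
  · exact idealBelow_mono hmn hm
  induction m, hnm using Nat.le_induction with
  | base => exact hm
  | succ m hnm ih =>
    apply ih
    obtain ⟨z, hz, y, hy, rfl⟩ := exists_eq_add_of_mem_idealBelow hm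
    have h1 := tproj_of_mem_tensorBelow hnm hx
    rw [map_add, tproj_defPairs_snd hJ hz, tproj_of_mem_tensorBelow le_rfl
      (mul_mul_rel_mem_tensorBelow (ymDefRels_le v d hJ) hy), add_zero] at h1
    refine add_mem (mem_idealBelow_of_mem_defPairs hd hs hJ h m _ ?_) hy
    rw [← h1]
    exact hz

/-- The ideal generated by `R` starts in degree 3; under PBW the inhomogeneous ideal therefore
contains no nonzero element of degree at most 2. -/
theorem eq_zero_of_hasPBW (hJ : ∀ u, J u ∈ tensorBelow K V 3)
    (h : HasPBW 3 (ymDefRels v d J)) {n : ℕ} (hn : n ≤ 3) {x : TensorAlgebra K V}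
    (hx : x ∈ tensorBelow K V n) (hx0 : toQuot (ymDefRels v d J) x = 0) : x = 0 := by
  rw [hasPBW_iff, leadingPart_ymDefRels v d hJ] at h
  induction n with
  | zero =>
    rw [tensorBelow, iSup_of_empty] at hx
    exact hx
  | succ n ih =>
    have h1 := h n _ (tproj_mem n x) _ (tproj_add_mem_of_mem_tensorBelow hx) (by
      rwa [add_sub_cancel])
    have h2 := eq_zero_of_toQuot (ymRels_le v d) (by omega) (tproj_mem n x) h1
    have h3 := tproj_add_mem_of_mem_tensorBelow hx
    rw [h2, sub_zero] at h3
    exact ih (by omega) h3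

/-- An inhomogeneous Yang–Mills algebra has the PBW property if and only if the syzygy
`∑ d_k [v_k, r_k] = 0` of the Yang–Mills relations lifts. -/
theorem hasPBW_ymDefRels_iff (hd : ∀ k, d k ≠ 0) (hs : 1 ≤ s)
    (hJ : ∀ u, J u ∈ tensorBelow K V 3) :
    HasPBW 3 (ymDefRels v d J) ↔
      ∑ k, d k • (ι K (v k) * J (v k) - J (v k) * ι K (v k)) ∈ ymDefRels v d J := by
  constructor
  · intro h
    set z := ∑ k, d k • (ι K (v k) * J (v k) - J (v k) * ι K (v k)) with hz
    have hz4 : z ∈ tensorBelow K V 4 := by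
      refine sum_mem fun k _ => Submodule.smul_mem _ _ (sub_mem ?_ ?_)
      · exact mul_mem_tensorBelow (ι_mem_tensorDeg _) (hJ _) rfl
      · exact mem_mul_mem_tensorBelow (ι_mem_tensorDeg _) (hJ _) rfl
    have hz0 : toQuot (ymDefRels v d J) z = 0 := by
      have h1 := sum_smul_mul_defRel v d J
      rw [eq_sub_iff_add_eq, ← eq_sub_iff_add_eq', ← hz] at h1
      have h2 : ∀ k, toQuot (ymDefRels v d J) (ymMap v d (v k) - J (v k)) = 0 :=
        fun k => toQuot_of_mem (mem_ymDefRels v d J k)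
      rw [h1, map_sub, map_sum, map_sum]
      simp only [map_mul, h2, mul_zero, zero_mul, Finset.sum_const_zero, sub_zero]
    have h1 := h
    rw [hasPBW_iff, leadingPart_ymDefRels v d hJ] at h1
    -- PBW puts the cubic part of the defect in `R`. Subtracting the corresponding element of `P`
    -- leaves an element of the ideal of degree at most 2, which must be 0.
    have h2 := mem_of_toQuot (ymRels_le v d) (tproj_mem 3 z)
      (h1 3 _ (tproj_mem 3 z) _ (tproj_add_mem_of_mem_tensorBelow hz4) (by rwa [add_sub_cancel]))
    obtain ⟨c, hc⟩ := (Submodule.mem_span_range_iff_exists_fun K).1 h2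
    have hp : ∑ k, c k • (ymMap v d (v k) - J (v k)) ∈ ymDefRels v d J :=
      sum_mem fun k _ => Submodule.smul_mem _ _ (mem_ymDefRels v d J k)
    have h3 : z - ∑ k, c k • (ymMap v d (v k) - J (v k)) ∈ tensorBelow K V 3 := by
      have : z - ∑ k, c k • (ymMap v d (v k) - J (v k)) =
          (z - tproj K V 3 z) + ∑ k, c k • J (v k) := by
        rw [← hc]
        simp only [smul_sub, Finset.sum_sub_distrib]
        abel
      rw [this]
      exact add_mem (tproj_add_mem_of_mem_tensorBelow hz4)
        (sum_mem fun k _ => Submodule.smul_mem _ _ (hJ _))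
    have h4 := eq_zero_of_hasPBW hJ h le_rfl h3 (by rw [map_sub, hz0, toQuot_of_mem hp, sub_zero])
    rw [sub_eq_zero] at h4
    rw [h4]
    exact hp
  · intro h
    rw [hasPBW_iff, leadingPart_ymDefRels v d hJ]
    intro n x hx y hy hxy
    -- An element of filtration degree at most `n` is a combination of products of formal degree at
    -- most `n`; those of degree exactly `n` determine its leading part, which is then in the
    -- homogeneous ideal.
    have h1 := mem_idealBelow_of_mem_tensorBelow hd hs hJ h (n := n + 1) (add_mem
      (tensorDeg_le_tensorBelow (Nat.lt_succ_self n) hx) (tensorBelow_mono (Nat.le_succ n) hy)) hxy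
    obtain ⟨z, hz, t, ht, h2⟩ := exists_eq_add_of_mem_idealBelow h1
    have h3 := congrArg (tproj K V n) h2
    rw [map_add, map_add, tproj_of_mem hx, tproj_of_mem_tensorBelow le_rfl hy,
      tproj_defPairs_snd hJ hz, tproj_of_mem_tensorBelow le_rfl
      (mul_mul_rel_mem_tensorBelow (ymDefRels_le v d hJ) ht), add_zero, add_zero] at h3
    rw [h3]
    exact toQuot_defPairs_fst hz

end PBWCriterion

/-! ### Diagonalization of the bilinear form. -/

section Diagonalization

open Matrix

variable {K : Type*} [Field K] {s : ℕ}

/-- The inverse of a nondegenerate symmetric matrix is `∑ d_k v_k v_kᵀ` for a basis `v`. -/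
theorem exists_basis_inv_eq (h2 : (2 : K) ≠ 0) {g : Matrix (Fin (s + 1)) (Fin (s + 1)) K}
    (hg : g.IsSymm) (hdet : IsUnit g.det) :
    ∃ (v : Module.Basis (Fin (s + 1)) K (Fin (s + 1) → K)) (d : Fin (s + 1) → K),
      (∀ k, d k ≠ 0) ∧ ∀ l m, g⁻¹ l m = ∑ k, d k * v k l * v k m := by
  have := invertibleOfNonzero h2
  have hsymm : LinearMap.IsSymm (Matrix.toBilin' g) := ⟨fun x y => by
    simp only [Matrix.toBilin'_apply, RingHom.id_apply]
    rw [Finset.sum_comm]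
    refine Finset.sum_congr rfl fun i _ => Finset.sum_congr rfl fun j _ => ?_
    rw [hg.apply i j]
    ring⟩
  obtain ⟨v', hv'⟩ := LinearMap.BilinForm.exists_orthogonal_basis hsymm
  let v := v'.reindex (finCongr (Module.finrank_fin_fun K (n := s + 1)))
  have hv : ∀ i j, i ≠ j → Matrix.toBilin' g (v i) (v j) = 0 := by
    intro i j hij
    simp only [v, Module.Basis.reindex_apply]
    exact hv' (fun h => hij ((finCongr _).symm.injective h))
  let M : Matrix (Fin (s + 1)) (Fin (s + 1)) K := (Pi.basisFun K _).toMatrix v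
  have hM : ∀ l k, M l k = v k l := fun l k => by simp [M, Module.Basis.toMatrix_apply]
  let e : Fin (s + 1) → K := fun k => Matrix.toBilin' g (v k) (v k)
  have hD : Mᵀ * (g * M) = diagonal e := by
    ext i j
    have h1 : (Mᵀ * (g * M)) i j = Matrix.toBilin' g (v i) (v j) := by
      rw [Matrix.toBilin'_apply, Matrix.mul_apply]
      refine Finset.sum_congr rfl fun l _ => ?_
      rw [Matrix.mul_apply, Finset.mul_sum, Matrix.transpose_apply]
      refine Finset.sum_congr rfl fun m _ => ?_
      rw [hM, hM]
      ring
    rw [h1, diagonal_apply]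
    split_ifs with h
    · subst h; rfl
    · exact hv i j h
  have hMdet : IsUnit M.det := by
    have := (Pi.basisFun K (Fin (s + 1))).invertibleToMatrix v
    exact Matrix.isUnit_det_of_invertible _
  have he : ∀ k, e k ≠ 0 := by
    have h1 : IsUnit (diagonal e).det := by
      rw [← hD, det_mul, det_mul, det_transpose]
      exact hMdet.mul (hdet.mul hMdet)
    rw [det_diagonal] at h1
    exact fun k => Finset.prod_ne_zero_iff.1 h1.ne_zero k (Finset.mem_univ k)
  refine ⟨v, fun k => (e k)⁻¹, fun k => inv_ne_zero (he k), ?_⟩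
  -- With the basis vectors as the columns of `M`, orthogonality is `Mᵀ g M = diag(e)`, hence `g⁻¹ =
  -- M diag(e)⁻¹ Mᵀ` and `d_k = e_k⁻¹`.
  have h1 : Mᵀ * (g * M * diagonal fun k => (e k)⁻¹) = 1 := by
    rw [← Matrix.mul_assoc, hD, diagonal_mul_diagonal, ← diagonal_one]
    congr 1
    funext k
    exact mul_inv_cancel₀ (he k)
  have h3 : g * (M * (diagonal fun k => (e k)⁻¹) * Mᵀ) = 1 := by
    rw [mul_eq_one_comm] at h1
    rwa [← Matrix.mul_assoc, ← Matrix.mul_assoc]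
  intro l m
  rw [Matrix.inv_eq_right_inv h3, Matrix.mul_apply]
  refine Finset.sum_congr rfl fun k _ => ?_
  rw [Matrix.mul_diagonal, Matrix.transpose_apply, hM, hM]
  ring

end Diagonalization

/-! ### The defect and the relations in the monomials `∇_a ∇_b ∇_c`. -/

section Coordinates

open TensorAlgebra

variable {K : Type*} [Field K] {s : ℕ}

/-- `∑ t_{abc} ∇_a ∇_b ∇_c`. -/
def cubicSum (t : Fin (s + 1) → Fin (s + 1) → Fin (s + 1) → K) :
    TensorAlgebra K (Fin (s + 1) → K) :=
  ∑ a, ∑ b, ∑ c, t a b c • (nabla a * nabla b * nabla c)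

/-- `∑ t_{ab} ∇_a ∇_b`. -/
def quadSum (t : Fin (s + 1) → Fin (s + 1) → K) : TensorAlgebra K (Fin (s + 1) → K) :=
  ∑ a, ∑ b, t a b • (nabla a * nabla b)

/-- `∑ t_a ∇_a`. -/
def linSum (t : Fin (s + 1) → K) : TensorAlgebra K (Fin (s + 1) → K) := ∑ a, t a • nabla a

theorem rcoord_mul_nabla (c l : Fin (s + 1)) (t : TensorAlgebra K (Fin (s + 1) → K)) :
    rcoord (LinearMap.proj c) (t * nabla l) = if l = c then t else 0 := by
  rw [nabla, rcoord_mul_ι, LinearMap.proj_apply, Pi.single_apply]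
  simp only [eq_comm (a := c), ite_smul, one_smul, zero_smul]

theorem rcoord_nabla (c l : Fin (s + 1)) :
    rcoord (LinearMap.proj c) (nabla l) = if l = c then (1 : TensorAlgebra K (Fin (s + 1) → K))
      else 0 := by
  rw [← rcoord_mul_nabla, one_mul]

theorem rcoord_cubicSum (t : Fin (s + 1) → Fin (s + 1) → Fin (s + 1) → K) (c : Fin (s + 1)) :
    rcoord (LinearMap.proj c) (cubicSum t) = quadSum fun a b => t a b c := by
  simp [cubicSum, quadSum, rcoord_mul_nabla]

theorem rcoord_quadSum (t : Fin (s + 1) → Fin (s + 1) → K) (c : Fin (s + 1)) :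
    rcoord (LinearMap.proj c) (quadSum t) = linSum fun a => t a c := by
  simp [linSum, quadSum, rcoord_mul_nabla]

theorem rcoord_linSum (t : Fin (s + 1) → K) (c : Fin (s + 1)) :
    rcoord (LinearMap.proj c) (linSum t) = t c • 1 := by
  simp [linSum, rcoord_nabla]

theorem smul_one_eq_zero {c : K} (h : c • (1 : TensorAlgebra K (Fin (s + 1) → K)) = 0) : c = 0 := by
  rwa [← Algebra.algebraMap_eq_smul_one, algebraMap_eq_zero_iff] at h

theorem linSum_eq_zero {t₁ : Fin (s + 1) → K} {t₀ : K} (h : linSum t₁ + t₀ • 1 = 0) :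
    t₁ = 0 ∧ t₀ = 0 := by
  have h1 : t₁ = 0 := funext fun c => by
    have := congrArg (rcoord (LinearMap.proj c)) h
    rw [map_add, rcoord_linSum, map_smul, rcoord_one, smul_zero, add_zero, map_zero] at this
    exact smul_one_eq_zero this
  subst h1
  refine ⟨rfl, smul_one_eq_zero (s := s) ?_⟩
  simpa [linSum] using h

theorem quadSum_eq_zero {t₂ : Fin (s + 1) → Fin (s + 1) → K} {t₁ : Fin (s + 1) → K} {t₀ : K}
    (h : quadSum t₂ + linSum t₁ + t₀ • 1 = 0) : t₂ = 0 ∧ t₁ = 0 ∧ t₀ = 0 := by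
  have h1 : t₂ = 0 := funext fun a => funext fun c => by
    have := congrArg (rcoord (LinearMap.proj c)) h
    rw [map_add, map_add, rcoord_quadSum, rcoord_linSum, map_smul, rcoord_one, smul_zero, add_zero,
      map_zero] at this
    exact congrFun (linSum_eq_zero this).1 a
  subst h1
  exact ⟨rfl, linSum_eq_zero (by simpa [quadSum] using h)⟩

/-- Independence of monomials of degree at most 3. A right coordinate kills constants and lowers
every other degree by one, so the top coefficients reduce to the previous lemma. -/
theorem cubicSum_eq_zero {t₃ : Fin (s + 1) → Fin (s + 1) → Fin (s + 1) → K}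
    {t₂ : Fin (s + 1) → Fin (s + 1) → K} {t₁ : Fin (s + 1) → K} {t₀ : K}
    (h : cubicSum t₃ + quadSum t₂ + linSum t₁ + t₀ • 1 = 0) :
    t₃ = 0 ∧ t₂ = 0 ∧ t₁ = 0 ∧ t₀ = 0 := by
  have h1 : t₃ = 0 := funext fun a => funext fun b => funext fun c => by
    have := congrArg (rcoord (LinearMap.proj c)) h
    rw [map_add, map_add, map_add, rcoord_cubicSum, rcoord_quadSum, rcoord_linSum, map_smul,
      rcoord_one, smul_zero, add_zero, map_zero] at this
    exact congrFun (congrFun (quadSum_eq_zero this).1 a) b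
  subst h1
  exact ⟨rfl, quadSum_eq_zero (by simpa [cubicSum] using h)⟩

theorem current_eq (j₃ : Fin (s + 1) → Fin (s + 1) → Fin (s + 1) → K)
    (j₂ : Fin (s + 1) → Fin (s + 1) → K) (j₁ : Fin (s + 1) → K) (r : Fin (s + 1)) :
    current j₃ j₂ j₁ r = quadSum (fun a b => j₃ a b r) + linSum (fun a => j₂ a r) + j₁ r • 1 := rfl

theorem sum_lie_current (j₃ : Fin (s + 1) → Fin (s + 1) → Fin (s + 1) → K)
    (j₂ : Fin (s + 1) → Fin (s + 1) → K) (j₁ : Fin (s + 1) → K) :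
    ∑ r, (nabla r * current j₃ j₂ j₁ r - current j₃ j₂ j₁ r * nabla r) =
      cubicSum (fun a b c => j₃ b c a - j₃ a b c) + quadSum (fun a b => j₂ b a - j₂ a b) := by
  have h3 : ∑ r, nabla r * quadSum (fun a b => j₃ a b r) = cubicSum fun a b c => j₃ b c a := by
    simp only [quadSum, cubicSum, Finset.mul_sum, mul_smul_comm, mul_assoc]
  have h3' : ∑ r, quadSum (fun a b => j₃ a b r) * nabla r = cubicSum fun a b c => j₃ a b c := by
    simp only [quadSum, cubicSum, Finset.sum_mul, smul_mul_assoc]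
    rw [Finset.sum_comm]
    exact Finset.sum_congr rfl fun a _ => Finset.sum_comm
  have h2 : ∑ r, nabla r * linSum (fun a => j₂ a r) = quadSum fun a b => j₂ b a := by
    simp only [quadSum, linSum, Finset.mul_sum, mul_smul_comm]
  have h2' : ∑ r, linSum (fun a => j₂ a r) * nabla r = quadSum fun a b => j₂ a b := by
    simp only [quadSum, linSum, Finset.sum_mul, smul_mul_assoc]
    exact Finset.sum_comm
  simp only [current_eq, mul_add, add_mul, Finset.sum_sub_distrib, Finset.sum_add_distrib, h3, h3',
    h2, h2', mul_smul_comm, smul_mul_assoc, mul_one, one_mul]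
  simp only [cubicSum, quadSum, sub_smul, Finset.sum_sub_distrib]
  abel

/-- The double commutator has four monomials; after renaming indices, the symmetry of `g⁻¹`
identifies the two middle ones, which explains the coefficient 2. -/
theorem ymW_eq {g : Matrix (Fin (s + 1)) (Fin (s + 1)) K} (hg : ∀ a b, g⁻¹ b a = g⁻¹ a b)
    (r : Fin (s + 1)) :
    ymW g r = cubicSum fun a b c =>
      g⁻¹ a b * g⁻¹ c r - 2 * (g⁻¹ a c * g⁻¹ b r) + g⁻¹ b c * g⁻¹ a r := by
  let x : Fin (s + 1) → Fin (s + 1) → Fin (s + 1) → K := fun l m n => g⁻¹ l m * g⁻¹ n r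
  have h1 : ymW g r = cubicSum (fun a b c => x a b c) - cubicSum (fun a b c => x a c b) -
      (cubicSum (fun a b c => x c a b) - cubicSum (fun a b c => x c b a)) := by
    have hl : ∀ l m n : Fin (s + 1), ⁅nabla (K := K) l, ⁅nabla (K := K) m, nabla n⁆⁆ =
        nabla (K := K) l * nabla m * nabla n - nabla (K := K) l * nabla n * nabla m -
          (nabla (K := K) m * nabla n * nabla l - nabla (K := K) n * nabla m * nabla l) := by
      intro l m n
      simp only [Ring.lie_def]
      noncomm_ring
    have e1 : ∑ l, ∑ m, ∑ n, x l m n • (nabla (K := K) l * nabla n * nabla m) =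
        cubicSum (fun a b c => x a c b) :=
      Finset.sum_congr rfl fun a _ => Finset.sum_comm
    have e2 : ∑ l, ∑ m, ∑ n, x l m n • (nabla (K := K) m * nabla n * nabla l) =
        cubicSum (fun a b c => x c a b) := by
      rw [Finset.sum_comm]
      exact Finset.sum_congr rfl fun a _ => Finset.sum_comm
    have e3 : ∑ l, ∑ m, ∑ n, x l m n • (nabla (K := K) n * nabla m * nabla l) =
        cubicSum (fun a b c => x c b a) := by
      calc _ = ∑ l, ∑ n, ∑ m, x l m n • (nabla (K := K) n * nabla m * nabla l) :=
            Finset.sum_congr rfl fun a _ => Finset.sum_comm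
        _ = ∑ n, ∑ l, ∑ m, x l m n • (nabla (K := K) n * nabla m * nabla l) := Finset.sum_comm
        _ = _ := Finset.sum_congr rfl fun a _ => Finset.sum_comm
    rw [← e1, ← e2, ← e3]
    simp only [ymW, hl, smul_sub, Finset.sum_sub_distrib]
    rfl
  rw [h1]
  simp only [cubicSum, ← Finset.sum_sub_distrib, ← sub_smul]
  refine Finset.sum_congr rfl fun a _ => Finset.sum_congr rfl fun b _ =>
    Finset.sum_congr rfl fun c _ => ?_
  congr 1
  simp only [x]
  rw [hg a c, hg b c]
  ring

/-- `[∇_r, J^r] + b_r (W^r - J^r)`, summed over `r`, in coordinates. -/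
theorem sum_lie_current_add {g : Matrix (Fin (s + 1)) (Fin (s + 1)) K}
    (hg : ∀ a b, g⁻¹ b a = g⁻¹ a b) (j₃ : Fin (s + 1) → Fin (s + 1) → Fin (s + 1) → K)
    (j₂ : Fin (s + 1) → Fin (s + 1) → K) (j₁ : Fin (s + 1) → K) (b : Fin (s + 1) → K) :
    ∑ r, (nabla r * current j₃ j₂ j₁ r - current j₃ j₂ j₁ r * nabla r) +
        ∑ r, b r • (ymW g r - current j₃ j₂ j₁ r) =
      cubicSum (fun α β γ => j₃ β γ α - j₃ α β γ + ∑ r, b r *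
        (g⁻¹ α β * g⁻¹ γ r - 2 * (g⁻¹ α γ * g⁻¹ β r) + g⁻¹ β γ * g⁻¹ α r)) +
      quadSum (fun α β => j₂ β α - j₂ α β - ∑ r, b r * j₃ α β r) +
      linSum (fun α => -∑ r, b r * j₂ α r) + (-∑ r, b r * j₁ r) • 1 := by
  have hcub : ∀ t : Fin (s + 1) → Fin (s + 1) → Fin (s + 1) → Fin (s + 1) → K,
      ∑ r, b r • cubicSum (t r) = cubicSum fun α β γ => ∑ r, b r * t r α β γ := by
    intro t
    simp only [cubicSum, Finset.smul_sum, smul_smul, Finset.sum_smul]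
    rw [Finset.sum_comm]
    refine Finset.sum_congr rfl fun α _ => ?_
    rw [Finset.sum_comm]
    exact Finset.sum_congr rfl fun β _ => Finset.sum_comm
  have hquad : ∀ t : Fin (s + 1) → Fin (s + 1) → Fin (s + 1) → K,
      ∑ r, b r • quadSum (t r) = quadSum fun α β => ∑ r, b r * t r α β := by
    intro t
    simp only [quadSum, Finset.smul_sum, smul_smul, Finset.sum_smul]
    rw [Finset.sum_comm]
    exact Finset.sum_congr rfl fun α _ => Finset.sum_comm
  have hlin : ∀ t : Fin (s + 1) → Fin (s + 1) → K,
      ∑ r, b r • linSum (t r) = linSum fun α => ∑ r, b r * t r α := by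
    intro t
    simp only [linSum, Finset.smul_sum, smul_smul, Finset.sum_smul]
    exact Finset.sum_comm
  have h1 : ∑ r, b r • (ymW g r - current j₃ j₂ j₁ r) =
      cubicSum (fun α β γ => ∑ r, b r *
        (g⁻¹ α β * g⁻¹ γ r - 2 * (g⁻¹ α γ * g⁻¹ β r) + g⁻¹ β γ * g⁻¹ α r)) -
      (quadSum (fun α β => ∑ r, b r * j₃ α β r) + linSum (fun α => ∑ r, b r * j₂ α r) +
        (∑ r, b r * j₁ r) • 1) := by
    simp only [ymW_eq hg, current_eq, smul_sub, smul_add, Finset.sum_sub_distrib,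
      Finset.sum_add_distrib, hcub, hquad, hlin, smul_smul, ← Finset.sum_smul]
  rw [sum_lie_current, h1]
  simp only [cubicSum, quadSum, linSum, sub_smul, add_smul, neg_smul, Finset.sum_sub_distrib,
    Finset.sum_add_distrib, Finset.sum_neg_distrib]
  abel

end Coordinates

/-! ### Passage between the given basis and the orthogonal basis. -/

section Bridge

open TensorAlgebra

variable {K : Type*} [Field K] {s : ℕ}

/-- The contraction of a bilinear map with the tensor `h` does not depend on how `h` is written.
Both the relations `W^ρ` and the defect are such contractions. -/
theorem sum_smul_bilin {T : Type*} [AddCommGroup T] [Module K T]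
    {v : Fin (s + 1) → Fin (s + 1) → K} {d : Fin (s + 1) → K}
    {h : Fin (s + 1) → Fin (s + 1) → K} (hv : ∀ l m, h l m = ∑ k, d k * v k l * v k m)
    (F : (Fin (s + 1) → K) →ₗ[K] (Fin (s + 1) → K) →ₗ[K] T) :
    ∑ l, ∑ m, h l m • F (Pi.single l 1) (Pi.single m 1) = ∑ k, d k • F (v k) (v k) := by
  have h1 : ∀ k, F (v k) (v k) =
      ∑ l, ∑ m, (v k l * v k m) • F (Pi.single l 1) (Pi.single m 1) := by
    intro k
    conv_lhs => rw [pi_eq_sum_univ' (v k)]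
    simp only [map_sum, map_smul, LinearMap.sum_apply, LinearMap.smul_apply, Finset.smul_sum,
      smul_smul]
    rw [Finset.sum_comm]
    exact Finset.sum_congr rfl fun l _ => Finset.sum_congr rfl fun m _ => by rw [mul_comm]
  simp only [h1, Finset.smul_sum, smul_smul, hv, Finset.sum_smul, ← mul_assoc]
  calc _ = ∑ l, ∑ k, ∑ m, (d k * v k l * v k m) • F (Pi.single l 1) (Pi.single m 1) :=
        Finset.sum_congr rfl fun l _ => Finset.sum_comm
    _ = _ := Finset.sum_comm

variable {g : Matrix (Fin (s + 1)) (Fin (s + 1)) K}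

/-- The vector with coordinates `g^{νρ}`, for fixed `ρ`. -/
def invCol (g : Matrix (Fin (s + 1)) (Fin (s + 1)) K) (r : Fin (s + 1)) : Fin (s + 1) → K :=
  fun n => g⁻¹ n r

theorem ι_eq_sum_nabla (u : Fin (s + 1) → K) : ι K u = ∑ n, u n • nabla n := by
  conv_lhs => rw [pi_eq_sum_univ' u]
  rw [map_sum]
  simp only [map_smul]
  rfl

/-- The linear extension of `J^ρ` to a map on vectors, with value `J^ρ` at `g^{νρ} ∇_ν`. -/
def currentMap (g : Matrix (Fin (s + 1)) (Fin (s + 1)) K)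
    (J : Fin (s + 1) → TensorAlgebra K (Fin (s + 1) → K)) :
    (Fin (s + 1) → K) →ₗ[K] TensorAlgebra K (Fin (s + 1) → K) :=
  (Fintype.linearCombination K J).comp g.mulVecLin

theorem currentMap_apply (J : Fin (s + 1) → TensorAlgebra K (Fin (s + 1) → K))
    (u : Fin (s + 1) → K) : currentMap g J u = ∑ r, (g.mulVec u) r • J r := by
  simp [currentMap, Fintype.linearCombination_apply]

theorem mulVec_invCol (hdet : IsUnit g.det) (r : Fin (s + 1)) :
    g.mulVec (invCol g r) = Pi.single r 1 := by
  funext l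
  have := congrFun (congrFun (Matrix.mul_nonsing_inv g hdet) l) r
  rw [Matrix.mul_apply, Matrix.one_apply] at this
  rw [Pi.single_apply]
  exact this

theorem currentMap_invCol (hdet : IsUnit g.det)
    (J : Fin (s + 1) → TensorAlgebra K (Fin (s + 1) → K)) (r : Fin (s + 1)) :
    currentMap g J (invCol g r) = J r := by
  rw [currentMap_apply, mulVec_invCol hdet]
  simp [Pi.single_apply]

theorem sum_mulVec_invCol (hdet : IsUnit g.det) (u : Fin (s + 1) → K) :
    ∑ r, (g.mulVec u) r • invCol g r = u := by
  have h : g⁻¹.mulVec (g.mulVec u) = u := by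
    rw [Matrix.mulVec_mulVec, Matrix.nonsing_inv_mul g hdet, Matrix.one_mulVec]
  conv_rhs => rw [← h]
  funext l
  simp only [Finset.sum_apply, Pi.smul_apply, smul_eq_mul, invCol, Matrix.mulVec, dotProduct]
  exact Finset.sum_congr rfl fun r _ => mul_comm _ _

variable {v : Module.Basis (Fin (s + 1)) K (Fin (s + 1) → K)} {d : Fin (s + 1) → K}

theorem ymW_eq_ymMap (hv : ∀ l m, g⁻¹ l m = ∑ k, d k * v k l * v k m) (r : Fin (s + 1)) :
    ymW g r = ymMap v d (invCol g r) := by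
  let F : (Fin (s + 1) → K) →ₗ[K] (Fin (s + 1) → K) →ₗ[K] TensorAlgebra K (Fin (s + 1) → K) :=
    LinearMap.mk₂ K (fun x y => ⁅ι K x, ⁅ι K y, ι K (invCol g r)⁆⁆)
      (fun x x' y => by simp only [map_add, Ring.lie_def]; noncomm_ring)
      (fun c x y => by
        simp only [map_smul, Ring.lie_def, smul_mul_assoc, mul_smul_comm, smul_sub])
      (fun x y y' => by simp only [map_add, Ring.lie_def]; noncomm_ring)
      (fun c x y => by
        simp only [map_smul, Ring.lie_def, smul_mul_assoc, mul_smul_comm, ← smul_sub])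
  have h := sum_smul_bilin hv F
  rw [ymMap_apply]
  refine Eq.trans ?_ h
  rw [ymW]
  refine Finset.sum_congr rfl fun l _ => Finset.sum_congr rfl fun m _ => ?_
  change _ = g⁻¹ l m • ⁅nabla (K := K) l, ⁅nabla (K := K) m, ι K (invCol g r)⁆⁆
  rw [ι_eq_sum_nabla]
  simp only [Ring.lie_def, Finset.mul_sum, Finset.sum_mul, ← Finset.sum_sub_distrib,
    Finset.smul_sum, mul_smul_comm, smul_mul_assoc, ← smul_sub, smul_smul]
  rfl

theorem sum_lie_currentMap (hv : ∀ l m, g⁻¹ l m = ∑ k, d k * v k l * v k m)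
    (hg : ∀ a b, g⁻¹ b a = g⁻¹ a b) (hdet : IsUnit g.det)
    (J : Fin (s + 1) → TensorAlgebra K (Fin (s + 1) → K)) :
    ∑ k, d k • (ι K (v k) * currentMap g J (v k) - currentMap g J (v k) * ι K (v k)) =
      ∑ r, (nabla r * J r - J r * nabla r) := by
  let F : (Fin (s + 1) → K) →ₗ[K] (Fin (s + 1) → K) →ₗ[K] TensorAlgebra K (Fin (s + 1) → K) :=
    LinearMap.mk₂ K (fun x y => ι K x * currentMap g J y - currentMap g J y * ι K x)
      (fun x x' y => by simp only [map_add]; noncomm_ring)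
      (fun c x y => by simp only [map_smul, smul_mul_assoc, mul_smul_comm, smul_sub])
      (fun x y y' => by simp only [map_add]; noncomm_ring)
      (fun c x y => by simp only [map_smul, smul_mul_assoc, mul_smul_comm, smul_sub])
  refine (sum_smul_bilin hv F).symm.trans (Finset.sum_congr rfl fun l _ => ?_)
  change ∑ m, g⁻¹ l m • (nabla l * currentMap g J (Pi.single m 1) -
    currentMap g J (Pi.single m 1) * nabla l) = _
  have h1 : ∑ m, g⁻¹ l m • currentMap g J (Pi.single m 1) = J l := by
    rw [← currentMap_invCol hdet J l]
    conv_rhs => rw [pi_eq_sum_univ' (invCol g l)]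
    simp only [map_sum, map_smul, invCol, hg l]
  conv_rhs => rw [← h1]
  simp only [Finset.mul_sum, Finset.sum_mul, mul_smul_comm, smul_mul_assoc, smul_sub,
    Finset.sum_sub_distrib]

theorem ymRelations_eq (hv : ∀ l m, g⁻¹ l m = ∑ k, d k * v k l * v k m) (hdet : IsUnit g.det)
    (j₃ : Fin (s + 1) → Fin (s + 1) → Fin (s + 1) → K)
    (j₂ : Fin (s + 1) → Fin (s + 1) → K) (j₁ : Fin (s + 1) → K) :
    ymRelations g j₃ j₂ j₁ = ymDefRels v d (currentMap g (current j₃ j₂ j₁)) := by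
  let f := ymMap v d - currentMap g (current j₃ j₂ j₁)
  -- Relations are linear in a vector, so either basis generates the same space: the basis vectors
  -- `v_k` give one generating family, the columns of `g⁻¹` the other.
  have h1 : ymDefRels v d (currentMap g (current j₃ j₂ j₁)) = LinearMap.range f := by
    rw [LinearMap.range_eq_map, ← v.span_eq, Submodule.map_span, ← Set.range_comp]
    rfl
  have h2 : ∀ r, ymW g r - current j₃ j₂ j₁ r = f (invCol g r) := fun r => by
    rw [LinearMap.sub_apply, ymW_eq_ymMap hv, currentMap_invCol hdet]
  rw [h1]
  apply le_antisymm
  · refine Submodule.span_le.2 ?_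
    rintro _ ⟨r, rfl⟩
    exact ⟨_, (h2 r).symm⟩
  · rintro _ ⟨u, rfl⟩
    rw [← sum_mulVec_invCol hdet u, map_sum]
    refine sum_mem fun r _ => ?_
    rw [map_smul, ← h2]
    exact Submodule.smul_mem _ _ (Submodule.subset_span ⟨r, rfl⟩)

theorem currentMap_mem (j₃ : Fin (s + 1) → Fin (s + 1) → Fin (s + 1) → K)
    (j₂ : Fin (s + 1) → Fin (s + 1) → K) (j₁ : Fin (s + 1) → K) (u : Fin (s + 1) → K) :
    currentMap g (current j₃ j₂ j₁) u ∈ tensorBelow K (Fin (s + 1) → K) 3 := by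
  rw [currentMap_apply]
  refine sum_mem fun r _ => Submodule.smul_mem _ _ (add_mem (add_mem ?_ ?_) ?_)
  · exact sum_mem fun a _ => sum_mem fun b _ => Submodule.smul_mem _ _
      (tensorDeg_le_tensorBelow (by norm_num : 2 < 3)
        (mul_mem_tensorDeg (ι_mem_tensorDeg _) (ι_mem_tensorDeg _) rfl))
  · exact sum_mem fun a _ => Submodule.smul_mem _ _
      (tensorDeg_le_tensorBelow (by norm_num : 1 < 3) (ι_mem_tensorDeg _))
  · exact Submodule.smul_mem _ _
      (tensorDeg_le_tensorBelow (by norm_num : 0 < 3) one_mem_tensorDeg)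

theorem inv_symm (hg : g.IsSymm) (a b : Fin (s + 1)) : g⁻¹ b a = g⁻¹ a b := by
  have h : (g⁻¹).IsSymm := by
    rw [Matrix.IsSymm, Matrix.transpose_nonsing_inv, hg.eq]
  exact h.apply a b

/-- The PBW property of an inhomogeneous Yang–Mills algebra in coordinates. -/
theorem hasPBW_ymRelations_iff (h2 : (2 : K) ≠ 0) (hs : 1 ≤ s) (hg : g.IsSymm)
    (hdet : IsUnit g.det) (j₃ : Fin (s + 1) → Fin (s + 1) → Fin (s + 1) → K)
    (j₂ : Fin (s + 1) → Fin (s + 1) → K) (j₁ : Fin (s + 1) → K) :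
    HasPBW 3 (ymRelations g j₃ j₂ j₁) ↔ ∃ b : Fin (s + 1) → K,
      (∀ α β γ, j₃ β γ α - j₃ α β γ + ∑ r, b r *
        (g⁻¹ α β * g⁻¹ γ r - 2 * (g⁻¹ α γ * g⁻¹ β r) + g⁻¹ β γ * g⁻¹ α r) = 0) ∧
      (∀ α β, j₂ β α - j₂ α β - ∑ r, b r * j₃ α β r = 0) ∧
      (∀ α, ∑ r, b r * j₂ α r = 0) ∧ ∑ r, b r * j₁ r = 0 := by
  obtain ⟨v, d, hd, hv⟩ := exists_basis_inv_eq h2 hg hdet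
  have hsymm := inv_symm hg
  rw [ymRelations_eq hv hdet, hasPBW_ymDefRels_iff hd hs (currentMap_mem j₃ j₂ j₁),
    sum_lie_currentMap hv hsymm hdet, ← ymRelations_eq hv hdet, ymRelations,
    Submodule.mem_span_range_iff_exists_fun]
  constructor
  · rintro ⟨c, hc⟩
    -- The coefficients of the defect in terms of the relations are `-b`, in accordance with the
    -- sign convention of the statement.
    have h1 := sum_lie_current_add hsymm j₃ j₂ j₁ (-c)
    have h0 : ∑ r, (nabla r * current j₃ j₂ j₁ r - current j₃ j₂ j₁ r * nabla r) +
        ∑ r, (-c) r • (ymW g r - current j₃ j₂ j₁ r) = 0 := by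
      rw [← hc]
      simp only [Pi.neg_apply, neg_smul, Finset.sum_neg_distrib, add_neg_cancel]
    rw [h0] at h1
    obtain ⟨e3, e2, e1, e0⟩ := cubicSum_eq_zero h1.symm
    refine ⟨-c, fun α β γ => ?_, fun α β => ?_, fun α => ?_, ?_⟩
    · simpa using congrFun (congrFun (congrFun e3 α) β) γ
    · simpa using congrFun (congrFun e2 α) β
    · simpa using congrFun e1 α
    · simpa using e0
  · rintro ⟨b, e3, e2, e1, e0⟩
    have h1 := sum_lie_current_add hsymm j₃ j₂ j₁ b
    simp only [e3, e2, e1, e0, cubicSum, quadSum, linSum, neg_zero, zero_smul,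
      Finset.sum_const_zero, add_zero] at h1
    refine ⟨-b, ?_⟩
    rw [eq_neg_of_add_eq_zero_left h1]
    simp only [Pi.neg_apply, neg_smul, Finset.sum_neg_distrib]

theorem isKoszulHomogeneous_ymRelations (h2 : (2 : K) ≠ 0) (hs : 1 ≤ s) (hg : g.IsSymm)
    (hdet : IsUnit g.det) (j₃ : Fin (s + 1) → Fin (s + 1) → Fin (s + 1) → K)
    (j₂ : Fin (s + 1) → Fin (s + 1) → K) (j₁ : Fin (s + 1) → K) :
    IsKoszulHomogeneous 3 (leadingPart 3 (ymRelations g j₃ j₂ j₁)) := by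
  obtain ⟨v, d, hd, hv⟩ := exists_basis_inv_eq h2 hg hdet
  rw [ymRelations_eq hv hdet, leadingPart_ymDefRels v d (currentMap_mem j₃ j₂ j₁)]
  exact isKoszulHomogeneous_ymRels v hd hs

end Bridge

/-! ### Solving the coefficient equations for the current. -/

section CurrentDecomposition

variable {K : Type*} [Field K] {κ : Type*} [Fintype κ]

theorem sum_sum_mul_mul_eq_zero_of_antisymm (h2 : (2 : K) ≠ 0) {w : κ → κ → K}
    (hw : ∀ a b, w b a = -w a b) (b : κ → K) : ∑ r, (∑ ρ, w r ρ * b ρ) * b r = 0 := by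
  have h : ∑ r, (∑ ρ, w r ρ * b ρ) * b r = -∑ r, (∑ ρ, w r ρ * b ρ) * b r := by
    conv_lhs =>
      simp only [Finset.sum_mul]
      rw [Finset.sum_comm]
    simp only [Finset.sum_mul, ← Finset.sum_neg_distrib]
    refine Finset.sum_congr rfl fun r _ => Finset.sum_congr rfl fun ρ _ => ?_
    rw [hw r ρ]
    ring
  have h' : (2 : K) * ∑ r, (∑ ρ, w r ρ * b ρ) * b r = 0 := by linear_combination h
  exact (mul_eq_zero.1 h').resolve_left h2

/-- The cubic equation fixes `j₃` up to cyclically invariant tensors, and with 2 invertible these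
are sums of an antisymmetric and a symmetric tensor, as a 3-cycle and a transposition generate
`S_3`. The quadratic equation then fixes the antisymmetric part of `j₂` and forces `s₃` to be
annihilated by `b`; the last two equations do the same for `s₂` and `s₁`. -/
theorem exists_current_decomposition_iff (h2 : (2 : K) ≠ 0) {h : κ → κ → K}
    (hh : ∀ a b, h b a = h a b) (j₃ : κ → κ → κ → K) (j₂ : κ → κ → K) (j₁ : κ → K) :
    (∃ b : κ → K,
      (∀ α β γ, j₃ β γ α - j₃ α β γ + ∑ r, b r *
        (h α β * h γ r - 2 * (h α γ * h β r) + h β γ * h α r) = 0) ∧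
      (∀ α β, j₂ β α - j₂ α β - ∑ r, b r * j₃ α β r = 0) ∧
      (∀ α, ∑ r, b r * j₂ α r = 0) ∧ ∑ r, b r * j₁ r = 0) ↔
    ∃ (b : κ → K) (ω : κ → κ → κ → K) (s₃ : κ → κ → κ → K) (s₂ : κ → κ → K) (s₁ : κ → K),
      (∀ α β γ, ω β α γ = -ω α β γ ∧ ω α γ β = -ω α β γ) ∧
      (∀ α β γ, s₃ β α γ = s₃ α β γ ∧ s₃ α γ β = s₃ α β γ) ∧
      (∀ α β, s₂ β α = s₂ α β) ∧
      (∀ α β, ∑ ρ, s₃ α β ρ * b ρ = 0) ∧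
      (∀ α, ∑ ρ, s₂ α ρ * b ρ = 0) ∧
      (∑ ρ, s₁ ρ * b ρ = 0) ∧
      (∀ α β γ, j₃ α β γ =
        (∑ ρ, (h α ρ * h β γ - h α γ * h β ρ) * b ρ) + ω α β γ + s₃ α β γ) ∧
      (∀ α β, j₂ α β = -(1 / 2) * (∑ ρ, ω α β ρ * b ρ) + s₂ α β) ∧
      (∀ α, j₁ α = s₁ α) := by
  let B : (κ → K) → κ → K := fun b α => ∑ ρ, h α ρ * b ρ
  have hB1 : ∀ b α β γ, ∑ ρ, (h α ρ * h β γ - h α γ * h β ρ) * b ρ =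
      B b α * h β γ - h α γ * B b β := by
    intro b α β γ
    simp only [B, Finset.sum_mul, Finset.mul_sum, ← Finset.sum_sub_distrib]
    exact Finset.sum_congr rfl fun ρ _ => by ring
  have hB2 : ∀ b α β γ, ∑ r, b r * (h α β * h γ r - 2 * (h α γ * h β r) + h β γ * h α r) =
      h α β * B b γ - 2 * (h α γ * B b β) + h β γ * B b α := by
    intro b α β γ
    simp only [B, Finset.mul_sum, ← Finset.sum_sub_distrib, ← Finset.sum_add_distrib]
    exact Finset.sum_congr rfl fun ρ _ => by ring
  -- The particular solution of the cubic equation contracts to 0 with `b`, so it does not enter the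
  -- quadratic equation.
  have hB3 : ∀ b α β, ∑ r, b r * (B b α * h β r - h α r * B b β) = 0 := by
    intro b α β
    have : ∑ r, b r * (B b α * h β r - h α r * B b β) = B b α * B b β - B b α * B b β := by
      conv_rhs =>
        congr
        · rw [show B b β = ∑ r, h β r * b r from rfl, Finset.mul_sum]
        · rw [show B b α = ∑ r, h α r * b r from rfl, Finset.sum_mul]
      rw [← Finset.sum_sub_distrib]
      exact Finset.sum_congr rfl fun r _ => by ring
    rw [this, sub_self]
  simp only [hB1, hB2]
  constructor
  · rintro ⟨b, e3, e2, e1, e0⟩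
    let u : κ → κ → κ → K := fun α β γ => j₃ α β γ - (B b α * h β γ - h α γ * B b β)
    have hu : ∀ α β γ, u β γ α = u α β γ := by
      intro α β γ
      have := e3 α β γ
      simp only [u]
      rw [hh α γ, hh α β]
      linear_combination this
    -- As `u` is cyclically invariant, (anti)symmetrizing in the first two indices alone already
    -- gives a completely (anti)symmetric tensor.
    let ω : κ → κ → κ → K := fun α β γ => (u α β γ - u β α γ) / 2
    have hω' : ∀ α β γ, ω α γ β = -ω α β γ := fun α β γ => by
      simp only [ω]
      rw [hu β α γ, ← hu γ α β]
      ring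
    let s₃ : κ → κ → κ → K := fun α β γ => (u α β γ + u β α γ) / 2
    have hω : ∀ α β γ, ω β α γ = -ω α β γ := fun α β γ => by simp only [ω]; ring
    have hs₃ : ∀ α β γ, s₃ β α γ = s₃ α β γ := fun α β γ => by simp only [s₃]; ring
    have hj : ∀ α β γ, j₃ α β γ = B b α * h β γ - h α γ * B b β + ω α β γ + s₃ α β γ := by
      intro α β γ
      simp only [ω, s₃, u]
      field_simp
      ring
    have hsum : ∀ α β, ∑ r, b r * j₃ α β r = ∑ r, ω α β r * b r + ∑ r, s₃ α β r * b r := by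
      intro α β
      rw [← zero_add (∑ r, ω α β r * b r), ← hB3 b α β, ← Finset.sum_add_distrib,
        ← Finset.sum_add_distrib]
      refine Finset.sum_congr rfl fun r _ => ?_
      rw [hj]
      ring
    have hωsum : ∀ α β, ∑ r, ω β α r * b r = -∑ r, ω α β r * b r := by
      intro α β
      simp only [hω α β, neg_mul, Finset.sum_neg_distrib]
    have hs₃b : ∀ α β, ∑ ρ, s₃ α β ρ * b ρ = 0 := by
      intro α β
      -- Adding the equations for `(α, β)` and `(β, α)` cancels `j₂` and `ω` and leaves twice the
      -- contraction of `s₃` with `b`.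
      have h3 := e2 α β
      have h4 := e2 β α
      rw [hsum] at h3 h4
      rw [hωsum α β] at h4
      simp only [hs₃ α β] at h4
      have h5 : (2 : K) * ∑ ρ, s₃ α β ρ * b ρ = 0 := by linear_combination -h3 - h4
      exact (mul_eq_zero.1 h5).resolve_left h2
    refine ⟨b, ω, s₃, fun α β => j₂ α β + 1 / 2 * ∑ ρ, ω α β ρ * b ρ, j₁,
      fun α β γ => ⟨hω α β γ, hω' α β γ⟩, fun α β γ => ⟨hs₃ α β γ, ?_⟩, fun α β => ?_, hs₃b, fun α => ?_,
      ?_, hj, fun α β => ?_, fun _ => rfl⟩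
    · simp only [s₃]
      rw [hu β α γ, ← hu γ α β]
      ring
    · have h3 := e2 α β
      rw [hsum, hs₃b] at h3
      beta_reduce
      rw [hωsum α β]
      field_simp
      linear_combination (2 : K) * h3
    -- The contribution of `ω` is contracted twice with `b` and vanishes by antisymmetry, so the
    -- linear equation passes from `j₂` to `s₂`.
    · have h3 := sum_sum_mul_mul_eq_zero_of_antisymm h2 (w := fun β ρ => ω α β ρ)
        (fun a c => hω' α a c) b
      have h4 := e1 α
      simp only [add_mul, Finset.sum_add_distrib, mul_assoc, ← Finset.mul_sum]
      rw [h3, mul_zero, add_zero, ← h4]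
      exact Finset.sum_congr rfl fun r _ => mul_comm _ _
    · rw [← e0]
      exact Finset.sum_congr rfl fun r _ => mul_comm _ _
    · ring
  · rintro ⟨b, ω, s₃, s₂, s₁, hω, hs₃, hs₂, hs₃b, hs₂b, hs₁b, hj₃, hj₂, hj₁⟩
    refine ⟨b, fun α β γ => ?_, fun α β => ?_, fun α => ?_, ?_⟩
    · have w1 : ω β γ α = ω α β γ := by
        rw [(hω β α γ).2, (hω α β γ).1, neg_neg]
      have w2 : s₃ β γ α = s₃ α β γ := by rw [(hs₃ β α γ).2, (hs₃ α β γ).1]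
      rw [hj₃, hj₃, w1, w2, hh α γ, hh α β]
      ring
    · have h3 : ∑ r, b r * j₃ α β r = ∑ r, ω α β r * b r := by
        have h4 : ∑ r, b r * j₃ α β r = ∑ r, b r * (B b α * h β r - h α r * B b β) +
            ∑ r, ω α β r * b r + ∑ r, s₃ α β r * b r := by
          rw [← Finset.sum_add_distrib, ← Finset.sum_add_distrib]
          refine Finset.sum_congr rfl fun r _ => ?_
          rw [hj₃]
          ring
        rw [h4, hB3, hs₃b, zero_add, add_zero]
      have h4 : ∑ r, ω β α r * b r = -∑ r, ω α β r * b r := by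
        simp only [(hω α β _).1, neg_mul, Finset.sum_neg_distrib]
      rw [h3, hj₂, hj₂, h4, hs₂ α β]
      field_simp
      ring
    · have h3 := sum_sum_mul_mul_eq_zero_of_antisymm h2 (w := fun β ρ => ω α β ρ)
        (fun a c => (hω α a c).2) b
      have h4 : ∑ r, b r * j₂ α r = -(1 / 2) * ∑ r, (∑ ρ, ω α r ρ * b ρ) * b r +
          ∑ r, s₂ α r * b r := by
        rw [Finset.mul_sum, ← Finset.sum_add_distrib]
        refine Finset.sum_congr rfl fun r _ => ?_
        rw [hj₂]
        ring
      rw [h4, h3, hs₂b, mul_zero, add_zero]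
    · rw [← hs₁b]
      exact Finset.sum_congr rfl fun r _ => by rw [hj₁, mul_comm]

end CurrentDecomposition

end InhomYM

end

theorem theorem5 {K : Type*} [Field K] (h2 : (2 : K) ≠ 0) (s : ℕ) (hs : 1 ≤ s)
    (g : Matrix (Fin (s + 1)) (Fin (s + 1)) K) (hg : g.IsSymm) (hdet : IsUnit g.det)
    (j₃ : Fin (s + 1) → Fin (s + 1) → Fin (s + 1) → K)
    (j₂ : Fin (s + 1) → Fin (s + 1) → K) (j₁ : Fin (s + 1) → K) :
    (InhomYM.IsKoszul 3 (InhomYM.ymRelations g j₃ j₂ j₁) ↔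
      InhomYM.HasPBW 3 (InhomYM.ymRelations g j₃ j₂ j₁)) ∧
    (InhomYM.HasPBW 3 (InhomYM.ymRelations g j₃ j₂ j₁) ↔
      ∃ (b : Fin (s + 1) → K)
        (ω : Fin (s + 1) → Fin (s + 1) → Fin (s + 1) → K)
        (s₃ : Fin (s + 1) → Fin (s + 1) → Fin (s + 1) → K)
        (s₂ : Fin (s + 1) → Fin (s + 1) → K) (s₁ : Fin (s + 1) → K),
        (∀ α β γ, ω β α γ = -ω α β γ ∧ ω α γ β = -ω α β γ) ∧
        (∀ α β γ, s₃ β α γ = s₃ α β γ ∧ s₃ α γ β = s₃ α β γ) ∧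
        (∀ α β, s₂ β α = s₂ α β) ∧
        (∀ α β, ∑ ρ, s₃ α β ρ * b ρ = 0) ∧
        (∀ α, ∑ ρ, s₂ α ρ * b ρ = 0) ∧
        (∑ ρ, s₁ ρ * b ρ = 0) ∧
        (∀ α β γ, j₃ α β γ =
          (∑ ρ, (g⁻¹ α ρ * g⁻¹ β γ - g⁻¹ α γ * g⁻¹ β ρ) * b ρ) + ω α β γ + s₃ α β γ) ∧
        (∀ α β, j₂ α β = -(1 / 2) * (∑ ρ, ω α β ρ * b ρ) + s₂ α β) ∧
        (∀ α, j₁ α = s₁ α)) := by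
  refine ⟨⟨fun h => h.2, fun h =>
    ⟨InhomYM.isKoszulHomogeneous_ymRelations h2 hs hg hdet j₃ j₂ j₁, h⟩⟩, ?_⟩
  rw [InhomYM.hasPBW_ymRelations_iff h2 hs hg hdet]
  exact InhomYM.exists_current_decomposition_iff h2 (InhomYM.inv_symm hg) j₃ j₂ j₁
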